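/- Let $y^{(n)}+a_{n-1}(z)\,y^{(n-1)}+\dots+a_1(z)\,y'+a_0(z)\,y=0$, with $a_i\in\mathbb{C}(z)$, be a Fuchsian differential equation on $\mathbb{P}^1(\mathbb{C})$, let $P\in\mathbb{P}^1(\mathbb{C})$, and let $b\in\mathbb{C}$ be a nonsingular base point near $P$ (in the local parameter $t=z-P$, or $t=1/z$ if $P=\infty$, the closed punctured disc $0<|t|\le |t(b)|$ contains no singular point). Suppose that the monodromy group $G$ of the equation at $b$ is isomorphic to a finite dihedral group $D_m$ of order $2m$, $m\ge 1$, and that the local exponents $\lambda_1,\dots,\lambda_n$ at $P$ are pairwise distinct modulo $\mathbb{Z}$. If $n=2$ and $\lambda_1,\lambda_2\in\frac12\mathbb{Z}$, assume moreover that $m\in\{1,2,4\}$. A germ at $b$ of a solution is called *radical* if it equals $R^{1/N}$ with $R\in\mathbb{C}(z)$ and $N\ge 1$. For $g\in\mathbb{C}(z)$ it is called *dihedral with respect to $\sqrt g$* if it is a member of a pair of linearly independent solutions of the form $(p\pm q\sqrt g)^{1/N}$ with $p,q\in\mathbb{C}(z)$ and $N\ge 1$. A germ at $b$ has vanishing order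 $\mu$ at $P$ if it continues analytically to the universal cover of the punctured disc at $P$ and is asymptotic to $c\,t^{\mu}$, $c\neq 0$, as $z\to P$ radially from $b$. Then there are $g\in\mathbb{C}(z)$ and a basis $f_1,\dots,f_n$ of the space of solutions at $b$ such that every $f_i$ is radical or dihedral with respect to $\sqrt g$, and $f_i$ has vanishing order $\lambda_i$ at $P$. Moreover, for each $i$, every solution at $b$ that is radical or dihedral with respect to $\sqrt g$ and has vanishing order $\lambda_i$ at $P$ is a scalar multiple of $f_i$. -/

import Mathlib

open Filter Topology

namespace LinODE

noncomputable section

/-! A family `a : Fin n → RatFunc ℂ` stands for the linear differential equation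
`y⁽ⁿ⁾ + a_{n-1}(z) y⁽ⁿ⁻¹⁾ + ⋯ + a_1(z) y' + a_0(z) y = 0` on the Riemann sphere
`OnePoint ℂ = ℂ ∪ {∞}`. -/

/-- The value at `z ∈ ℂ` of a rational function (used away from its poles). -/
def ratVal (f : RatFunc ℂ) (z : ℂ) : ℂ := RatFunc.eval (RingHom.id ℂ) z f

/-- The rational function `f` has no pole at the point `P` of the sphere. -/
def RegularAt (f : RatFunc ℂ) : OnePoint ℂ → Prop
  | OnePoint.infty => f.num.natDegree ≤ f.denom.natDegree
  | OnePoint.some p => f.denom.eval p ≠ 0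

/-- The value at `P` of a rational function that has no pole there (`f.denom` is monic). -/
def valueAt (f : RatFunc ℂ) : OnePoint ℂ → ℂ
  | OnePoint.infty => f.num.coeff f.denom.natDegree
  | OnePoint.some p => ratVal f p

/-- The factor `z - p` for a finite point `p`, and `z` for the point `∞`. -/
def scale : OnePoint ℂ → RatFunc ℂ
  | OnePoint.infty => RatFunc.X
  | OnePoint.some p => RatFunc.X - RatFunc.C p

/-- The equation is Fuchsian: every point of the sphere is regular or a regular singularity.
At a finite point `p`, `a_i` has a pole of order at most `n - i`;
at `∞`, `a_i(z) = O(z^{-(n-i)})`. -/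
def IsFuchsian {n : ℕ} (a : Fin n → RatFunc ℂ) : Prop :=
  ∀ (P : OnePoint ℂ) (i : Fin n), RegularAt (scale P ^ (n - (i : ℕ)) * a i) P

/-- The indicial polynomial at `P`. With `c_i` the value at `P` of `(z-p)^{n-i} a_i(z)`
(respectively of `z^{n-i} a_i(z)` at `∞`), it is
`[X]_n + ∑_{i<n} c_i [X]_i` where `[X]_i = X (X-1) ⋯ (X-i+1)`, and at `∞`, where the local
parameter is `1/z`, the variable `X` is replaced by `-X`. -/
def indicialPolynomial {n : ℕ} (a : Fin n → RatFunc ℂ) (P : OnePoint ℂ) : Polynomial ℂ :=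
  let I : Polynomial ℂ := descPochhammer ℂ n +
    ∑ i : Fin n, Polynomial.C (valueAt (scale P ^ (n - (i : ℕ)) * a i) P) * descPochhammer ℂ i
  match P with
  | OnePoint.infty => I.comp (-Polynomial.X)
  | OnePoint.some _ => I

/-- `lam` lists the local exponents at `P`, with multiplicity. -/
def IsLocalExponents {n : ℕ} (a : Fin n → RatFunc ℂ) (P : OnePoint ℂ) (lam : Fin n → ℂ) : Prop :=
  (indicialPolynomial a P).roots = Finset.univ.val.map lam

/-- The finite singular points: the poles in `ℂ` of the coefficients. -/
def singularSet {n : ℕ} (a : Fin n → RatFunc ℂ) : Set ℂ :=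
  {z | ∃ i, (a i).denom.eval z = 0}

/-- The function `F` is a holomorphic solution in a neighbourhood of `b`. -/
def IsSolutionAt {n : ℕ} (a : Fin n → RatFunc ℂ) (b : ℂ) (F : ℂ → ℂ) : Prop :=
  AnalyticAt ℂ F b ∧
    ∀ᶠ z in 𝓝 b, iteratedDeriv n F z + ∑ i : Fin n, ratVal (a i) z * iteratedDeriv i F z = 0

theorem IsSolutionAt.add {n : ℕ} {a : Fin n → RatFunc ℂ} {b : ℂ} {F G : ℂ → ℂ}
    (hF : IsSolutionAt a b F) (hG : IsSolutionAt a b G) : IsSolutionAt a b (F + G) := by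
  refine ⟨hF.1.add hG.1, ?_⟩
  filter_upwards [hF.2, hG.2, hF.1.eventually_analyticAt, hG.1.eventually_analyticAt]
    with z h1 h2 h3 h4
  have key : ∀ k : ℕ, iteratedDeriv k (F + G) z = iteratedDeriv k F z + iteratedDeriv k G z :=
    fun k => iteratedDeriv_add h3.contDiffAt h4.contDiffAt
  simp only [key, mul_add, Finset.sum_add_distrib]
  linear_combination h1 + h2

theorem IsSolutionAt.smul {n : ℕ} {a : Fin n → RatFunc ℂ} {b : ℂ} {F : ℂ → ℂ} (c : ℂ)
    (hF : IsSolutionAt a b F) : IsSolutionAt a b (c • F) := by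
  refine ⟨hF.1.const_smul, ?_⟩
  filter_upwards [hF.2, hF.1.eventually_analyticAt] with z h1 h3
  have key : ∀ k : ℕ, iteratedDeriv k (c • F) z = c * iteratedDeriv k F z := fun k => by
    rw [iteratedDeriv_const_smul h3.contDiffAt c, smul_eq_mul]
  simp only [key, mul_left_comm _ c, ← Finset.mul_sum]
  linear_combination c * h1

/-- The space of germs at `b` of holomorphic solutions. -/
def solutionSpace {n : ℕ} (a : Fin n → RatFunc ℂ) (b : ℂ) : Submodule ℂ (Germ (𝓝 b) ℂ) where
  carrier := {φ | ∃ F : ℂ → ℂ, IsSolutionAt a b F ∧ φ = (F : Germ (𝓝 b) ℂ)}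
  zero_mem' := by
    refine ⟨0, ⟨analyticAt_const, Eventually.of_forall fun z => ?_⟩, rfl⟩
    simp
  add_mem' := by
    rintro _ _ ⟨F, hF, rfl⟩ ⟨G, hG, rfl⟩
    exact ⟨F + G, hF.add hG, rfl⟩
  smul_mem' := by
    rintro c _ ⟨F, hF, rfl⟩
    exact ⟨c • F, hF.smul c, rfl⟩

/-- The germ `ψ` is obtained from the germ `φ` by analytic continuation along the loop `γ`. -/
def ContinuesTo {b : ℂ} (γ : Path b b) (φ ψ : Germ (𝓝 b) ℂ) : Prop :=
  ∃ F : unitInterval → ℂ → ℂ,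
    (∀ t, AnalyticAt ℂ (F t) (γ t)) ∧
    (∀ t, ∀ᶠ s in 𝓝 t, F s =ᶠ[𝓝 (γ s)] F t) ∧
    φ = (F 0 : Germ (𝓝 b) ℂ) ∧ ψ = (F 1 : Germ (𝓝 b) ℂ)

/-- The monodromy group with base point `b`: it is generated by (in fact it consists of) the
linear automorphisms of the solution space given by analytic continuation along loops at `b`
that avoid the singular points. -/
def monodromyGroup {n : ℕ} (a : Fin n → RatFunc ℂ) (b : ℂ) :
    Subgroup (solutionSpace a b ≃ₗ[ℂ] solutionSpace a b) :=
  Subgroup.closure {T | ∃ γ : Path b b, (∀ t, γ t ∉ singularSet a) ∧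
    ∀ φ : solutionSpace a b, ContinuesTo γ (φ : Germ (𝓝 b) ℂ) (T φ : Germ (𝓝 b) ℂ)}

/-- The local parameter at `P`: `z - p` at a finite point `p`, and `1/z` at `∞`. -/
def localParam : OnePoint ℂ → ℂ → ℂ
  | OnePoint.infty => fun z => z⁻¹
  | OnePoint.some p => fun z => z - p

/-- `b` is a base point near `P`: it differs from `P`, and the closed disc around `P` (in the
local parameter) whose boundary passes through `b` contains no singular point except possibly
`P` itself. -/
def IsNear {n : ℕ} (a : Fin n → RatFunc ℂ) (b : ℂ) : OnePoint ℂ → Prop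
  | OnePoint.infty => b ≠ 0 ∧ ∀ s ∈ singularSet a, ‖s‖ < ‖b‖
  | OnePoint.some p => b ≠ p ∧ ∀ s ∈ singularSet a, s ≠ p → ‖b - p‖ < ‖s - p‖

/-- The germ `φ` at a point `b` near `P` has vanishing order `μ` at `P`. In terms of the local
parameter `t` at `P`, write `t(z) = t(b) e^s` with `s = 0` at `z = b`. Then `φ`, as a function
`u` of `s`, continues to the half-plane `Re s ≤ 0` (that is, to the universal cover of a
punctured disc around `P`), and `u(s) ~ c e^{μ s}` with `c ≠ 0`, i.e. `φ ~ c (t(z)/t(b))^μ`,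
as `z` tends to `P` from `b` radially. -/
def HasVanishingOrder {b : ℂ} (P : OnePoint ℂ) (φ : Germ (𝓝 b) ℂ) (μ : ℂ) : Prop :=
  ∃ u : ℂ → ℂ, AnalyticOnNhd ℂ u {s | s.re ≤ 0} ∧
    φ = ((fun z => u (Complex.log (localParam P z / localParam P b)) : ℂ → ℂ) :
      Germ (𝓝 b) ℂ) ∧
    ∃ c : ℂ, c ≠ 0 ∧
      Tendsto (fun x : ℝ => Complex.exp (-(μ * (x : ℂ))) * u (x : ℂ)) atBot (𝓝 c)

/-- A radical function: `φ = R^{1/N}` with `R` a rational function and `N ≥ 1`. -/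
def IsRadical {b : ℂ} (φ : Germ (𝓝 b) ℂ) : Prop :=
  ∃ (F : ℂ → ℂ) (N : ℕ) (R : RatFunc ℂ), φ = (F : Germ (𝓝 b) ℂ) ∧ N ≠ 0 ∧
    ∀ᶠ z in 𝓝[≠] b, F z ^ N = ratVal R z

/-- A dihedral solution with respect to `√g`: one member `φ = (p + q√g)^{1/N}` of a pair of
linearly independent solutions `(p ± q√g)^{1/N}`, with `p`, `q` rational functions and `N ≥ 1`.
Here `r` is a branch of `√g` near `b`. -/
def IsDihedralSolution {n : ℕ} (a : Fin n → RatFunc ℂ) {b : ℂ} (g : RatFunc ℂ)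
    (φ : solutionSpace a b) : Prop :=
  ∃ (φ' : solutionSpace a b) (F F' r : ℂ → ℂ) (N : ℕ) (p q : RatFunc ℂ),
    LinearIndependent ℂ ![φ, φ'] ∧
    (φ : Germ (𝓝 b) ℂ) = (F : Germ (𝓝 b) ℂ) ∧ (φ' : Germ (𝓝 b) ℂ) = (F' : Germ (𝓝 b) ℂ) ∧
    N ≠ 0 ∧ MeromorphicAt r b ∧
    ∀ᶠ z in 𝓝[≠] b, r z ^ 2 = ratVal g z ∧
      F z ^ N = ratVal p z + ratVal q z * r z ∧ F' z ^ N = ratVal p z - ratVal q z * r z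

/-- A solution that is radical, or dihedral with respect to `√g`. -/
def IsRadicalOrDihedral {n : ℕ} (a : Fin n → RatFunc ℂ) {b : ℂ} (g : RatFunc ℂ)
    (φ : solutionSpace a b) : Prop :=
  IsRadical (φ : Germ (𝓝 b) ℂ) ∨ IsDihedralSolution a g φ

end

end LinODE

/-! The basis sought is an eigenbasis of the local monodromy `M` at P, the continuation once around
P.

Existence of the eigenbasis. The group G is finite, so `M` is diagonalizable. Solutions of a
Fuchsian equation have moderate growth (`IsNear.exists_growth`), so with t = t(b) e^s an eigenvector
of `M` equals e^{μs} H(e^s) near P, where H is holomorphic and H(0) ≠ 0. Then μ is a root of the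
indicial polynomial and the eigenvalue is e^{2πiμ}. As the exponents are distinct modulo ℤ, the
eigenvalue determines the exponent. If two independent eigenvectors shared an eigenvalue, a
combination cancelling their leading terms would have the wrong exponent. So the eigenspaces are
lines, and there is one eigenvector f_i for each λ_i (`IsNear.exists_index`,
`IsNear.eigenspace_le_one`, `IsNear.exists_eigenbasis`).

Group theory (`dihedral_permutes_eigenlines`). If `M` is a rotation, every element of G commutes
with `M` or inverts it, hence permutes the eigenlines. If `M` is a reflection, then M² = 1, so n ≤
2; the case n = 1 is trivial, and for n = 2 all exponents are half-integers, so m divides 4 by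
assumption and commutators with `M` are harmless. In all cases the elements commuting with `M` fix
every eigenline and form a subgroup of index at most two.

Rationality (`exists_ratFunc_of_invariant`). A polynomial expression in solutions that is invariant
under monodromy is single-valued with moderate growth at every point of the sphere, hence rational.
Put N = |G|. If all of G commutes with `M`, each f_i^N is invariant and f_i is radical. Otherwise
fix T₀ in G that does not commute with `M`. Every element of G either fixes both N-th powers f_i^N
and (T₀f_i)^N, for all i, or exchanges them, for all i. Half their sum is rational, and so is the
product of any two half-differences d_i d_j. With g = d_{i₀}² for a nonzero d_{i₀}, every d_i is a
rational multiple of √g (`exists_common_sqrt`), so f_i is dihedral, or radical when T₀ fixes its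
line.

Uniqueness. The branch √g = d_{i₀} is unchanged by `M`, because `M` fixes all the N-th powers
involved. So for a radical or dihedral y some power of y is unchanged by `M`, and y is an
eigenvector of `M` (`IsNear.exists_eigenvalue`). Its vanishing order determines its eigenline. -/

namespace LinODE

/-! ### Holomorphic linear systems on convex sets -/

section LinearSystem

open Metric Set

variable {E : Type*} [NormedAddCommGroup E] [NormedSpace ℂ E]

theorem exists_primitive_of_convex [CompleteSpace E] {U : Set ℂ} (hU : IsOpen U) (hc : Convex ℝ U)
    {f : ℂ → E} (hf : DifferentiableOn ℂ f U) (s₀ : ℂ) :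
    ∃ g : ℂ → E, g s₀ = 0 ∧ ∀ s ∈ U, HasDerivAt g (f s) s := by
  obtain ⟨g, hg⟩ := hc.exists_forall_hasDerivWithinAt hf
  refine ⟨fun s => g s - g s₀, sub_self _, fun s hs => ?_⟩
  exact ((hg s hs).hasDerivAt (hU.mem_nhds hs)).sub_const _

/-- These are the terms, not the partial sums, of the Picard series: each one is the primitive of A
applied to the previous one, so their sum formally solves the system with initial value c. -/
theorem exists_picard_sequence [CompleteSpace E] {U : Set ℂ} (hU : IsOpen U) (hc : Convex ℝ U)
    {A : ℂ → E →L[ℂ] E} (hA : DifferentiableOn ℂ A U) (s₀ : ℂ) (c : E) :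
    ∃ d : ℕ → ℂ → E, (∀ s, d 0 s = c) ∧ (∀ k, d (k + 1) s₀ = 0) ∧
      ∀ k, ∀ s ∈ U, HasDerivAt (d (k + 1)) (A s (d k s)) s := by
  -- Holomorphy is bundled with the function because each primitive exists only for a holomorphic
  -- integrand.
  have step : ∀ f : {f : ℂ → E // DifferentiableOn ℂ f U}, ∃ g : {f : ℂ → E // DifferentiableOn ℂ f U},
      g.1 s₀ = 0 ∧ ∀ s ∈ U, HasDerivAt g.1 (A s (f.1 s)) s := by
    rintro ⟨f, hf⟩
    obtain ⟨g, hg0, hg⟩ := exists_primitive_of_convex hU hc (hA.clm_apply hf) s₀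
    exact ⟨⟨g, fun s hs => (hg s hs).differentiableAt.differentiableWithinAt⟩, hg0, hg⟩
  choose next h0 hnext using step
  let D : ℕ → {f : ℂ → E // DifferentiableOn ℂ f U} := fun k =>
    Nat.rec ⟨fun _ => c, differentiableOn_const c⟩ (fun _ f => next f) k
  exact ⟨fun k => (D k).1, fun s => rfl, fun k => h0 (D k), fun k => hnext (D k)⟩

/-- The straight line from `s₀` in the direction `v`, as a curve with real parameter. -/
theorem hasDerivAt_comp_line {f : ℂ → E} {f' : E} {s₀ v : ℂ} {t : ℝ}
    (h : HasDerivAt f f' (s₀ + t * v)) :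
    HasDerivAt (fun τ : ℝ => f (s₀ + τ * v)) (v • f') t := by
  have h1 : HasDerivAt (fun τ : ℝ => s₀ + τ * v) v t := by
    have := ((Complex.ofRealCLM.hasDerivAt (x := t)).mul_const v).const_add s₀
    simpa using this
  exact HasDerivAt.scomp t h h1

theorem line_mem_of_convex {U : Set ℂ} (hc : Convex ℝ U) {s₀ s : ℂ} (h₀ : s₀ ∈ U) (h : s ∈ U) {t : ℝ}
    (ht : t ∈ Icc (0 : ℝ) 1) : s₀ + t * (s - s₀) ∈ U := by
  have := hc.add_smul_sub_mem h₀ h ht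
  simpa using this

/-- With the weight exp(2M‖s - s₀‖), integrating along a segment from s₀ an integrand that grows by
at most the factor M gains a factor 1/2, whatever the length of the segment. The bound is therefore
geometric on all of K, and K need only be star-shaped about s₀. -/
theorem picard_bound {K : Set ℂ} {s₀ : ℂ}
    (hc : ∀ s ∈ K, ∀ t ∈ Icc (0 : ℝ) 1, s₀ + t * (s - s₀) ∈ K)
    {A : ℂ → E →L[ℂ] E} {c : E} {M : ℝ} (hM0 : 0 < M) (hM : ∀ s ∈ K, ‖A s‖ ≤ M)
    {d : ℕ → ℂ → E} (hd0 : ∀ s, d 0 s = c) (hd1 : ∀ k, d (k + 1) s₀ = 0)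
    (hd : ∀ k, ∀ s ∈ K, HasDerivAt (d (k + 1)) (A s (d k s)) s) (k : ℕ) :
    ∀ s ∈ K, ‖d k s‖ ≤ ‖c‖ * (1 / 2) ^ k * Real.exp (2 * M * ‖s - s₀‖) := by
  induction k with
  | zero =>
    intro s _
    rw [hd0, pow_zero, mul_one]
    exact le_mul_of_one_le_right (norm_nonneg _) (Real.one_le_exp (by positivity))
  | succ k ih =>
    intro s hs
    set L : ℝ := ‖s - s₀‖
    set C : ℝ := ‖c‖ * (1 / 2) ^ k
    have hder : ∀ t ∈ Icc (0 : ℝ) 1, HasDerivAt (fun τ : ℝ => d (k + 1) (s₀ + τ * (s - s₀)))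
        ((s - s₀) • A (s₀ + t * (s - s₀)) (d k (s₀ + t * (s - s₀)))) t := fun t ht =>
      hasDerivAt_comp_line (hd k _ (hc s hs t ht))
    have hB : ∀ t : ℝ, HasDerivAt (fun τ : ℝ => C / 2 * Real.exp (2 * M * L * τ))
        (L * (M * (C * Real.exp (2 * M * L * t)))) t := by
      intro t
      have := (((hasDerivAt_id t).const_mul (2 * M * L)).exp).const_mul (C / 2)
      convert! this using 1
      simp only [id]
      ring
    have key := image_norm_le_of_norm_deriv_right_le_deriv_boundary
      (f := fun τ : ℝ => d (k + 1) (s₀ + τ * (s - s₀))) (a := 0) (b := 1)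
      (fun t ht => (hder t ht).continuousAt.continuousWithinAt)
      (fun t ht => (hder t (Ico_subset_Icc_self ht)).hasDerivWithinAt)
      (by simp only [Complex.ofReal_zero, zero_mul, add_zero, hd1, norm_zero]; positivity) hB
      (fun t ht => by
        have hmem := hc s hs t (Ico_subset_Icc_self ht)
        rw [norm_smul]
        refine mul_le_mul_of_nonneg_left ?_ (norm_nonneg _)
        refine ((A _).le_opNorm _).trans ?_
        refine mul_le_mul (hM _ hmem) ((ih _ hmem).trans (le_of_eq ?_)) (norm_nonneg _) hM0.le
        have : ‖s₀ + (t : ℂ) * (s - s₀) - s₀‖ = t * L := by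
          rw [add_sub_cancel_left, norm_mul, Complex.norm_real, Real.norm_of_nonneg ht.1]
        rw [this]
        congr 2
        ring) (right_mem_Icc.2 zero_le_one)
    simp only [Complex.ofReal_one, one_mul, mul_one, add_sub_cancel] at key
    refine key.trans (le_of_eq ?_)
    simp only [C]
    ring

/-- Existence for holomorphic linear systems on a convex open set. -/
theorem exists_solution_of_convex [CompleteSpace E] {U : Set ℂ} (hU : IsOpen U) (hc : Convex ℝ U)
    {A : ℂ → E →L[ℂ] E} (hA : DifferentiableOn ℂ A U) {s₀ : ℂ} (h₀ : s₀ ∈ U) (c : E) :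
    ∃ w : ℂ → E, w s₀ = c ∧ ∀ s ∈ U, HasDerivAt w (A s (w s)) s := by
  obtain ⟨d, hd0, hd1, hd⟩ := exists_picard_sequence hU hc hA s₀ c
  refine ⟨fun s => ∑' k, d k s, ?_, fun s hs => ?_⟩
  · beta_reduce
    rw [tsum_eq_single 0 (fun k hk => ?_), hd0]
    obtain ⟨j, rfl⟩ := Nat.exists_eq_succ_of_ne_zero hk
    exact hd1 j
  obtain ⟨r, hr, hrU⟩ := nhds_basis_closedBall.mem_iff.1 (hU.mem_nhds hs)
  -- A need not be bounded on U. The union of the segments from s₀ to a closed ball around s is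
  -- compact, contained in U and star-shaped about s₀, so the Picard bound holds there.
  set K : Set ℂ := (fun p : ℂ × ℝ => s₀ + p.2 * (p.1 - s₀)) '' (closedBall s r ×ˢ Icc (0 : ℝ) 1)
  have hKU : K ⊆ U := by
    rintro _ ⟨p, ⟨hp1, hp2⟩, rfl⟩
    exact line_mem_of_convex hc h₀ (hrU hp1) hp2
  have hKc : IsCompact K :=
    ((isCompact_closedBall s r).prod isCompact_Icc).image (by fun_prop)
  have hstar : ∀ x ∈ K, ∀ t ∈ Icc (0 : ℝ) 1, s₀ + t * (x - s₀) ∈ K := by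
    rintro _ ⟨p, ⟨hp1, hp2⟩, rfl⟩ t ht
    refine ⟨(p.1, t * p.2), ⟨hp1, mul_nonneg ht.1 hp2.1, mul_le_one₀ ht.2 hp2.1 hp2.2⟩, ?_⟩
    push_cast
    ring
  have hballK : ball s r ⊆ K := fun x hx =>
    ⟨(x, 1), ⟨ball_subset_closedBall hx, right_mem_Icc.2 zero_le_one⟩, by simp⟩
  obtain ⟨M, hM⟩ := hKc.exists_bound_of_continuousOn (hA.continuousOn.mono hKU)
  obtain ⟨R, hR⟩ := hKc.exists_bound_of_continuousOn
    (f := fun x : ℂ => x - s₀) (by fun_prop)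
  set M' : ℝ := max M 1
  have hM' : 0 < M' := lt_of_lt_of_le one_pos (le_max_right _ _)
  have bound := fun k => picard_bound hstar hM'
    (fun x hx => (hM x hx).trans (le_max_left _ _)) hd0 hd1 (fun k x hx => hd k x (hKU hx)) k
  have bound' : ∀ k, ∀ x ∈ ball s r, ‖d k x‖ ≤ ‖c‖ * (1 / 2) ^ k * Real.exp (2 * M' * R) := by
    intro k x hx
    refine (bound k x (hballK hx)).trans ?_
    gcongr
    exact hR x (hballK hx)
  have hsum : Summable fun k : ℕ => ‖c‖ * (1 / 2) ^ k * Real.exp (2 * M' * R) :=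
    ((summable_geometric_two).mul_left _).mul_right _
  have hdiff : ∀ k, DifferentiableOn ℂ (d k) (ball s r) := by
    rintro (_ | k) x hx
    · rw [funext hd0]
      exact differentiableWithinAt_const c
    · exact (hd k x (hKU (hballK hx))).differentiableAt.differentiableWithinAt
  have hsball : s ∈ ball s r := mem_ball_self hr
  have h1 := Complex.differentiableOn_tsum_of_summable_norm hsum hdiff isOpen_ball bound'
  have h2 := Complex.hasSum_deriv_of_summable_norm hsum hdiff isOpen_ball bound' hsball
  have h3 : HasSum (fun k => d k s) (∑' k, d k s) :=
    (Summable.of_norm_bounded hsum fun k => bound' k s hsball).hasSum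
  -- The zeroth term is constant, so the series of derivatives is the series of the A(d k) shifted
  -- by one place.
  have h4 : HasSum (fun k => deriv (d k) s) (A s (∑' k, d k s)) := by
    rw [← hasSum_nat_add_iff' 1]
    have h5 : deriv (d 0) s = 0 := by rw [funext hd0]; exact deriv_const _ _
    simp only [Finset.range_one, Finset.sum_singleton, h5, sub_zero]
    have := (A s).hasSum h3
    simpa only [(hd _ s hs).deriv] using this
  have h6 := (h1.differentiableAt (isOpen_ball.mem_nhds hsball)).hasDerivAt
  rwa [h2.unique h4] at h6

/-- Uniqueness for holomorphic linear systems on a convex set. -/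
theorem solution_unique_of_convex {U : Set ℂ} (hc : Convex ℝ U)
    {A : ℂ → E →L[ℂ] E} (hA : ContinuousOn A U) {s₀ : ℂ} (h₀ : s₀ ∈ U) {w₁ w₂ : ℂ → E}
    (h₁ : ∀ s ∈ U, HasDerivAt w₁ (A s (w₁ s)) s) (h₂ : ∀ s ∈ U, HasDerivAt w₂ (A s (w₂ s)) s)
    (h : w₁ s₀ = w₂ s₀) : EqOn w₁ w₂ U := by
  intro s hs
  -- On the segment from s₀ to s the difference of the solutions satisfies a linear differential
  -- inequality with initial value 0, so it vanishes.
  have hline : ContinuousOn (fun t : ℝ => A (s₀ + t * (s - s₀))) (Icc 0 1) :=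
    hA.comp (by fun_prop) fun t ht => line_mem_of_convex hc h₀ hs ht
  obtain ⟨M, hM⟩ := isCompact_Icc.exists_bound_of_continuousOn hline
  have hder : ∀ t ∈ Icc (0 : ℝ) 1, HasDerivAt (fun τ : ℝ => (w₁ - w₂) (s₀ + τ * (s - s₀)))
      ((s - s₀) • A (s₀ + t * (s - s₀)) ((w₁ - w₂) (s₀ + t * (s - s₀)))) t := fun t ht => by
    have hm := line_mem_of_convex hc h₀ hs ht
    refine hasDerivAt_comp_line ?_
    simpa using! (h₁ _ hm).sub (h₂ _ hm)
  have := eq_zero_of_abs_deriv_le_mul_abs_self_of_eq_zero_right (K := ‖s - s₀‖ * M)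
    (f := fun τ : ℝ => (w₁ - w₂) (s₀ + τ * (s - s₀))) (a := 0) (b := 1)
    (fun t ht => (hder t ht).continuousAt.continuousWithinAt)
    (fun t ht => (hder t (Ico_subset_Icc_self ht)).hasDerivWithinAt)
    (by simp [h])
    (fun t ht => by
      rw [norm_smul, mul_assoc]
      refine mul_le_mul_of_nonneg_left ?_ (norm_nonneg _)
      exact ((A _).le_opNorm _).trans
        (mul_le_mul_of_nonneg_right (hM t (Ico_subset_Icc_self ht)) (norm_nonneg _)))
    1 (right_mem_Icc.2 zero_le_one)
  simpa [sub_eq_zero] using this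

end LinearSystem

/-! ### The companion system and local solutions -/

section Companion

theorem ratVal_eq (f : RatFunc ℂ) (z : ℂ) : ratVal f z = f.num.eval z / f.denom.eval z := by
  simp only [ratVal, RatFunc.eval, Polynomial.eval₂_id]

theorem analyticAt_ratVal {f : RatFunc ℂ} {z : ℂ} (h : f.denom.eval z ≠ 0) :
    AnalyticAt ℂ (ratVal f) z := by
  rw [funext (ratVal_eq f)]
  exact (AnalyticOnNhd.eval_polynomial f.num z trivial).div
    (AnalyticOnNhd.eval_polynomial f.denom z trivial) h

variable {n : ℕ}

theorem finite_singularSet (a : Fin n → RatFunc ℂ) : (singularSet a).Finite := by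
  have : singularSet a = ⋃ i, {z | (a i).denom.IsRoot z} := by
    ext z
    simp [singularSet]
  rw [this]
  exact Set.finite_iUnion fun i => Polynomial.finite_setOfPred_isRoot (RatFunc.denom_ne_zero _)

theorem isOpen_compl_singularSet (a : Fin n → RatFunc ℂ) : IsOpen (singularSet a)ᶜ :=
  (finite_singularSet a).isClosed.isOpen_compl

theorem analyticAt_coeff {a : Fin n → RatFunc ℂ} {z : ℂ} (hz : z ∉ singularSet a) (i : Fin n) :
    AnalyticAt ℂ (ratVal (a i)) z :=
  analyticAt_ratVal fun h => hz ⟨i, h⟩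

/-- The constant part of the companion matrix. -/
noncomputable def shiftMap (n : ℕ) : (Fin n → ℂ) →L[ℂ] (Fin n → ℂ) :=
  LinearMap.toContinuousLinearMap
    { toFun := fun v k => if h : (k : ℕ) + 1 < n then v ⟨k + 1, h⟩ else 0
      map_add' := fun v w => by
        ext k
        by_cases h : (k : ℕ) + 1 < n <;> simp [h]
      map_smul' := fun c v => by
        ext k
        by_cases h : (k : ℕ) + 1 < n <;> simp [h] }

/-- The part of the companion matrix that is multiplied by the `i`-th coefficient. -/
noncomputable def lastRowMap (i : Fin n) : (Fin n → ℂ) →L[ℂ] (Fin n → ℂ) :=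
  LinearMap.toContinuousLinearMap
    { toFun := fun v k => if (k : ℕ) + 1 < n then 0 else -v i
      map_add' := fun v w => by
        ext k
        by_cases h : (k : ℕ) + 1 < n <;> simp [h, add_comm]
      map_smul' := fun c v => by
        ext k
        by_cases h : (k : ℕ) + 1 < n <;> simp [h] }

/-- The companion system `w' = companion a z w` of the equation. -/
noncomputable def companion (a : Fin n → RatFunc ℂ) (z : ℂ) : (Fin n → ℂ) →L[ℂ] (Fin n → ℂ) :=
  shiftMap n + ∑ i, ratVal (a i) z • lastRowMap i

theorem companion_apply_of_lt (a : Fin n → RatFunc ℂ) (z : ℂ) (v : Fin n → ℂ) {k : Fin n}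
    (h : (k : ℕ) + 1 < n) : companion a z v k = v ⟨k + 1, h⟩ := by
  simp [companion, shiftMap, lastRowMap, h]

theorem companion_apply_of_not_lt (a : Fin n → RatFunc ℂ) (z : ℂ) (v : Fin n → ℂ) {k : Fin n}
    (h : ¬ (k : ℕ) + 1 < n) : companion a z v k = -∑ i, ratVal (a i) z * v i := by
  simp [companion, shiftMap, lastRowMap, h]

theorem analyticAt_companion {a : Fin n → RatFunc ℂ} {z : ℂ} (hz : z ∉ singularSet a) :
    AnalyticAt ℂ (companion a) z := by
  have : companion a = (fun _ => shiftMap n) + fun z => ∑ i, ratVal (a i) z • lastRowMap i := rfl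
  rw [this]
  refine analyticAt_const.add (Finset.analyticAt_fun_sum _ fun i _ => ?_)
  exact (analyticAt_coeff hz i).smul analyticAt_const

/-- The Cauchy data of `F` at `z`. -/
noncomputable def jet (n : ℕ) (F : ℂ → ℂ) (z : ℂ) : Fin n → ℂ := fun k => iteratedDeriv k F z

theorem hasDerivAt_iteratedDeriv {F : ℂ → ℂ} {z : ℂ} (h : AnalyticAt ℂ F z) (k : ℕ) :
    HasDerivAt (iteratedDeriv k F) (iteratedDeriv (k + 1) F z) z := by
  rw [iteratedDeriv_succ, iteratedDeriv_eq_iterate]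
  exact (h.iterated_deriv k).differentiableAt.hasDerivAt

theorem jet_congr {F G : ℂ → ℂ} {z : ℂ} (h : F =ᶠ[𝓝 z] G) : jet n F z = jet n G z :=
  funext fun k => (h.iteratedDeriv k).eq_of_nhds

theorem IsSolutionAt.eventually {a : Fin n → RatFunc ℂ} {z : ℂ} {F : ℂ → ℂ}
    (h : IsSolutionAt a z F) : ∀ᶠ x in 𝓝 z, IsSolutionAt a x F := by
  filter_upwards [h.1.eventually_analyticAt, eventually_eventually_nhds.2 h.2] with x h1 h2
  exact ⟨h1, h2⟩

theorem IsSolutionAt.hasDerivAt_jet {a : Fin n → RatFunc ℂ} {z : ℂ} {F : ℂ → ℂ}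
    (h : IsSolutionAt a z F) : HasDerivAt (jet n F) (companion a z (jet n F z)) z := by
  rw [hasDerivAt_pi]
  intro k
  by_cases hk : (k : ℕ) + 1 < n
  · rw [companion_apply_of_lt _ _ _ hk]
    exact hasDerivAt_iteratedDeriv h.1 k
  · rw [companion_apply_of_not_lt _ _ _ hk]
    have hk' : (k : ℕ) + 1 = n := by omega
    have h1 := h.2.self_of_nhds
    have h2 : -∑ i, ratVal (a i) z * jet n F z i = iteratedDeriv (k + 1) F z := by
      rw [hk', neg_eq_iff_add_eq_zero, add_comm]
      exact h1
    rw [h2]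
    exact hasDerivAt_iteratedDeriv h.1 k

theorem exists_ball_compl_singularSet {a : Fin n → RatFunc ℂ} {z : ℂ} (hz : z ∉ singularSet a) :
    ∃ ρ > 0, Metric.ball z ρ ⊆ (singularSet a)ᶜ :=
  Metric.isOpen_iff.1 (isOpen_compl_singularSet a) z hz

variable [NeZero n]

theorem jet_of_hasDerivAt_companion {a : Fin n → RatFunc ℂ} {U : Set ℂ} (hU : IsOpen U)
    {w : ℂ → Fin n → ℂ} (hw : ∀ z ∈ U, HasDerivAt w (companion a z (w z)) z) :
    ∀ z ∈ U, jet n (fun x => w x 0) z = w z := by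
  have key : ∀ k : ℕ, ∀ hk : k < n, ∀ z ∈ U, iteratedDeriv k (fun x => w x 0) z = w z ⟨k, hk⟩ := by
    intro k
    induction k with
    | zero => intro hk z _; rw [iteratedDeriv_zero]; rfl
    | succ k ih =>
      intro hk z hz
      have hk' : k < n := by omega
      rw [iteratedDeriv_succ]
      have h1 : iteratedDeriv k (fun x => w x 0) =ᶠ[𝓝 z] fun x => w x ⟨k, hk'⟩ := by
        filter_upwards [hU.mem_nhds hz] with x hx using ih hk' x hx
      rw [h1.deriv_eq]
      have h2 := (hasDerivAt_pi.1 (hw z hz)) ⟨k, hk'⟩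
      rw [h2.deriv, companion_apply_of_lt a z (w z) (k := ⟨k, hk'⟩) hk]
  exact fun z hz => funext fun k => key k k.2 z hz

theorem isSolutionAt_of_hasDerivAt_companion {a : Fin n → RatFunc ℂ} {U : Set ℂ} (hU : IsOpen U)
    {w : ℂ → Fin n → ℂ} (hw : ∀ z ∈ U, HasDerivAt w (companion a z (w z)) z) {z : ℂ} (hz : z ∈ U) :
    IsSolutionAt a z fun x => w x 0 := by
  have hn : 0 < n := NeZero.pos n
  have han : ∀ x ∈ U, AnalyticAt ℂ (fun x => w x 0) x := by
    have hd : DifferentiableOn ℂ (fun x => w x 0) U := fun x hx =>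
      ((hasDerivAt_pi.1 (hw x hx)) 0).differentiableAt.differentiableWithinAt
    exact fun x hx => hd.analyticOnNhd hU x hx
  refine ⟨han z hz, ?_⟩
  filter_upwards [hU.mem_nhds hz] with x hx
  have hk : n - 1 < n := by omega
  have h1 : iteratedDeriv (n - 1) (fun x => w x 0) =ᶠ[𝓝 x] fun y => w y ⟨n - 1, hk⟩ := by
    filter_upwards [hU.mem_nhds hx] with y hy
    exact congrFun (jet_of_hasDerivAt_companion hU hw y hy) ⟨n - 1, hk⟩
  have h2 := ((hasDerivAt_pi.1 (hw x hx)) ⟨n - 1, hk⟩).deriv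
  rw [companion_apply_of_not_lt a x (w x) (k := ⟨n - 1, hk⟩) (by simp only; omega)] at h2
  have h3 : iteratedDeriv n (fun x => w x 0) x = -∑ i, ratVal (a i) x * w x i := by
    rw [← h2, ← h1.deriv_eq, ← iteratedDeriv_succ]
    congr 1
    omega
  rw [h3, neg_add_eq_zero]
  refine Finset.sum_congr rfl fun i _ => ?_
  rw [← congrFun (jet_of_hasDerivAt_companion hU hw x hx) i]
  rfl

/-- Solutions with prescribed Cauchy data exist on every disc without singular points. -/
theorem exists_solution_on_ball {a : Fin n → RatFunc ℂ} {z₀ : ℂ} {ρ : ℝ}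
    (hball : Metric.ball z₀ ρ ⊆ (singularSet a)ᶜ) {z₁ : ℂ} (hz₁ : z₁ ∈ Metric.ball z₀ ρ)
    (c : Fin n → ℂ) :
    ∃ F : ℂ → ℂ, jet n F z₁ = c ∧ ∀ z ∈ Metric.ball z₀ ρ, IsSolutionAt a z F := by
  obtain ⟨w, hw0, hw⟩ := exists_solution_of_convex Metric.isOpen_ball (convex_ball z₀ ρ)
    (A := companion a)
    (fun z hz => (analyticAt_companion (hball hz)).differentiableAt.differentiableWithinAt)
    hz₁ c
  refine ⟨fun x => w x 0, ?_, fun z hz =>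
    isSolutionAt_of_hasDerivAt_companion Metric.isOpen_ball hw hz⟩
  rw [jet_of_hasDerivAt_companion Metric.isOpen_ball hw z₁ hz₁, hw0]

theorem IsSolutionAt.eventuallyEq {a : Fin n → RatFunc ℂ} {z : ℂ} (hz : z ∉ singularSet a)
    {F G : ℂ → ℂ} (hF : IsSolutionAt a z F) (hG : IsSolutionAt a z G)
    (h : jet n F z = jet n G z) : F =ᶠ[𝓝 z] G := by
  have hev : ∀ᶠ x in 𝓝 z, IsSolutionAt a x F ∧ IsSolutionAt a x G ∧ x ∈ (singularSet a)ᶜ :=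
    hF.eventually.and (hG.eventually.and ((isOpen_compl_singularSet a).mem_nhds hz))
  obtain ⟨ρ, hρ, hball⟩ := Metric.eventually_nhds_iff_ball.1 hev
  have := solution_unique_of_convex (convex_ball z ρ) (A := companion a)
    (fun x hx => (analyticAt_companion (hball x hx).2.2).continuousAt.continuousWithinAt)
    (Metric.mem_ball_self hρ) (fun x hx => (hball x hx).1.hasDerivAt_jet)
    (fun x hx => (hball x hx).2.1.hasDerivAt_jet) h
  filter_upwards [Metric.ball_mem_nhds z hρ] with x hx
  have := congrFun (this hx) 0
  simpa [jet] using this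

theorem exists_solution {a : Fin n → RatFunc ℂ} {z : ℂ} (hz : z ∉ singularSet a)
    (c : Fin n → ℂ) : ∃ F : ℂ → ℂ, IsSolutionAt a z F ∧ jet n F z = c := by
  obtain ⟨ρ, hρ, hball⟩ := exists_ball_compl_singularSet hz
  obtain ⟨F, h1, h2⟩ := exists_solution_on_ball hball (Metric.mem_ball_self hρ) c
  exact ⟨F, h2 z (Metric.mem_ball_self hρ), h1⟩

end Companion

/-! ### Continuation of Cauchy data along maps and paths -/

section Horizontal

variable {n : ℕ} {X Y : Type*} [TopologicalSpace X] [TopologicalSpace Y]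

/-- `v` is the Cauchy data, along the map `c`, of a solution continued along `c`. -/
def HorizontalOn (a : Fin n → RatFunc ℂ) (U : Set X) (c : X → ℂ) (v : X → Fin n → ℂ) : Prop :=
  ∀ x ∈ U, ∃ F : ℂ → ℂ, IsSolutionAt a (c x) F ∧ ∀ᶠ y in 𝓝 x, v y = jet n F (c y)

variable {a : Fin n → RatFunc ℂ} {U : Set X} {c : X → ℂ} {v w : X → Fin n → ℂ}

theorem HorizontalOn.comp (h : HorizontalOn a U c v) {f : Y → X} (hf : Continuous f) :
    HorizontalOn a (f ⁻¹' U) (c ∘ f) (v ∘ f) := by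
  intro y hy
  obtain ⟨F, hF, hev⟩ := h (f y) hy
  exact ⟨F, hF, hf.continuousAt.eventually hev⟩

theorem HorizontalOn.mono (h : HorizontalOn a U c v) {U' : Set X} (hU : U' ⊆ U) :
    HorizontalOn a U' c v := fun x hx => h x (hU hx)

theorem jet_add {F G : ℂ → ℂ} {z : ℂ} (hF : AnalyticAt ℂ F z) (hG : AnalyticAt ℂ G z) :
    jet n (F + G) z = jet n F z + jet n G z :=
  funext fun _ => iteratedDeriv_add hF.contDiffAt hG.contDiffAt

theorem jet_smul {F : ℂ → ℂ} {z : ℂ} (c : ℂ) (hF : AnalyticAt ℂ F z) :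
    jet n (c • F) z = c • jet n F z :=
  funext fun _ => iteratedDeriv_const_smul hF.contDiffAt c

theorem HorizontalOn.add (hc : ∀ x ∈ U, ContinuousAt c x) (hv : HorizontalOn a U c v)
    (hw : HorizontalOn a U c w) : HorizontalOn a U c (v + w) := by
  intro x hx
  obtain ⟨F, hF, hFv⟩ := hv x hx
  obtain ⟨G, hG, hGw⟩ := hw x hx
  refine ⟨F + G, hF.add hG, ?_⟩
  filter_upwards [hFv, hGw, (hc x hx).eventually hF.eventually, (hc x hx).eventually hG.eventually]
    with y h1 h2 h3 h4
  rw [jet_add h3.1 h4.1, Pi.add_apply, h1, h2]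

theorem HorizontalOn.smul (hc : ∀ x ∈ U, ContinuousAt c x) (k : ℂ) (hv : HorizontalOn a U c v) :
    HorizontalOn a U c (k • v) := by
  intro x hx
  obtain ⟨F, hF, hFv⟩ := hv x hx
  refine ⟨k • F, hF.smul k, ?_⟩
  filter_upwards [hFv, (hc x hx).eventually hF.eventually] with y h1 h3
  rw [jet_smul k h3.1, Pi.smul_apply, h1]

theorem horizontalOn_jet {F : ℂ → ℂ} (hF : ∀ x ∈ U, IsSolutionAt a (c x) F) :
    HorizontalOn a U c fun x => jet n F (c x) :=
  fun x hx => ⟨F, hF x hx, Eventually.of_forall fun _ => rfl⟩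

variable [NeZero n]

/-- The locus of agreement is open by local uniqueness of solutions, and the locus of disagreement
is open by continuity of Cauchy data. Only connectedness of U and continuity of c enter, so the
lemma serves both paths and half-planes. -/
theorem HorizontalOn.eqOn (hU : IsOpen U) (hconn : IsPreconnected U)
    (hc : ∀ x ∈ U, ContinuousAt c x) (hS : ∀ x ∈ U, c x ∉ singularSet a)
    (hv : HorizontalOn a U c v) (hw : HorizontalOn a U c w) {x₀ : X} (hx₀ : x₀ ∈ U)
    (h : v x₀ = w x₀) : Set.EqOn v w U := by
  have hO1 : IsOpen {x | x ∈ U ∧ v x = w x} := by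
    rw [isOpen_iff_mem_nhds]
    rintro x ⟨hx, hxv⟩
    obtain ⟨F, hF, hFv⟩ := hv x hx
    obtain ⟨G, hG, hGw⟩ := hw x hx
    have hFG : F =ᶠ[𝓝 (c x)] G := hF.eventuallyEq (hS x hx) hG (by
      rw [← hFv.self_of_nhds, ← hGw.self_of_nhds, hxv])
    filter_upwards [hU.mem_nhds hx, hFv, hGw, (hc x hx).eventually hFG.eventuallyEq_nhds]
      with y hy h1 h2 h3
    exact ⟨hy, by rw [h1, h2, jet_congr h3]⟩
  have hO2 : IsOpen {x | x ∈ U ∧ v x ≠ w x} := by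
    rw [isOpen_iff_mem_nhds]
    rintro x ⟨hx, hxv⟩
    obtain ⟨F, hF, hFv⟩ := hv x hx
    obtain ⟨G, hG, hGw⟩ := hw x hx
    have hne : jet n F (c x) ≠ jet n G (c x) := by
      rwa [← hFv.self_of_nhds, ← hGw.self_of_nhds]
    have hcont : ∀ᶠ z in 𝓝 (c x), jet n F z ≠ jet n G z :=
      (hF.hasDerivAt_jet.continuousAt.ne_iff_eventually_ne hG.hasDerivAt_jet.continuousAt).1 hne
    filter_upwards [hU.mem_nhds hx, hFv, hGw, (hc x hx).eventually hcont] with y hy h1 h2 h3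
    exact ⟨hy, by rw [h1, h2]; exact h3⟩
  intro x hx
  by_contra hne
  obtain ⟨y, _, ⟨_, h1⟩, ⟨_, h2⟩⟩ := hconn _ _ hO1 hO2
    (fun y hy => (em (v y = w y)).imp (fun h => ⟨hy, h⟩) fun h => ⟨hy, h⟩)
    ⟨x₀, hx₀, hx₀, h⟩ ⟨x, hx, hx, hne⟩
  exact h2 h1

/-- A solution of the companion system pulled back along a holomorphic map is horizontal. -/
theorem horizontalOn_of_hasDerivAt {U : Set ℂ} (hU : IsOpen U) {c c' : ℂ → ℂ}
    (hc : ∀ s ∈ U, HasDerivAt c (c' s) s) (hc' : ContinuousOn c' U)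
    (hS : ∀ s ∈ U, c s ∉ singularSet a) {w : ℂ → Fin n → ℂ}
    (hw : ∀ s ∈ U, HasDerivAt w (c' s • companion a (c s) (w s)) s) :
    HorizontalOn a U c w := by
  intro s hs
  obtain ⟨F, hF, hjet⟩ := exists_solution (hS s hs) (w s)
  refine ⟨F, hF, ?_⟩
  have hev : ∀ᶠ x in 𝓝 s, x ∈ U ∧ IsSolutionAt a (c x) F :=
    (hU.eventually_mem hs).and ((hc s hs).continuousAt.eventually hF.eventually)
  obtain ⟨ρ, hρ, hball⟩ := Metric.eventually_nhds_iff_ball.1 hev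
  -- Both w and the Cauchy data of F along c solve the pulled-back linear system with the same value
  -- at s.
  have := solution_unique_of_convex (convex_ball s ρ)
    (A := fun s => c' s • companion a (c s))
    (fun x hx => by
      have hx' := (hball x hx).1
      refine ((hc'.continuousAt (hU.mem_nhds hx')).smul ?_).continuousWithinAt
      exact ContinuousAt.comp (f := c) (analyticAt_companion (hS x hx')).continuousAt
        (hc x hx').continuousAt)
    (Metric.mem_ball_self hρ) (w₁ := w) (w₂ := fun x => jet n F (c x))
    (fun x hx => hw x (hball x hx).1)
    (fun x hx => HasDerivAt.scomp x (hball x hx).2.hasDerivAt_jet (hc x (hball x hx).1)) hjet.symm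
  filter_upwards [Metric.ball_mem_nhds s hρ] with x hx using this hx

theorem exists_horizontalOn_of_convex {U : Set ℂ} (hU : IsOpen U) (hconv : Convex ℝ U) {c c' : ℂ → ℂ}
    (hc : ∀ s ∈ U, HasDerivAt c (c' s) s) (hc' : DifferentiableOn ℂ c' U)
    (hS : ∀ s ∈ U, c s ∉ singularSet a) {s₀ : ℂ} (h₀ : s₀ ∈ U) (v₀ : Fin n → ℂ) :
    ∃ w : ℂ → Fin n → ℂ, w s₀ = v₀ ∧ HorizontalOn a U c w ∧
      ∀ s ∈ U, HasDerivAt w (c' s • companion a (c s) (w s)) s := by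
  obtain ⟨w, hw0, hw⟩ := exists_solution_of_convex hU hconv
    (A := fun s => c' s • companion a (c s)) (hc'.smul fun s hs =>
      ((analyticAt_companion (hS s hs)).differentiableAt.comp s
        (hc s hs).differentiableAt).differentiableWithinAt) h₀ v₀
  exact ⟨w, hw0, horizontalOn_of_hasDerivAt hU hc hc'.continuousOn hS hw, hw⟩

open unitInterval in
/-- Solutions can be continued along every path that avoids the singular points. -/
theorem exists_horizontal_path {x y : ℂ} (γ : Path x y) (hγ : ∀ t, γ t ∉ singularSet a)
    (v₀ : Fin n → ℂ) : ∃ v : I → Fin n → ℂ, v 0 = v₀ ∧ HorizontalOn a Set.univ γ v := by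
  choose ρ hρ hball using fun t => exists_ball_compl_singularSet (hγ t)
  obtain ⟨t, ht0, hmono, ⟨m, hm⟩, hcov⟩ := exists_monotone_Icc_subset_open_cover_unitInterval
    (c := fun t : I => γ ⁻¹' Metric.ball (γ t) (ρ t))
    (fun t => Metric.isOpen_ball.preimage γ.continuous)
    (fun s _ => Set.mem_iUnion.2 ⟨s, Metric.mem_ball_self (hρ s)⟩)
  -- Induction over a subdivision whose pieces each map into a disc without singular points. The
  -- condition is one-sided at t k, since v is redefined to the right of that point in the next
  -- step.
  have key : ∀ k : ℕ, ∃ v : I → Fin n → ℂ, v 0 = v₀ ∧ ∀ s ≤ t k, ∃ F : ℂ → ℂ,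
      IsSolutionAt a (γ s) F ∧ ∀ᶠ r in 𝓝[Set.Iic (t k)] s, v r = jet n F (γ r) := by
    intro k
    induction k with
    | zero =>
      obtain ⟨F, hF, hjet⟩ := exists_solution (hγ 0) v₀
      refine ⟨fun _ => v₀, rfl, fun s hs => ?_⟩
      rw [ht0] at hs ⊢
      obtain rfl : s = 0 := le_antisymm hs s.2.1
      refine ⟨F, hF, ?_⟩
      filter_upwards [self_mem_nhdsWithin] with r hr
      obtain rfl : r = 0 := le_antisymm hr r.2.1
      exact hjet.symm
    | succ k ih =>
      obtain ⟨v, hv0, hv⟩ := ih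
      obtain ⟨i, hi⟩ := hcov k
      have htk := hmono (Nat.le_succ k)
      obtain ⟨F, hFjet, hF⟩ := exists_solution_on_ball (hball i)
        (hi ⟨le_refl (t k), htk⟩) (v (t k))
      obtain ⟨F₀, hF₀, hF₀v⟩ := hv (t k) le_rfl
      have hFF₀ : F₀ =ᶠ[𝓝 (γ (t k))] F := hF₀.eventuallyEq (hγ _)
        (hF _ (hi ⟨le_refl (t k), htk⟩))
        (by rw [hFjet]; exact (hF₀v.self_of_nhdsWithin (le_refl (t k))).symm)
      classical
      -- To the right of t k the Cauchy data are those of F, the solution on the next disc. At t k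
      -- itself F also represents the left-hand side, as it agrees near γ (t k) with the old
      -- solution.
      refine ⟨fun s => if s ≤ t k then v s else jet n F (γ s), (if_pos (t k).2.1).trans hv0, fun s hs => ?_⟩
      rcases lt_trichotomy s (t k) with hlt | rfl | hgt
      · obtain ⟨G, hG, hGv⟩ := hv s hlt.le
        refine ⟨G, hG, mem_nhdsWithin_of_mem_nhds ?_⟩
        rw [nhdsWithin_eq_nhds.2 (Iic_mem_nhds hlt)] at hGv
        filter_upwards [hGv, Iic_mem_nhds hlt] with r hr hr'
        rw [if_pos (Set.mem_Iic.1 hr'), hr]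
      · refine ⟨F, hF _ (hi ⟨le_rfl, htk⟩), mem_nhdsWithin_of_mem_nhds ?_⟩
        filter_upwards [eventually_nhdsWithin_iff.1 hF₀v,
          γ.continuous.continuousAt.eventually hFF₀.eventuallyEq_nhds] with r hr hr'
        split_ifs with h
        · rw [hr h, jet_congr hr']
        · rfl
      · refine ⟨F, hF _ (hi ⟨hgt.le, hs⟩), mem_nhdsWithin_of_mem_nhds ?_⟩
        filter_upwards [Ioi_mem_nhds hgt] with r hr
        rw [if_neg (not_le.2 hr)]
  obtain ⟨v, hv0, hv⟩ := key m
  have h1 : t m = 1 := hm m le_rfl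
  refine ⟨v, hv0, fun s _ => ?_⟩
  obtain ⟨F, hF, hFv⟩ := hv s (h1 ▸ s.2.2)
  refine ⟨F, hF, ?_⟩
  have : Set.Iic (t m) = Set.univ := by
    rw [h1]
    exact Set.eq_univ_of_forall fun s => s.2.2
  rwa [this, nhdsWithin_univ] at hFv

theorem HorizontalOn.eq_of_path {x y : ℂ} {γ : Path x y} (hγ : ∀ t, γ t ∉ singularSet a)
    {v w : unitInterval → Fin n → ℂ} (hv : HorizontalOn a Set.univ γ v)
    (hw : HorizontalOn a Set.univ γ w) {t₀ : unitInterval} (h : v t₀ = w t₀) : v = w :=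
  funext fun _ => hv.eqOn isOpen_univ isPreconnected_univ
    (fun _ _ => γ.continuous.continuousAt) (fun t _ => hγ t) hw (Set.mem_univ t₀) h (Set.mem_univ _)

end Horizontal

/-! ### Cauchy data at the base point and monodromy operators -/

section Monodromy

variable {n : ℕ} {a : Fin n → RatFunc ℂ} {b : ℂ}

/-- A function representing a germ in the solution space. -/
noncomputable def rep (φ : solutionSpace a b) : ℂ → ℂ := Classical.choose φ.2

theorem isSolutionAt_rep (φ : solutionSpace a b) : IsSolutionAt a b (rep φ) :=
  (Classical.choose_spec φ.2).1

theorem coe_rep (φ : solutionSpace a b) :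
    (φ : Germ (𝓝 b) ℂ) = ((rep φ : ℂ → ℂ) : Germ (𝓝 b) ℂ) :=
  (Classical.choose_spec φ.2).2

theorem rep_eventuallyEq {φ : solutionSpace a b} {F : ℂ → ℂ}
    (h : (φ : Germ (𝓝 b) ℂ) = (F : Germ (𝓝 b) ℂ)) : rep φ =ᶠ[𝓝 b] F := by
  rw [coe_rep] at h
  exact Germ.coe_eq.1 h

theorem rep_add (φ ψ : solutionSpace a b) : rep (φ + ψ) =ᶠ[𝓝 b] rep φ + rep ψ := by
  refine rep_eventuallyEq ?_
  rw [Submodule.coe_add, coe_rep φ, coe_rep ψ, Germ.coe_add]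

theorem rep_smul (c : ℂ) (φ : solutionSpace a b) : rep (c • φ) =ᶠ[𝓝 b] c • rep φ := by
  refine rep_eventuallyEq ?_
  rw [Submodule.coe_smul, coe_rep φ, Germ.coe_smul]

/-- The germ of a solution as an element of the solution space. -/
noncomputable def ofSolution (F : ℂ → ℂ) (hF : IsSolutionAt a b F) : solutionSpace a b :=
  ⟨(F : Germ (𝓝 b) ℂ), F, hF, rfl⟩

theorem ext_of_rep {φ ψ : solutionSpace a b} (h : rep φ =ᶠ[𝓝 b] rep ψ) : φ = ψ := by
  apply Subtype.ext
  rw [coe_rep, coe_rep]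
  exact Germ.coe_eq.2 h

variable [NeZero n]

/-- Cauchy data at a nonsingular point identify the solution space with `ℂⁿ`. -/
noncomputable def jetEquiv (hb : b ∉ singularSet a) : solutionSpace a b ≃ₗ[ℂ] (Fin n → ℂ) :=
  LinearEquiv.ofBijective
    { toFun := fun φ => jet n (rep φ) b
      map_add' := fun φ ψ => by
        rw [jet_congr (rep_add φ ψ), jet_add (isSolutionAt_rep φ).1 (isSolutionAt_rep ψ).1]
      map_smul' := fun c φ => by
        rw [jet_congr (rep_smul c φ), jet_smul c (isSolutionAt_rep φ).1, RingHom.id_apply] }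
    ⟨fun φ ψ h => ext_of_rep ((isSolutionAt_rep φ).eventuallyEq hb (isSolutionAt_rep ψ) h),
      fun v => by
        obtain ⟨F, hF, hv⟩ := exists_solution hb v
        refine ⟨ofSolution F hF, ?_⟩
        rw [← hv]
        exact jet_congr (rep_eventuallyEq rfl)⟩

theorem jetEquiv_apply (hb : b ∉ singularSet a) (φ : solutionSpace a b) :
    jetEquiv hb φ = jet n (rep φ) b := rfl

theorem continuesTo_of_horizontal {γ : Path b b} (hγ : ∀ t, γ t ∉ singularSet a)
    {v : unitInterval → Fin n → ℂ} (hv : HorizontalOn a Set.univ γ v) {φ ψ : solutionSpace a b}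
    (h0 : v 0 = jet n (rep φ) b) (h1 : v 1 = jet n (rep ψ) b) :
    ContinuesTo γ (φ : Germ (𝓝 b) ℂ) (ψ : Germ (𝓝 b) ℂ) := by
  choose F hF hFv using fun t => hv t (Set.mem_univ t)
  refine ⟨F, fun t => (hF t).1, fun t => ?_, ?_, ?_⟩
  · filter_upwards [hFv t, γ.continuous.continuousAt.eventually (hF t).eventually] with s h1 h2
    exact (hF s).eventuallyEq (hγ s) h2 (by rw [← h1, ← (hFv s).self_of_nhds])
  · rw [coe_rep φ]
    refine Germ.coe_eq.2 ?_
    have h := hF 0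
    have h2 := (hFv 0).self_of_nhds
    rw [γ.source] at h h2
    exact (isSolutionAt_rep φ).eventuallyEq (γ.source ▸ hγ 0) h (by rw [← h0, h2])
  · rw [coe_rep ψ]
    refine Germ.coe_eq.2 ?_
    have h := hF 1
    have h2 := (hFv 1).self_of_nhds
    rw [γ.target] at h h2
    exact (isSolutionAt_rep ψ).eventuallyEq (γ.source ▸ hγ 0) h (by rw [← h1, h2])

/-- Continuation along a loop is an element of the monodromy group. -/
theorem exists_monodromy (γ : Path b b) (hγ : ∀ t, γ t ∉ singularSet a) :
    ∃ T ∈ monodromyGroup a b, ∀ (φ : solutionSpace a b) (v : unitInterval → Fin n → ℂ),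
      HorizontalOn a Set.univ γ v → v 0 = jet n (rep φ) b → v 1 = jet n (rep (T φ)) b := by
  have hb : b ∉ singularSet a := γ.source ▸ hγ 0
  have hc : ∀ t ∈ (Set.univ : Set unitInterval), ContinuousAt γ t :=
    fun t _ => γ.continuous.continuousAt
  choose L hL0 hL using exists_horizontal_path γ hγ
  -- Continuation is linear because the continuation of given initial data is unique. It is
  -- injective because uniqueness may equally be started from the end point, so H is an automorphism
  -- of ℂⁿ.
  let H : (Fin n → ℂ) →ₗ[ℂ] (Fin n → ℂ) :=
    { toFun := fun v => L v 1
      map_add' := fun v w => by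
        have := HorizontalOn.eq_of_path hγ (hL (v + w)) ((hL v).add hc (hL w)) (t₀ := 0)
          (by rw [Pi.add_apply, hL0, hL0, hL0])
        rw [this]
        rfl
      map_smul' := fun k v => by
        have := HorizontalOn.eq_of_path hγ (hL (k • v)) ((hL v).smul hc k) (t₀ := 0)
          (by rw [Pi.smul_apply, hL0, hL0])
        rw [this]
        rfl }
  have hinj : Function.Injective H := fun v w h => by
    have := HorizontalOn.eq_of_path hγ (hL v) (hL w) (t₀ := 1) h
    rw [← hL0 v, ← hL0 w, this]
  let T : solutionSpace a b ≃ₗ[ℂ] solutionSpace a b :=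
    (jetEquiv hb).trans ((LinearEquiv.ofInjectiveEndo H hinj).trans (jetEquiv hb).symm)
  have hT : ∀ φ, jet n (rep (T φ)) b = L (jet n (rep φ) b) 1 := fun φ => by
    rw [← jetEquiv_apply hb (T φ)]
    simp only [T, LinearEquiv.trans_apply, LinearEquiv.apply_symm_apply]
    rfl
  refine ⟨T, Subgroup.subset_closure ⟨γ, hγ, fun φ => ?_⟩, fun φ v hv hv0 => ?_⟩
  · exact continuesTo_of_horizontal hγ (hL (jet n (rep φ) b)) (hL0 _) (hT φ).symm
  · rw [hT, HorizontalOn.eq_of_path hγ hv (hL (jet n (rep φ) b)) (t₀ := 0) (by rw [hv0, hL0])]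

end Monodromy

/-! ### Persistence of relations and single-valued expressions -/

section SingleValued

open unitInterval

variable {n : ℕ} {a : Fin n → RatFunc ℂ}

/-- Continuation along `γ` takes the Cauchy data `c` to `c'`. -/
def Transports (a : Fin n → RatFunc ℂ) {x y : ℂ} (γ : Path x y) (c c' : Fin n → ℂ) : Prop :=
  ∃ v : I → Fin n → ℂ, HorizontalOn a Set.univ γ v ∧ v 0 = c ∧ v 1 = c'

theorem Transports.symm {x y : ℂ} {γ : Path x y} {c c' : Fin n → ℂ} (h : Transports a γ c c') :
    Transports a γ.symm c' c := by
  obtain ⟨v, hv, h0, h1⟩ := h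
  refine ⟨v ∘ σ, (hv.comp continuous_symm).mono (fun _ _ => trivial), ?_, ?_⟩
  · simpa using h1
  · simpa using h0

/-- In one complex variable, differentiability nearby gives analyticity, so complex
differentiability of Q suffices and no power series in several variables is needed. -/
theorem analyticAt_comp_tuple {ι : Type*} [Fintype ι] {Q : (ι → ℂ) → ℂ} (hQ : Differentiable ℂ Q) {F : ι → ℂ → ℂ} {z : ℂ}
    (hF : ∀ i, AnalyticAt ℂ (F i) z) : AnalyticAt ℂ (fun x => Q fun i => F i x) z := by
  rw [Complex.analyticAt_iff_eventually_differentiableAt]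
  have : ∀ᶠ x in 𝓝 z, ∀ i, AnalyticAt ℂ (F i) x :=
    eventually_all.2 fun i => (hF i).eventually_analyticAt
  filter_upwards [this] with x hx
  exact (hQ _).comp x (differentiableAt_pi.2 fun i => (hx i).differentiableAt)

theorem transports_jet {x y : ℂ} (γ : Path x y) {F : ℂ → ℂ} (hF : ∀ t, IsSolutionAt a (γ t) F) :
    Transports a γ (jet n F x) (jet n F y) :=
  ⟨fun t => jet n F (γ t), horizontalOn_jet fun t _ => hF t, by simp, by simp⟩

theorem exists_path_avoiding {x y : ℂ} (hx : x ∉ singularSet a) (hy : y ∉ singularSet a) :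
    ∃ γ : Path x y, ∀ t, γ t ∉ singularSet a := by
  have h := (finite_singularSet a).countable.isPathConnected_compl_of_one_lt_rank
    (by rw [Complex.rank_real_complex]; norm_num)
  obtain ⟨γ, hγ⟩ := h.joinedIn x hx y hy
  exact ⟨γ, hγ⟩

variable {ι : Type*}

/-- `F` is obtained from the tuple `f` of solutions at `b` by continuation to `z`. -/
def IsContinuation {b : ℂ} (f : ι → solutionSpace a b) (z : ℂ) (F : ι → ℂ → ℂ) : Prop :=
  (∀ i, IsSolutionAt a z (F i)) ∧ ∃ γ : Path b z, (∀ t, γ t ∉ singularSet a) ∧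
    ∀ i, Transports a γ (jet n (rep (f i)) b) (jet n (F i) z)

theorem isContinuation_rep {b : ℂ} (hb : b ∉ singularSet a) (f : ι → solutionSpace a b) :
    IsContinuation f b fun i => rep (f i) :=
  ⟨fun _ => isSolutionAt_rep _, Path.refl b, fun _ => hb,
    fun i => transports_jet _ fun _ => isSolutionAt_rep (f i)⟩

variable [NeZero n]

theorem Transports.unique {x y : ℂ} {γ : Path x y} (hγ : ∀ t, γ t ∉ singularSet a)
    {c c₁ c₂ : Fin n → ℂ} (h₁ : Transports a γ c c₁) (h₂ : Transports a γ c c₂) : c₁ = c₂ := by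
  obtain ⟨v, hv, hv0, hv1⟩ := h₁
  obtain ⟨w, hw, hw0, hw1⟩ := h₂
  rw [← hv1, ← hw1, hv.eq_of_path hγ hw (t₀ := 0) (by rw [hv0, hw0])]

theorem exists_transports {x y : ℂ} {γ : Path x y} (hγ : ∀ t, γ t ∉ singularSet a)
    (c : Fin n → ℂ) : ∃ c', Transports a γ c c' := by
  obtain ⟨v, h0, hv⟩ := exists_horizontal_path γ hγ c
  exact ⟨v 1, v, hv, h0, rfl⟩

theorem Transports.trans {x y z : ℂ} {γ₁ : Path x y} {γ₂ : Path y z}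
    (h₁ : ∀ t, γ₁ t ∉ singularSet a) (h₂ : ∀ t, γ₂ t ∉ singularSet a) {c₁ c₂ c₃ : Fin n → ℂ}
    (hc₁ : Transports a γ₁ c₁ c₂) (hc₂ : Transports a γ₂ c₂ c₃) :
    Transports a (γ₁.trans γ₂) c₁ c₃ := by
  have hγ : ∀ t, (γ₁.trans γ₂) t ∉ singularSet a := by
    intro t
    rw [Path.trans_apply]
    split_ifs
    · exact h₁ _
    · exact h₂ _
  obtain ⟨v, hv0, hv⟩ := exists_horizontal_path (γ₁.trans γ₂) hγ c₁
  -- The continuation along the concatenated path is restricted to its two halves, where uniqueness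
  -- identifies it with the given continuations.
  let l : I → I := fun t => ⟨t / 2, by constructor <;> linarith [t.2.1, t.2.2]⟩
  let r : I → I := fun t => ⟨(t + 1) / 2, by constructor <;> linarith [t.2.1, t.2.2]⟩
  have hl : Continuous l := by fun_prop
  have hr : Continuous r := by fun_prop
  have hγl : (γ₁.trans γ₂) ∘ l = γ₁ := by
    ext t
    have : ((l t : I) : ℝ) ≤ 1 / 2 := by simp only [l]; linarith [t.2.2]
    rw [Function.comp_apply, Path.trans_apply, dif_pos this]
    congr 1
    ext
    simp only [l]
    ring
  have hγr : (γ₁.trans γ₂) ∘ r = γ₂ := by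
    ext t
    rw [Function.comp_apply, Path.trans_apply]
    split_ifs with h
    · have h0 : t = 0 := by
        ext
        simp only [r] at h
        rw [Set.Icc.coe_zero]
        linarith [t.2.1]
      subst h0
      simp [r]
    · congr 1
      ext
      simp only [r]
      ring
  have hvl := (hv.comp hl).mono (Set.subset_univ _ : Set.univ ⊆ _)
  have hvr := (hv.comp hr).mono (Set.subset_univ _ : Set.univ ⊆ _)
  rw [hγl] at hvl
  rw [hγr] at hvr
  have e1 : l 0 = 0 := by ext; simp [l]
  have e2 : l 1 = r 0 := by ext; simp [l, r]
  have e3 : r 1 = 1 := by ext; simp [r]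
  have k1 : v (r 0) = c₂ := by
    rw [← e2]
    exact Transports.unique h₁ (c := c₁) ⟨_, hvl, by simp [e1, hv0], rfl⟩ hc₁
  have k2 : v 1 = c₃ := by
    rw [← e3]
    exact Transports.unique h₂ (c := c₂) ⟨_, hvr, k1, rfl⟩ hc₂
  exact ⟨v, hv, hv0, k2⟩

theorem exists_isContinuation {b : ℂ} (hb : b ∉ singularSet a) (f : ι → solutionSpace a b) {z : ℂ}
    (hz : z ∉ singularSet a) : ∃ F, IsContinuation f z F := by
  obtain ⟨γ, hγ⟩ := exists_path_avoiding hb hz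
  choose c hc using fun i => exists_transports hγ (jet n (rep (f i)) b)
  choose F hF hFc using fun i => exists_solution hz (c i)
  exact ⟨F, hF, γ, hγ, fun i => by rw [hFc]; exact hc i⟩

theorem IsContinuation.of_mem_ball {b : ℂ} {f : ι → solutionSpace a b} {z₀ z : ℂ} {F : ι → ℂ → ℂ}
    (h : IsContinuation f z₀ F) {ρ : ℝ} (hz : z ∈ Metric.ball z₀ ρ)
    (hρ : ∀ x ∈ Metric.ball z₀ ρ, x ∉ singularSet a ∧ ∀ i, IsSolutionAt a x (F i)) :
    IsContinuation f z F := by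
  obtain ⟨_, γ, hγ, hT⟩ := h
  have hpos : 0 < ρ := lt_of_le_of_lt dist_nonneg (Metric.mem_ball.1 hz)
  have hmem : ∀ t, (Path.segment z₀ z) t ∈ Metric.ball z₀ ρ := fun t => by
    rw [Path.segment_apply]
    exact (convex_ball z₀ ρ).lineMap_mem (Metric.mem_ball_self hpos) hz t.2
  refine ⟨(hρ z hz).2, γ.trans (Path.segment z₀ z), fun t => ?_, fun i => ?_⟩
  · rw [Path.trans_apply]
    split_ifs
    · exact hγ _
    · exact (hρ _ (hmem _)).1
  · exact (hT i).trans hγ (fun t => (hρ _ (hmem t)).1)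
      (transports_jet _ fun t => (hρ _ (hmem t)).2 i)

variable [Fintype ι]

/-- Analytic relations between solutions persist under continuation. -/
theorem relation_of_transports {Q : (ι → ℂ) → ℂ} (hQ : Differentiable ℂ Q) {x y : ℂ}
    {γ : Path x y} (hγ : ∀ t, γ t ∉ singularSet a) {F F' G G' : ι → ℂ → ℂ}
    (hF : ∀ i, IsSolutionAt a x (F i)) (hF' : ∀ i, IsSolutionAt a y (F' i))
    (hG : ∀ i, IsSolutionAt a x (G i)) (hG' : ∀ i, IsSolutionAt a y (G' i))
    (hFF' : ∀ i, Transports a γ (jet n (F i) x) (jet n (F' i) y))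
    (hGG' : ∀ i, Transports a γ (jet n (G i) x) (jet n (G' i) y))
    (h : (fun z => Q fun i => F i z) =ᶠ[𝓝 x] fun z => Q fun i => G i z) :
    (fun z => Q fun i => F' i z) =ᶠ[𝓝 y] fun z => Q fun i => G' i z := by
  choose v hv hv0 hv1 using hFF'
  choose w hw hw0 hw1 using hGG'
  choose A hA hAv using fun i t => hv i t (Set.mem_univ t)
  choose B hB hBw using fun i t => hw i t (Set.mem_univ t)
  -- E t says that the relation holds between the branches at time t. By the identity theorem on a
  -- small disc around γ t it is locally constant in t, hence constant.
  let E : I → Prop := fun t =>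
    (fun z => Q fun i => A i t z) =ᶠ[𝓝 (γ t)] fun z => Q fun i => B i t z
  have hE : IsLocallyConstant E := by
    rw [IsLocallyConstant.iff_eventually_eq]
    intro t
    have hsol : ∀ᶠ z in 𝓝 (γ t), ∀ i, IsSolutionAt a z (A i t) ∧ IsSolutionAt a z (B i t) :=
      eventually_all.2 fun i => (hA i t).eventually.and (hB i t).eventually
    obtain ⟨ρ, hρ, hball⟩ := Metric.eventually_nhds_iff_ball.1 hsol
    have hv' : ∀ᶠ s in 𝓝 t, ∀ i, v i s = jet n (A i t) (γ s) ∧ w i s = jet n (B i t) (γ s) :=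
      eventually_all.2 fun i => (hAv i t).and (hBw i t)
    filter_upwards [hv', γ.continuous.continuousAt (Metric.ball_mem_nhds (γ t) hρ)] with s hs hsb
    have eA : ∀ᶠ z in 𝓝 (γ s), ∀ i, A i s z = A i t z := eventually_all.2 fun i =>
      (hA i s).eventuallyEq (hγ s) (hball _ hsb i).1
        (by rw [← (hs i).1, ← (hAv i s).self_of_nhds])
    have eB : ∀ᶠ z in 𝓝 (γ s), ∀ i, B i s z = B i t z := eventually_all.2 fun i =>
      (hB i s).eventuallyEq (hγ s) (hball _ hsb i).2
        (by rw [← (hs i).2, ← (hBw i s).self_of_nhds])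
    have hanA : AnalyticOnNhd ℂ (fun z => Q fun i => A i t z) (Metric.ball (γ t) ρ) :=
      fun z hz => analyticAt_comp_tuple hQ fun i => (hball z hz i).1.1
    have hanB : AnalyticOnNhd ℂ (fun z => Q fun i => B i t z) (Metric.ball (γ t) ρ) :=
      fun z hz => analyticAt_comp_tuple hQ fun i => (hball z hz i).2.1
    have hpre := (convex_ball (γ t) ρ).isPreconnected
    have spread : ∀ z ∈ Metric.ball (γ t) ρ, ∀ z' ∈ Metric.ball (γ t) ρ,
        ((fun z => Q fun i => A i t z) =ᶠ[𝓝 z] fun z => Q fun i => B i t z) →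
        ((fun z => Q fun i => A i t z) =ᶠ[𝓝 z'] fun z => Q fun i => B i t z) := by
      intro z hz z' hz' h
      have := hanA.eqOn_of_preconnected_of_eventuallyEq hanB hpre hz h
      exact this.eventuallyEq_of_mem (Metric.isOpen_ball.mem_nhds hz')
    have e1 : (fun z => Q fun i => A i s z) =ᶠ[𝓝 (γ s)] fun z => Q fun i => A i t z := by
      filter_upwards [eA] with z hz
      simp only [hz]
    have e2 : (fun z => Q fun i => B i s z) =ᶠ[𝓝 (γ s)] fun z => Q fun i => B i t z := by
      filter_upwards [eB] with z hz
      simp only [hz]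
    refine propext ⟨fun h => ?_, fun h => ?_⟩
    · exact spread _ hsb _ (Metric.mem_ball_self hρ) ((e1.symm.trans h).trans e2)
    · exact (e1.trans (spread _ (Metric.mem_ball_self hρ) _ hsb h)).trans e2.symm
  have h01 : E 0 = E 1 := hE.apply_eq_of_preconnectedSpace 0 1
  have hx : x ∉ singularSet a := γ.source ▸ hγ 0
  have hy : y ∉ singularSet a := γ.target ▸ hγ 1
  have start : E 0 := by
    change (fun z => Q fun i => A i 0 z) =ᶠ[𝓝 (γ 0)] fun z => Q fun i => B i 0 z
    have hA0 := fun i => hA i 0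
    have hB0 := fun i => hB i 0
    have hA0' := fun i => (hAv i 0).self_of_nhds
    have hB0' := fun i => (hBw i 0).self_of_nhds
    simp only [γ.source] at hA0 hB0 hA0' hB0' ⊢
    have eA : ∀ᶠ z in 𝓝 x, ∀ i, A i 0 z = F i z := eventually_all.2 fun i =>
      (hA0 i).eventuallyEq hx (hF i) (by rw [← hA0', hv0])
    have eB : ∀ᶠ z in 𝓝 x, ∀ i, B i 0 z = G i z := eventually_all.2 fun i =>
      (hB0 i).eventuallyEq hx (hG i) (by rw [← hB0', hw0])
    filter_upwards [eA, eB, h] with z h1 h2 h3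
    simp only [h1, h2]
    exact h3
  have fin : (fun z => Q fun i => A i 1 z) =ᶠ[𝓝 (γ 1)] fun z => Q fun i => B i 1 z := by
    have : E 1 := h01 ▸ start
    exact this
  have hA0 := fun i => hA i 1
  have hB0 := fun i => hB i 1
  have hA0' := fun i => (hAv i 1).self_of_nhds
  have hB0' := fun i => (hBw i 1).self_of_nhds
  simp only [γ.target] at hA0 hB0 hA0' hB0' fin
  have eA : ∀ᶠ z in 𝓝 y, ∀ i, A i 1 z = F' i z := eventually_all.2 fun i =>
    (hA0 i).eventuallyEq hy (hF' i) (by rw [← hA0', hv1])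
  have eB : ∀ᶠ z in 𝓝 y, ∀ i, B i 1 z = G' i z := eventually_all.2 fun i =>
    (hB0 i).eventuallyEq hy (hG' i) (by rw [← hB0', hw1])
  filter_upwards [eA, eB, fin] with z h1 h2 h3
  simpa only [h1, h2] using h3

/-- Going out along the path of F and back along that of G is a loop at b, hence some T in the
monodromy group. Thus F is the continuation of the T (f i) along the path of G, and the invariance
at b is transported along that path. -/
theorem IsContinuation.relation {b : ℂ} {f : ι → solutionSpace a b} {Q : (ι → ℂ) → ℂ}
    (hQ : Differentiable ℂ Q)
    (hinv : ∀ T ∈ monodromyGroup a b, (fun z => Q fun i => rep (T (f i)) z) =ᶠ[𝓝 b]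
      fun z => Q fun i => rep (f i) z) {z₀ : ℂ} {F G : ι → ℂ → ℂ} (hF : IsContinuation f z₀ F)
    (hG : IsContinuation f z₀ G) :
    (fun z => Q fun i => F i z) =ᶠ[𝓝 z₀] fun z => Q fun i => G i z := by
  obtain ⟨hFs, γ, hγ, hγF⟩ := hF
  obtain ⟨hGs, γ', hγ', hγG⟩ := hG
  have hsymm : ∀ t, γ'.symm t ∉ singularSet a := fun t => hγ' _
  obtain ⟨T, hTG, hT⟩ := exists_monodromy (γ.trans γ'.symm) (fun t => by
    rw [Path.trans_apply]
    split_ifs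
    · exact hγ _
    · exact hsymm _)
  refine relation_of_transports hQ hγ' (fun i => isSolutionAt_rep (T (f i))) hFs
    (fun i => isSolutionAt_rep (f i)) hGs (fun i => ?_) hγG (hinv T hTG)
  obtain ⟨c, hc⟩ := exists_transports hsymm (jet n (F i) z₀)
  obtain ⟨v, hv, hv0, hv1⟩ := (hγF i).trans hγ hsymm hc
  have := hT (f i) v hv hv0
  rw [← this, hv1]
  simpa using hc.symm

/-- An expression in solutions that is invariant under monodromy is a single-valued function. -/
theorem exists_singleValued {b : ℂ} (hb : b ∉ singularSet a) {f : ι → solutionSpace a b}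
    {Q : (ι → ℂ) → ℂ} (hQ : Differentiable ℂ Q)
    (hinv : ∀ T ∈ monodromyGroup a b, (fun z => Q fun i => rep (T (f i)) z) =ᶠ[𝓝 b]
      fun z => Q fun i => rep (f i) z) :
    ∃ Φ : ℂ → ℂ, (Φ =ᶠ[𝓝 b] fun z => Q fun i => rep (f i) z) ∧
      ∀ z₀ ∉ singularSet a, ∃ F : ι → ℂ → ℂ, (∀ i, IsSolutionAt a z₀ (F i)) ∧
        Φ =ᶠ[𝓝 z₀] fun z => Q fun i => F i z := by
  classical
  choose! F hF using fun z (hz : z ∉ singularSet a) => exists_isContinuation hb f hz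
  -- The branches F z are chosen independently for each z. By invariance the value of Q does not
  -- depend on the choice, so near z₀ it agrees with Q of a single continuation G.
  have key : ∀ z₀ ∉ singularSet a, ∀ G : ι → ℂ → ℂ, IsContinuation f z₀ G →
      (fun z => Q fun i => F z i z) =ᶠ[𝓝 z₀] fun z => Q fun i => G i z := by
    intro z₀ hz₀ G hG
    have hev : ∀ᶠ x in 𝓝 z₀, x ∉ singularSet a ∧ ∀ i, IsSolutionAt a x (G i) :=
      ((isOpen_compl_singularSet a).eventually_mem hz₀).and
        (eventually_all.2 fun i => (hG.1 i).eventually)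
    obtain ⟨ρ, hρ, hball⟩ := Metric.eventually_nhds_iff_ball.1 hev
    filter_upwards [Metric.ball_mem_nhds z₀ hρ] with z hz
    exact ((hF z (hball z hz).1).relation hQ hinv (hG.of_mem_ball hz hball)).self_of_nhds
  exact ⟨fun z => Q fun i => F z i z, key b hb _ (isContinuation_rep hb f), fun z₀ hz₀ =>
    ⟨F z₀, (hF z₀ hz₀).1, key z₀ hz₀ _ (hF z₀ hz₀)⟩⟩

end SingleValued

/-! ### The universal covering of a punctured disc at P and the local monodromy -/

section HalfPlane

/-- The point around which the local monodromy at `P` turns. -/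
def center : OnePoint ℂ → ℂ
  | OnePoint.infty => 0
  | OnePoint.some p => p

/-- The sign that relates `z - center P` to the local parameter at `P`. -/
def orient : OnePoint ℂ → ℝ
  | OnePoint.infty => -1
  | OnePoint.some _ => 1

/-- The universal covering `s ↦ z`, `t(z) = t(b) e^s`, of a punctured disc around `P`. -/
noncomputable def toPlane (P : OnePoint ℂ) (b s : ℂ) : ℂ :=
  center P + (b - center P) * Complex.exp (orient P * s)

theorem orient_mul_self (P : OnePoint ℂ) : orient P * orient P = 1 := by
  induction P using OnePoint.rec <;> norm_num [orient]

theorem toPlane_zero (P : OnePoint ℂ) (b : ℂ) : toPlane P b 0 = b := by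
  simp [toPlane]

theorem toPlane_sub_center (P : OnePoint ℂ) (b s : ℂ) :
    toPlane P b s - center P = (b - center P) * Complex.exp (orient P * s) := by
  simp [toPlane]

theorem toPlane_add_period (P : OnePoint ℂ) (b s : ℂ) :
    toPlane P b (s + 2 * Real.pi * Complex.I) = toPlane P b s := by
  unfold toPlane
  congr 2
  induction P using OnePoint.rec with
  | infty =>
    simp only [orient]
    rw [Complex.exp_eq_exp_iff_exists_int]
    exact ⟨-1, by push_cast; ring⟩
  | coe p =>
    simp only [orient]
    rw [Complex.exp_eq_exp_iff_exists_int]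
    exact ⟨1, by push_cast; ring⟩

theorem hasDerivAt_toPlane (P : OnePoint ℂ) (b s : ℂ) :
    HasDerivAt (toPlane P b) (orient P * (toPlane P b s - center P)) s := by
  have := ((((hasDerivAt_id s).const_mul (orient P : ℂ)).cexp).const_mul
    (b - center P)).const_add (center P)
  convert! this using 1
  rw [toPlane_sub_center]
  simp only [id]
  ring

theorem differentiable_toPlane (P : OnePoint ℂ) (b : ℂ) : Differentiable ℂ (toPlane P b) :=
  fun s => (hasDerivAt_toPlane P b s).differentiableAt

theorem tendsto_toPlane_zero (P : OnePoint ℂ) (b : ℂ) : Tendsto (toPlane P b) (𝓝 0) (𝓝 b) := by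
  have := (differentiable_toPlane P b).continuous.tendsto 0
  rwa [toPlane_zero] at this

theorem norm_toPlane_sub_center (P : OnePoint ℂ) (b s : ℂ) :
    ‖toPlane P b s - center P‖ = ‖b - center P‖ * Real.exp (orient P * s.re) := by
  rw [toPlane_sub_center, norm_mul, Complex.norm_exp, Complex.re_ofReal_mul]

theorem log_localParam_toPlane {P : OnePoint ℂ} {b s : ℂ} (hb : b ≠ center P)
    (h1 : -Real.pi < s.im) (h2 : s.im ≤ Real.pi) :
    Complex.log (localParam P (toPlane P b s) / localParam P b) = s := by
  have key : localParam P (toPlane P b s) / localParam P b = Complex.exp s := by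
    induction P using OnePoint.rec with
    | infty =>
      have hb' : b ≠ 0 := hb
      simp only [toPlane, center, orient, localParam, sub_zero, zero_add, Complex.ofReal_neg,
        Complex.ofReal_one, neg_mul, one_mul, Complex.exp_neg]
      field_simp
    | coe p =>
      have hb' : b - p ≠ 0 := sub_ne_zero.2 hb
      simp only [toPlane, center, orient, localParam, Complex.ofReal_one, one_mul,
        add_sub_cancel_left]
      field_simp
  rw [key, Complex.log_exp h1 h2]

theorem toPlane_log_localParam {P : OnePoint ℂ} {b z : ℂ} (hb : b ≠ center P) (hz : z ≠ center P) :
    toPlane P b (Complex.log (localParam P z / localParam P b)) = z := by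
  induction P using OnePoint.rec with
  | infty =>
    have hb' : b ≠ 0 := hb
    have hz' : z ≠ 0 := hz
    simp only [toPlane, center, orient, localParam, sub_zero, zero_add, Complex.ofReal_neg,
        Complex.ofReal_one, neg_mul, one_mul, Complex.exp_neg]
    rw [Complex.exp_log (by simp [hb', hz'])]
    field_simp
  | coe p =>
    have hb' : b - p ≠ 0 := sub_ne_zero.2 hb
    have hz' : z - p ≠ 0 := sub_ne_zero.2 hz
    simp only [toPlane, center, orient, localParam, Complex.ofReal_one, one_mul]
    rw [Complex.exp_log (div_ne_zero hz' hb')]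
    field_simp
    ring

theorem continuousAt_log_localParam {P : OnePoint ℂ} {b : ℂ} (hb : b ≠ center P) :
    ContinuousAt (fun z => Complex.log (localParam P z / localParam P b)) b := by
  induction P using OnePoint.rec with
  | infty =>
    have hb' : b ≠ 0 := hb
    refine ContinuousAt.clog ?_ (by simp [localParam, hb'])
    simp only [localParam]
    exact (continuousAt_inv₀ hb').div_const _
  | coe p =>
    have hb' : b - p ≠ 0 := sub_ne_zero.2 hb
    refine ContinuousAt.clog ?_ (by simp [localParam, hb'])
    simp only [localParam]
    fun_prop

theorem log_localParam_self {P : OnePoint ℂ} {b : ℂ} (hb : b ≠ center P) :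
    Complex.log (localParam P b / localParam P b) = 0 := by
  have := log_localParam_toPlane (s := 0) hb (by simp [Real.pi_pos]) (by simp [Real.pi_pos.le])
  rwa [toPlane_zero] at this

variable {n : ℕ} {a : Fin n → RatFunc ℂ} {b : ℂ} {P : OnePoint ℂ}

theorem IsNear.ne_center (h : IsNear a b P) : b ≠ center P := by
  induction P using OnePoint.rec with
  | infty => exact h.1
  | coe p => exact h.1

/-- Nearness is a strict inequality for finitely many singular points, so the closed disc can be
enlarged a little. The point P itself is never reached, as the exponential has no zero. The margin
makes the half-plane open with 0 in its interior. -/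
theorem IsNear.exists_pos (h : IsNear a b P) :
    ∃ δ : ℝ, 0 < δ ∧ ∀ s : ℂ, s.re < δ → toPlane P b s ∉ singularSet a := by
  have hbc := h.ne_center
  have hpos : 0 < ‖b - center P‖ := norm_pos_iff.2 (sub_ne_zero.2 hbc)
  have key : ∀ σ ∈ singularSet a, ∀ᶠ δ : ℝ in 𝓝[>] 0, ∀ s : ℂ, s.re < δ → toPlane P b s ≠ σ := by
    intro σ hσ
    by_cases hσc : σ = center P
    · refine Eventually.of_forall fun δ s _ hs => ?_
      have := toPlane_sub_center P b s
      rw [hs, hσc, sub_self] at this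
      exact mul_ne_zero (sub_ne_zero.2 hbc) (Complex.exp_ne_zero _) this.symm
    refine mem_nhdsWithin_of_mem_nhds ?_
    induction P using OnePoint.rec with
    | infty =>
      have hlt := h.2 σ hσ
      have hcont : ContinuousAt (fun δ : ℝ => ‖b‖ * Real.exp (-δ)) 0 := by fun_prop
      have := hcont.eventually (lt_mem_nhds (a := ‖σ‖) (by simpa using hlt))
      filter_upwards [this] with δ hδ s hs hsσ
      have h1 := norm_toPlane_sub_center OnePoint.infty b s
      rw [hsσ] at h1
      simp only [center, orient, sub_zero, neg_mul, one_mul] at h1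
      rw [h1] at hδ
      have : Real.exp (-δ) ≤ Real.exp (-s.re) := Real.exp_le_exp.2 (by linarith)
      nlinarith [norm_nonneg b]
    | coe p =>
      have hlt := h.2 σ hσ hσc
      have hcont : ContinuousAt (fun δ : ℝ => ‖b - p‖ * Real.exp δ) 0 := by fun_prop
      have := hcont.eventually (gt_mem_nhds (a := ‖σ - p‖) (by simpa using hlt))
      filter_upwards [this] with δ hδ s hs hsσ
      have h1 := norm_toPlane_sub_center (OnePoint.some p) b s
      rw [hsσ] at h1
      simp only [center, orient, one_mul] at h1
      rw [h1] at hδ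
      have : Real.exp s.re ≤ Real.exp δ := Real.exp_le_exp.2 (by linarith)
      nlinarith [norm_nonneg (b - p)]
  have h2 := (finite_singularSet a).eventually_all.2 key
  obtain ⟨δ, hδ, hδpos⟩ := (h2.and self_mem_nhdsWithin).exists
  exact ⟨δ, hδpos, fun s hs hmem => hδ _ hmem s hs rfl⟩

/-- The logarithmic width of a punctured disc at `P` that contains `b`. -/
noncomputable def IsNear.width (h : IsNear a b P) : ℝ := Classical.choose h.exists_pos

/-- The half-plane that covers a punctured disc at `P`. -/
def IsNear.halfPlane (h : IsNear a b P) : Set ℂ := {s | s.re < h.width}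

theorem IsNear.width_pos (h : IsNear a b P) : 0 < h.width :=
  (Classical.choose_spec h.exists_pos).1

theorem IsNear.toPlane_notMem (h : IsNear a b P) {s : ℂ} (hs : s ∈ h.halfPlane) :
    toPlane P b s ∉ singularSet a :=
  (Classical.choose_spec h.exists_pos).2 s hs

theorem IsNear.isOpen_halfPlane (h : IsNear a b P) : IsOpen h.halfPlane :=
  isOpen_lt Complex.continuous_re continuous_const

theorem IsNear.convex_halfPlane (h : IsNear a b P) : Convex ℝ h.halfPlane :=
  convex_halfSpace_re_lt _

theorem IsNear.mem_halfPlane (h : IsNear a b P) {s : ℂ} (hs : s.re ≤ 0) : s ∈ h.halfPlane :=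
  lt_of_le_of_lt hs h.width_pos

theorem IsNear.zero_mem (h : IsNear a b P) : (0 : ℂ) ∈ h.halfPlane := h.mem_halfPlane le_rfl

theorem re_add_period (s : ℂ) : (s + 2 * Real.pi * Complex.I).re = s.re := by
  simp [Complex.mul_re]

theorem IsNear.add_period_mem (h : IsNear a b P) {s : ℂ} (hs : s ∈ h.halfPlane) :
    s + 2 * Real.pi * Complex.I ∈ h.halfPlane := by
  change (s + 2 * Real.pi * Complex.I).re < _
  rw [re_add_period]
  exact hs

theorem IsNear.notMem (h : IsNear a b P) : b ∉ singularSet a := by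
  have := h.toPlane_notMem h.zero_mem
  rwa [toPlane_zero] at this

variable [NeZero n]

/-- Pulled back along the covering, the companion system is a holomorphic linear system on a convex
half-plane, so the solution extends to all of it. -/
theorem IsNear.exists_extension (h : IsNear a b P) (φ : solutionSpace a b) :
    ∃ w : ℂ → Fin n → ℂ, w 0 = jet n (rep φ) b ∧ HorizontalOn a h.halfPlane (toPlane P b) w ∧
      ∀ s ∈ h.halfPlane, HasDerivAt w
        ((orient P * (toPlane P b s - center P)) • companion a (toPlane P b s) (w s)) s :=
  exists_horizontalOn_of_convex h.isOpen_halfPlane h.convex_halfPlane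
    (fun s _ => hasDerivAt_toPlane P b s)
    (((differentiable_toPlane P b).sub_const _).const_mul _).differentiableOn
    (fun _ hs => h.toPlane_notMem hs) h.zero_mem _

/-- The Cauchy data of the continuation of `φ` to the universal covering of a punctured disc
at `P`. -/
noncomputable def IsNear.extension (h : IsNear a b P) (φ : solutionSpace a b) : ℂ → Fin n → ℂ :=
  Classical.choose (h.exists_extension φ)

theorem IsNear.extension_zero (h : IsNear a b P) (φ : solutionSpace a b) :
    h.extension φ 0 = jet n (rep φ) b :=
  (Classical.choose_spec (h.exists_extension φ)).1

theorem IsNear.horizontalOn_extension (h : IsNear a b P) (φ : solutionSpace a b) :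
    HorizontalOn a h.halfPlane (toPlane P b) (h.extension φ) :=
  (Classical.choose_spec (h.exists_extension φ)).2.1

theorem IsNear.hasDerivAt_extension (h : IsNear a b P) (φ : solutionSpace a b) {s : ℂ}
    (hs : s ∈ h.halfPlane) : HasDerivAt (h.extension φ)
      ((orient P * (toPlane P b s - center P)) • companion a (toPlane P b s) (h.extension φ s)) s :=
  (Classical.choose_spec (h.exists_extension φ)).2.2 s hs

theorem IsNear.eqOn_of_horizontalOn (h : IsNear a b P) {v w : ℂ → Fin n → ℂ}
    (hv : HorizontalOn a h.halfPlane (toPlane P b) v)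
    (hw : HorizontalOn a h.halfPlane (toPlane P b) w) {s₀ : ℂ} (hs₀ : s₀ ∈ h.halfPlane)
    (h0 : v s₀ = w s₀) : Set.EqOn v w h.halfPlane :=
  hv.eqOn h.isOpen_halfPlane h.convex_halfPlane.isPreconnected
    (fun s _ => (hasDerivAt_toPlane P b s).continuousAt) (fun _ hs => h.toPlane_notMem hs) hw hs₀ h0

theorem IsNear.extension_add (h : IsNear a b P) (φ ψ : solutionSpace a b) :
    Set.EqOn (h.extension (φ + ψ)) (h.extension φ + h.extension ψ) h.halfPlane :=
  h.eqOn_of_horizontalOn (h.horizontalOn_extension _)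
    ((h.horizontalOn_extension φ).add (fun s _ => (hasDerivAt_toPlane P b s).continuousAt)
      (h.horizontalOn_extension ψ)) h.zero_mem (by
      rw [Pi.add_apply, h.extension_zero, h.extension_zero, h.extension_zero,
        ← jetEquiv_apply h.notMem, map_add, jetEquiv_apply, jetEquiv_apply])

theorem IsNear.extension_smul (h : IsNear a b P) (c : ℂ) (φ : solutionSpace a b) :
    Set.EqOn (h.extension (c • φ)) (c • h.extension φ) h.halfPlane :=
  h.eqOn_of_horizontalOn (h.horizontalOn_extension _)
    ((h.horizontalOn_extension φ).smul (fun s _ => (hasDerivAt_toPlane P b s).continuousAt) c)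
      h.zero_mem (by
      rw [Pi.smul_apply, h.extension_zero, h.extension_zero,
        ← jetEquiv_apply h.notMem, map_smul, jetEquiv_apply])

/-- The continuation of `φ` to the universal covering of a punctured disc at `P`. -/
noncomputable def IsNear.lift (h : IsNear a b P) (φ : solutionSpace a b) (s : ℂ) : ℂ :=
  h.extension φ s 0

theorem IsNear.hasDerivAt_extension_apply (h : IsNear a b P) (φ : solutionSpace a b) {s : ℂ}
    (hs : s ∈ h.halfPlane) (k : Fin n) : HasDerivAt (fun s => h.extension φ s k)
      ((orient P * (toPlane P b s - center P)) *
        companion a (toPlane P b s) (h.extension φ s) k) s :=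
  hasDerivAt_pi.1 (h.hasDerivAt_extension φ hs) k

theorem IsNear.analyticOnNhd_lift (h : IsNear a b P) (φ : solutionSpace a b) :
    AnalyticOnNhd ℂ (h.lift φ) h.halfPlane := by
  refine DifferentiableOn.analyticOnNhd (fun s hs => ?_) h.isOpen_halfPlane
  exact (h.hasDerivAt_extension_apply φ hs 0).differentiableAt.differentiableWithinAt

theorem IsNear.exists_lift_eq (h : IsNear a b P) (φ : solutionSpace a b) {s : ℂ}
    (hs : s ∈ h.halfPlane) : ∃ F : ℂ → ℂ, IsSolutionAt a (toPlane P b s) F ∧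
      jet n F (toPlane P b s) = h.extension φ s ∧
      ∀ᶠ x in 𝓝 s, h.lift φ x = F (toPlane P b x) := by
  obtain ⟨F, hF, hFv⟩ := h.horizontalOn_extension φ s hs
  refine ⟨F, hF, hFv.self_of_nhds.symm, ?_⟩
  filter_upwards [hFv] with x hx
  simp [IsNear.lift, hx, jet]

theorem IsNear.lift_eventuallyEq (h : IsNear a b P) (φ : solutionSpace a b) :
    ∀ᶠ s in 𝓝 0, h.lift φ s = rep φ (toPlane P b s) := by
  obtain ⟨F, hF, hjet, hev⟩ := h.exists_lift_eq φ h.zero_mem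
  rw [toPlane_zero, h.extension_zero] at hjet
  rw [toPlane_zero] at hF
  have h1 := hF.eventuallyEq h.notMem (isSolutionAt_rep φ) hjet
  filter_upwards [hev, (tendsto_toPlane_zero P b).eventually h1] with s h3 h4
  rw [h3, h4]

theorem eventually_toPlane_log (hb : b ≠ center P) :
    ∀ᶠ z in 𝓝 b, toPlane P b (Complex.log (localParam P z / localParam P b)) = z := by
  filter_upwards [isOpen_ne.mem_nhds hb] with z hz using toPlane_log_localParam hb hz

theorem tendsto_log_localParam (hb : b ≠ center P) :
    Tendsto (fun z => Complex.log (localParam P z / localParam P b)) (𝓝 b) (𝓝 0) := by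
  have := continuousAt_log_localParam hb
  rwa [ContinuousAt, log_localParam_self hb] at this

theorem IsNear.rep_eventuallyEq_lift (h : IsNear a b P) (φ : solutionSpace a b) :
    rep φ =ᶠ[𝓝 b] fun z => h.lift φ (Complex.log (localParam P z / localParam P b)) := by
  filter_upwards [eventually_toPlane_log h.ne_center,
    (tendsto_log_localParam h.ne_center).eventually (h.lift_eventuallyEq φ)] with z h1 h2
  rw [h2, h1]

theorem eventually_log_toPlane (hb : b ≠ center P) :
    ∀ᶠ s in 𝓝 (0 : ℂ), Complex.log (localParam P (toPlane P b s) / localParam P b) = s := by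
  have h1 : ∀ᶠ s : ℂ in 𝓝 0, -Real.pi < s.im :=
    Complex.continuous_im.continuousAt.eventually (lt_mem_nhds (by simp [Real.pi_pos]))
  have h2 : ∀ᶠ s : ℂ in 𝓝 0, s.im < Real.pi :=
    Complex.continuous_im.continuousAt.eventually (gt_mem_nhds (by simp [Real.pi_pos]))
  filter_upwards [h1, h2] with s h1 h2 using log_localParam_toPlane hb h1 h2.le

/-- Any other continuation agrees with `lift`. -/
theorem IsNear.eq_lift (h : IsNear a b P) {φ : solutionSpace a b} {u : ℂ → ℂ}
    (hu : AnalyticOnNhd ℂ u {s | s.re ≤ 0})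
    (hφ : (φ : Germ (𝓝 b) ℂ) =
      ((fun z => u (Complex.log (localParam P z / localParam P b)) : ℂ → ℂ) : Germ (𝓝 b) ℂ)) :
    ∀ s : ℂ, s.re ≤ 0 → u s = h.lift φ s := by
  have h1 := rep_eventuallyEq hφ
  have h2 : u =ᶠ[𝓝 0] h.lift φ := by
    filter_upwards [h.lift_eventuallyEq φ, (tendsto_toPlane_zero P b).eventually h1,
      eventually_log_toPlane h.ne_center] with s h3 h4 h5
    rw [h3, h4, h5]
  have h3 := hu.eqOn_of_preconnected_of_eventuallyEq
    ((h.analyticOnNhd_lift φ).mono fun s hs => h.mem_halfPlane hs)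
    (convex_halfSpace_re_le 0).isPreconnected (show (0 : ℂ) ∈ {s : ℂ | s.re ≤ 0} by simp) h2
  exact fun s hs => h3 hs

/-- The local monodromy at `P`. -/
theorem IsNear.exists_localMonodromy (h : IsNear a b P) :
    ∃ M ∈ monodromyGroup a b, ∀ φ : solutionSpace a b, ∀ s ∈ h.halfPlane,
      h.extension (M φ) s = h.extension φ (s + 2 * Real.pi * Complex.I) := by
  -- The segment from 0 to 2πi covers the loop around P.
  let ℓ : unitInterval → ℂ := fun t => (t : ℝ) * (2 * Real.pi * Complex.I)
  have hℓ : Continuous ℓ := by fun_prop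
  have hℓmem : ∀ t, ℓ t ∈ h.halfPlane := fun t => h.mem_halfPlane (by simp [ℓ])
  let γ : Path b b :=
    { toFun := toPlane P b ∘ ℓ
      continuous_toFun := (differentiable_toPlane P b).continuous.comp hℓ
      source' := by simp [ℓ, toPlane_zero]
      target' := by
        have := toPlane_add_period P b 0
        rw [toPlane_zero, zero_add] at this
        simpa [ℓ] using this }
  obtain ⟨M, hMG, hM⟩ := exists_monodromy γ fun t => h.toPlane_notMem (hℓmem t)
  refine ⟨M, hMG, fun φ => ?_⟩
  have h1 : HorizontalOn a Set.univ γ (h.extension φ ∘ ℓ) :=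
    ((h.horizontalOn_extension φ).comp hℓ).mono fun t _ => hℓmem t
  have h2 := hM φ _ h1 (by simp [ℓ, h.extension_zero])
  -- The covering has period 2πi, so the translated extension is again horizontal. It agrees with
  -- the extension of M φ at 0, hence on the whole half-plane.
  have h3 : HorizontalOn a h.halfPlane (toPlane P b)
      (h.extension φ ∘ fun s => s + 2 * Real.pi * Complex.I) := by
    have h4 := ((h.horizontalOn_extension φ).comp
      (f := fun s : ℂ => s + 2 * Real.pi * Complex.I) (by fun_prop)).mono
      (fun s hs => h.add_period_mem hs : h.halfPlane ⊆ _)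
    have h5 : (toPlane P b ∘ fun s => s + 2 * Real.pi * Complex.I) = toPlane P b :=
      funext fun s => toPlane_add_period P b s
    rwa [h5] at h4
  refine h.eqOn_of_horizontalOn (h.horizontalOn_extension _) h3 h.zero_mem ?_
  rw [h.extension_zero, ← h2]
  simp [ℓ]

end HalfPlane

/-! ### Regular singularities and moderate growth -/

section Growth

theorem tendsto_eval_div_pow_cobounded {p : Polynomial ℂ} {d : ℕ} (hp : p.natDegree ≤ d) :
    Tendsto (fun z : ℂ => p.eval z / z ^ d) (Bornology.cobounded ℂ) (𝓝 (p.coeff d)) := by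
  have h0 : ∀ᶠ z : ℂ in Bornology.cobounded ℂ, z ≠ 0 := by
    have := Bornology.eventually_ne_cobounded (0 : ℂ)
    exact this
  have h1 : Tendsto (fun z : ℂ => ∑ i ∈ Finset.range (d + 1), p.coeff i * (z⁻¹) ^ (d - i))
      (Bornology.cobounded ℂ) (𝓝 (∑ i ∈ Finset.range (d + 1), p.coeff i * (0 : ℂ) ^ (d - i))) :=
    tendsto_finsetSum _ fun i _ => (tendsto_inv₀_cobounded.pow _).const_mul _
  have h2 : ∑ i ∈ Finset.range (d + 1), p.coeff i * (0 : ℂ) ^ (d - i) = p.coeff d := by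
    rw [Finset.sum_range_succ, Finset.sum_eq_zero, Nat.sub_self, pow_zero, mul_one, zero_add]
    intro i hi
    rw [zero_pow (Nat.sub_ne_zero_of_lt (Finset.mem_range.1 hi)), mul_zero]
  rw [h2] at h1
  refine h1.congr' ?_
  filter_upwards [h0] with z hz
  rw [Polynomial.eval_eq_sum_range' (Nat.lt_succ_of_le hp), Finset.sum_div]
  refine Finset.sum_congr rfl fun i hi => ?_
  rw [mul_div_assoc]
  congr 1
  rw [inv_pow, eq_div_iff (pow_ne_zero _ hz), ← div_eq_inv_mul,
    div_eq_iff (pow_ne_zero _ hz), ← pow_add]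
  congr 1
  have := Finset.mem_range.1 hi
  omega

theorem tendsto_ratVal_cobounded {f : RatFunc ℂ} (h : f.num.natDegree ≤ f.denom.natDegree) :
    Tendsto (ratVal f) (Bornology.cobounded ℂ) (𝓝 (f.num.coeff f.denom.natDegree)) := by
  have h1 := (tendsto_eval_div_pow_cobounded h).div
    (tendsto_eval_div_pow_cobounded (le_refl f.denom.natDegree))
    (by rw [Polynomial.coeff_natDegree, f.monic_denom.leadingCoeff]; exact one_ne_zero)
  rw [Polynomial.coeff_natDegree, f.monic_denom.leadingCoeff, div_one] at h1
  refine h1.congr' ?_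
  filter_upwards [Bornology.eventually_ne_cobounded (0 : ℂ)] with z hz
  rw [Pi.div_apply, ratVal_eq, div_div_div_cancel_right₀ (pow_ne_zero _ hz)]

/-- The filter of the points far to the left. -/
abbrev farLeft : Filter ℂ := comap Complex.re atBot

theorem eventually_farLeft {p : ℂ → Prop} :
    (∀ᶠ s in farLeft, p s) ↔ ∃ L : ℝ, ∀ s : ℂ, s.re < L → p s := by
  rw [eventually_comap]
  constructor
  · intro h
    obtain ⟨L, hL⟩ := eventually_atBot.1 h
    exact ⟨L, fun s hs => hL s.re hs.le s rfl⟩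
  · rintro ⟨L, hL⟩
    filter_upwards [Iio_mem_atBot L] with x hx s hs
    exact hL s (hs ▸ hx)

theorem eventually_eventually_farLeft {p : ℂ → Prop} (h : ∀ᶠ s in farLeft, p s) :
    ∀ᶠ s in farLeft, ∀ᶠ x in 𝓝 s, p x := by
  obtain ⟨L, hL⟩ := eventually_farLeft.1 h
  refine eventually_farLeft.2 ⟨L, fun s hs => ?_⟩
  filter_upwards [(isOpen_lt Complex.continuous_re continuous_const).mem_nhds
    (show s ∈ {s : ℂ | s.re < L} from hs)] with x hx using hL x hx

instance : farLeft.NeBot := by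
  refine comap_neBot fun t ht => ?_
  obtain ⟨x, hx⟩ := (inferInstance : (atBot : Filter ℝ).NeBot).nonempty_of_mem ht
  exact ⟨(x : ℂ), by simpa using hx⟩

theorem tendsto_ofReal_farLeft : Tendsto (fun x : ℝ => (x : ℂ)) atBot farLeft := by
  rw [tendsto_comap_iff]
  exact tendsto_id

theorem tendsto_exp_farLeft : Tendsto Complex.exp farLeft (𝓝 0) :=
  Complex.tendsto_exp_comap_re_atBot

/-- As `s` goes to the left, a rational function regular at `P` tends to its value at `P`. -/
theorem tendsto_ratVal_toPlane {P : OnePoint ℂ} {b : ℂ} (hb : b ≠ center P) {f : RatFunc ℂ}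
    (hf : RegularAt f P) : Tendsto (fun s => ratVal f (toPlane P b s)) farLeft (𝓝 (valueAt f P)) := by
  induction P using OnePoint.rec with
  | infty =>
    refine (tendsto_ratVal_cobounded hf).comp ?_
    have hb' : b ≠ 0 := hb
    rw [← tendsto_norm_atTop_iff_cobounded]
    have h1 : ∀ s : ℂ, ‖toPlane OnePoint.infty b s‖ = ‖b‖ * Real.exp (-s.re) := fun s => by
      have := norm_toPlane_sub_center OnePoint.infty b s
      simpa [center, orient] using this
    simp only [h1]
    refine Tendsto.const_mul_atTop (norm_pos_iff.2 hb') ?_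
    exact Real.tendsto_exp_atTop.comp (tendsto_neg_atBot_atTop.comp tendsto_comap)
  | coe p =>
    have h1 : ContinuousAt (ratVal f) p := (analyticAt_ratVal hf).continuousAt
    refine h1.tendsto.comp ?_
    have h2 := ((tendsto_exp_farLeft).const_mul (b - p)).const_add p
    simp only [mul_zero, add_zero] at h2
    refine h2.congr fun s => ?_
    simp [toPlane, center, orient]

theorem ratVal_mul {f g : RatFunc ℂ} {z : ℂ} (hf : f.denom.eval z ≠ 0) (hg : g.denom.eval z ≠ 0) :
    ratVal (f * g) z = ratVal f z * ratVal g z :=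
  RatFunc.eval_mul _ _ (by simpa [Polynomial.eval₂_id] using hf) (by simpa [Polynomial.eval₂_id] using hg)

theorem scale_eq (P : OnePoint ℂ) :
    scale P = algebraMap (Polynomial ℂ) (RatFunc ℂ) (Polynomial.X - Polynomial.C (center P)) := by
  induction P using OnePoint.rec <;> simp [scale, center]

variable {n : ℕ} {a : Fin n → RatFunc ℂ} {b : ℂ} {P : OnePoint ℂ}

theorem ratVal_scale_pow_mul {z : ℂ} (hz : z ∉ singularSet a) (P : OnePoint ℂ) (k : ℕ) (i : Fin n) :
    ratVal (scale P ^ k * a i) z = (z - center P) ^ k * ratVal (a i) z := by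
  have h1 : scale P ^ k = algebraMap (Polynomial ℂ) (RatFunc ℂ)
      ((Polynomial.X - Polynomial.C (center P)) ^ k) := by rw [scale_eq, map_pow]
  have h2 : (scale P ^ k).denom = 1 := by rw [h1, RatFunc.denom_algebraMap]
  rw [ratVal_mul (by rw [h2]; simp) fun h => hz ⟨i, h⟩]
  congr 1
  rw [ratVal_eq, h2, h1, RatFunc.num_algebraMap]
  simp

/-- The coefficients of the equation in logarithmic form. -/
noncomputable def eulerCoeff (a : Fin n → RatFunc ℂ) (P : OnePoint ℂ) (b : ℂ) (i : Fin n) (s : ℂ) :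
    ℂ :=
  (toPlane P b s - center P) ^ (n - (i : ℕ)) * ratVal (a i) (toPlane P b s)

theorem IsNear.tendsto_eulerCoeff (h : IsNear a b P) (hF : IsFuchsian a) (i : Fin n) :
    Tendsto (eulerCoeff a P b i) farLeft (𝓝 (valueAt (scale P ^ (n - (i : ℕ)) * a i) P)) := by
  refine (tendsto_ratVal_toPlane h.ne_center (hF P i)).congr' ?_
  refine eventually_farLeft.2 ⟨0, fun s hs => ?_⟩
  exact ratVal_scale_pow_mul (h.toPlane_notMem (h.mem_halfPlane hs.le)) P _ i

variable [NeZero n]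

/-- The derivatives of a solution, scaled by powers of `z - center P`; the index `n` is included
with the value that the equation prescribes. -/
noncomputable def IsNear.scaled (h : IsNear a b P) (φ : solutionSpace a b) (k : ℕ) (s : ℂ) : ℂ :=
  if hk : k < n then (toPlane P b s - center P) ^ k * h.extension φ s ⟨k, hk⟩
  else -∑ i : Fin n, eulerCoeff a P b i s *
    ((toPlane P b s - center P) ^ (i : ℕ) * h.extension φ s i)

theorem IsNear.scaled_of_lt (h : IsNear a b P) (φ : solutionSpace a b) {k : ℕ} (hk : k < n) (s : ℂ) :
    h.scaled φ k s = (toPlane P b s - center P) ^ k * h.extension φ s ⟨k, hk⟩ := dif_pos hk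

theorem IsNear.scaled_zero (h : IsNear a b P) (φ : solutionSpace a b) (s : ℂ) :
    h.scaled φ 0 s = h.lift φ s := by
  rw [h.scaled_of_lt φ (NeZero.pos n), pow_zero, one_mul]
  rfl

theorem IsNear.scaled_self (h : IsNear a b P) (φ : solutionSpace a b) (s : ℂ) :
    h.scaled φ n s = -∑ i : Fin n, eulerCoeff a P b i s * h.scaled φ i s := by
  rw [IsNear.scaled, dif_neg (lt_irrefl n)]
  congr 1
  refine Finset.sum_congr rfl fun i _ => ?_
  rw [h.scaled_of_lt φ i.2]

/-- With D = z - center P, the derivative with respect to s is D d/dz up to the sign `orient P`, and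
it sends D^k y^{(k)} to k D^k y^{(k)} + D^{k+1} y^{(k+1)}. In these unknowns the coefficients of the
system stay bounded at P; this is where the Fuchs condition acts. -/
theorem IsNear.hasDerivAt_scaled (h : IsNear a b P) (φ : solutionSpace a b) {k : ℕ} (hk : k < n)
    {s : ℂ} (hs : s ∈ h.halfPlane) : HasDerivAt (h.scaled φ k)
      (orient P * (k * h.scaled φ k s + h.scaled φ (k + 1) s)) s := by
  have h1 : h.scaled φ k = fun s => (toPlane P b s - center P) ^ k * h.extension φ s ⟨k, hk⟩ :=
    funext fun s => h.scaled_of_lt φ hk s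
  have h2 := (((hasDerivAt_toPlane P b s).sub_const (center P)).pow k).mul
    (h.hasDerivAt_extension_apply φ hs ⟨k, hk⟩)
  rw [h1]
  convert! h2 using 1
  set D := toPlane P b s - center P
  have e1 : h.scaled φ (k + 1) s =
      D ^ (k + 1) * companion a (toPlane P b s) (h.extension φ s) ⟨k, hk⟩ := by
    by_cases hk' : k + 1 < n
    · rw [companion_apply_of_lt _ _ _ (k := ⟨k, hk⟩) hk', h.scaled_of_lt φ hk']
    · have hkn : k + 1 = n := by omega
      rw [companion_apply_of_not_lt _ _ _ (k := ⟨k, hk⟩) hk', hkn, h.scaled_self, mul_neg,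
        Finset.mul_sum]
      congr 1
      refine Finset.sum_congr rfl fun i _ => ?_
      rw [h.scaled_of_lt φ i.2, eulerCoeff]
      have : D ^ n = D ^ (n - (i : ℕ)) * D ^ (i : ℕ) := by
        rw [← pow_add, Nat.sub_add_cancel i.2.le]
      rw [this]
      ring
  have e2 : (k : ℂ) * D ^ k = k * D ^ (k - 1) * D := by
    rcases k with _ | k
    · simp
    · rw [Nat.add_sub_cancel, pow_succ]
      ring
  simp only [Pi.pow_apply] at *
  rw [e1]
  linear_combination (orient P * h.extension φ s ⟨k, hk⟩ : ℂ) * e2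

/-- Solutions have moderate growth at every point of the sphere. -/
theorem IsNear.exists_growth (h : IsNear a b P) (hF : IsFuchsian a) (φ : solutionSpace a b) :
    ∃ D K L : ℝ, 0 ≤ K ∧ 0 ≤ L ∧ ∀ s : ℂ, s.re ≤ -L → |s.im| ≤ Real.pi →
      ‖h.lift φ s‖ ≤ D * Real.exp (-K * s.re) := by
  have hev : ∀ᶠ s in farLeft, ∀ i, ‖eulerCoeff a P b i s‖ ≤
      ‖valueAt (scale P ^ (n - (i : ℕ)) * a i) P‖ + 1 := eventually_all.2 fun i =>
    ((h.tendsto_eulerCoeff hF i).norm.eventually (gt_mem_nhds (lt_add_one _))).mono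
      fun s hs => hs.le
  obtain ⟨L₀, hL₀⟩ := eventually_farLeft.1 hev
  set B : ℝ := ∑ i : Fin n, (‖valueAt (scale P ^ (n - (i : ℕ)) * a i) P‖ + 1)
  have hB : 0 ≤ B := Finset.sum_nonneg fun i _ => by positivity
  -- The bounds on the coefficients hold for Re s < L₀, and Re s ≤ -L implies Re s ≤ L₀ - 1.
  -- Nonnegativity of L keeps these points in the half-plane.
  set L : ℝ := max 0 (1 - L₀)
  -- The term k · scaled k contributes at most n, and the next entry at most 1 + B, whether it is
  -- another unknown or the last one given by the equation.
  set K : ℝ := n + 1 + B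
  have hK : 0 ≤ K := by positivity
  have hL : 0 ≤ L := le_max_left _ _
  let W : ℂ → Fin n → ℂ := fun s k => h.scaled φ k s
  let W' : ℂ → Fin n → ℂ := fun s k => orient P * (k * h.scaled φ k s + h.scaled φ (k + 1) s)
  have hW : ∀ s ∈ h.halfPlane, HasDerivAt W (W' s) s := fun s hs =>
    hasDerivAt_pi.2 fun k => h.hasDerivAt_scaled φ k.2 hs
  have hε : ‖(orient P : ℂ)‖ = 1 := by
    induction P using OnePoint.rec <;> simp [orient]
  have hbound : ∀ s : ℂ, s.re ≤ -L → ‖W' s‖ ≤ K * ‖W s‖ := by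
    intro s hs
    have hsL : s.re < L₀ := by
      have : 1 - L₀ ≤ L := le_max_right _ _
      linarith
    refine (pi_norm_le_iff_of_nonneg (by positivity)).2 fun k => ?_
    have hle : ∀ i : Fin n, ‖h.scaled φ i s‖ ≤ ‖W s‖ := fun i => norm_le_pi_norm (W s) i
    have hlast : ‖h.scaled φ n s‖ ≤ B * ‖W s‖ := by
      rw [h.scaled_self, norm_neg, Finset.sum_mul]
      refine norm_sum_le_of_le _ fun i _ => ?_
      rw [norm_mul]
      exact mul_le_mul (hL₀ s hsL i) (hle i) (norm_nonneg _) (by positivity)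
    have hnext : ‖h.scaled φ (k + 1) s‖ ≤ (1 + B) * ‖W s‖ := by
      by_cases hk : (k : ℕ) + 1 < n
      · have := hle ⟨k + 1, hk⟩
        simp only at this
        nlinarith [norm_nonneg (W s)]
      · have : (k : ℕ) + 1 = n := by omega
        rw [this]
        nlinarith [norm_nonneg (W s)]
    have hkn : (k : ℝ) ≤ n := by exact_mod_cast k.2.le
    calc ‖W' s k‖ = ‖(k : ℂ) * h.scaled φ k s + h.scaled φ (k + 1) s‖ := by
          simp only [W', norm_mul, hε, one_mul]
      _ ≤ k * ‖W s‖ + (1 + B) * ‖W s‖ := by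
          refine (norm_add_le _ _).trans (add_le_add ?_ hnext)
          rw [norm_mul, Complex.norm_natCast]
          exact mul_le_mul_of_nonneg_left (hle k) (Nat.cast_nonneg _)
      _ ≤ K * ‖W s‖ := by
          simp only [K]
          nlinarith [norm_nonneg (W s)]
  -- Grönwall's inequality is applied leftwards along horizontal lines. Its initial values lie on a
  -- compact vertical segment of half-height π, which gives one constant for the whole strip.
  have hseg : ContinuousOn (fun y : ℝ => W (((-L : ℝ) : ℂ) + y * Complex.I))
      (Set.Icc (-Real.pi) Real.pi) := by
    intro y _
    have hmem : ((-L : ℝ) : ℂ) + y * Complex.I ∈ h.halfPlane := h.mem_halfPlane (by simp [hL])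
    exact (ContinuousAt.comp (f := fun y : ℝ => ((-L : ℝ) : ℂ) + y * Complex.I)
      (hW _ hmem).continuousAt (by fun_prop)).continuousWithinAt
  obtain ⟨D, hD⟩ := isCompact_Icc.exists_bound_of_continuousOn hseg
  refine ⟨D, K, L, hK, hL, fun s hs him => ?_⟩
  have hy := hD s.im (abs_le.1 him)
  set s₀ : ℂ := ((-L : ℝ) : ℂ) + s.im * Complex.I
  have hre : ∀ τ : ℝ, (s₀ + τ * (-1)).re = -L - τ := fun τ => by
    simp [s₀, sub_eq_add_neg]
  have hder : ∀ τ : ℝ, 0 ≤ τ → HasDerivAt (fun τ : ℝ => W (s₀ + τ * (-1)))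
      ((-1 : ℂ) • W' (s₀ + τ * (-1))) τ := fun τ hτ =>
    hasDerivAt_comp_line (hW _ (h.mem_halfPlane (by rw [hre]; linarith)))
  have hgron := norm_le_gronwallBound_of_norm_deriv_right_le (δ := D) (K := K) (ε := 0)
    (f := fun τ : ℝ => W (s₀ + τ * (-1))) (a := 0) (b := -L - s.re)
    (fun τ hτ => (hder τ hτ.1).continuousAt.continuousWithinAt)
    (fun τ hτ => (hder τ hτ.1).hasDerivWithinAt) (by simpa using hy)
    (fun τ hτ => by
      rw [norm_smul, norm_neg, norm_one, one_mul, add_zero]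
      exact hbound _ (by rw [hre]; linarith [hτ.1])) (-L - s.re)
    ⟨by linarith, le_rfl⟩
  have hend : s₀ + ((-L - s.re : ℝ) : ℂ) * (-1) = s := by
    apply Complex.ext <;> simp [s₀]
  rw [hend, gronwallBound_ε0, sub_zero] at hgron
  have hD0 : 0 ≤ D := (norm_nonneg _).trans hy
  calc ‖h.lift φ s‖ = ‖W s 0‖ := by
        simp only [W]
        rw [← h.scaled_zero]
        rfl
    _ ≤ ‖W s‖ := norm_le_pi_norm _ _
    _ ≤ D * Real.exp (K * (-L - s.re)) := hgron
    _ ≤ D * Real.exp (-K * s.re) := by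
        refine mul_le_mul_of_nonneg_left (Real.exp_le_exp.2 ?_) hD0
        nlinarith

end Growth

/-! ### Exponents of eigenvectors of the local monodromy -/

section Exponents

open Complex (I)

variable {n : ℕ} [NeZero n] {a : Fin n → RatFunc ℂ} {b : ℂ} {P : OnePoint ℂ}

/-- The solution is `e^{μ s} H(e^s)` with `H` holomorphic at `0` and `H 0 ≠ 0`. -/
def IsNear.HasExponent (h : IsNear a b P) (φ : solutionSpace a b) (μ : ℂ) : Prop :=
  ∃ H : ℂ → ℂ, AnalyticAt ℂ H 0 ∧ H 0 ≠ 0 ∧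
    ∀ᶠ s in farLeft, h.lift φ s = Complex.exp (μ * s) * H (Complex.exp s)

theorem eq_zero_of_lift_eventually {h : IsNear a b P} {φ : solutionSpace a b}
    (h0 : ∀ᶠ s in farLeft, h.lift φ s = 0) : φ = 0 := by
  obtain ⟨s, hs, hs'⟩ :=
    ((eventually_eventually_farLeft h0).and (eventually_farLeft.2 ⟨0, fun s hs => hs⟩)).exists
  have hmem : s ∈ h.halfPlane := h.mem_halfPlane (le_of_lt hs')
  have h1 := (h.analyticOnNhd_lift φ).eqOn_of_preconnected_of_eventuallyEq
    (analyticOnNhd_const (v := 0)) h.convex_halfPlane.isPreconnected hmem hs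
  refine ext_of_rep ?_
  have h2 : rep (0 : solutionSpace a b) =ᶠ[𝓝 b] 0 := rep_eventuallyEq rfl
  refine EventuallyEq.trans ?_ h2.symm
  filter_upwards [h.rep_eventuallyEq_lift φ, (tendsto_log_localParam h.ne_center).eventually
    (h.isOpen_halfPlane.mem_nhds h.zero_mem)] with z h3 h4
  rw [h3, h1 h4]
  rfl

theorem IsNear.HasExponent.tendsto {h : IsNear a b P} {φ : solutionSpace a b} {μ : ℂ}
    (hφ : h.HasExponent φ μ) : ∃ c : ℂ, c ≠ 0 ∧
      Tendsto (fun s => Complex.exp (-(μ * s)) * h.lift φ s) farLeft (𝓝 c) := by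
  obtain ⟨H, hH, hH0, hev⟩ := hφ
  refine ⟨H 0, hH0, (hH.continuousAt.tendsto.comp tendsto_exp_farLeft).congr' ?_⟩
  filter_upwards [hev] with s hs
  rw [hs, ← mul_assoc, ← Complex.exp_add, neg_add_cancel, Complex.exp_zero, one_mul]
  rfl

theorem IsNear.HasExponent.hasVanishingOrder {h : IsNear a b P} {φ : solutionSpace a b} {μ : ℂ}
    (hφ : h.HasExponent φ μ) : HasVanishingOrder P (φ : Germ (𝓝 b) ℂ) μ := by
  obtain ⟨c, hc, ht⟩ := hφ.tendsto
  refine ⟨h.lift φ, (h.analyticOnNhd_lift φ).mono fun s hs => h.mem_halfPlane hs, ?_, c, hc,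
    ht.comp tendsto_ofReal_farLeft⟩
  rw [coe_rep]
  exact Germ.coe_eq.2 (h.rep_eventuallyEq_lift φ)

/-- Translating x by τ multiplies the function by e^{δτ} and leaves the limit c ≠ 0 unchanged. So
e^{δτ} = 1 for all real τ, and differentiating at 0 gives δ = 0. -/
theorem eq_of_tendsto_exp_mul {δ c : ℂ} (hc : c ≠ 0)
    (h : Tendsto (fun x : ℝ => Complex.exp (δ * x)) atBot (𝓝 c)) : δ = 0 := by
  have key : ∀ τ : ℝ, Complex.exp (δ * τ) = 1 := fun τ => by
    have h1 : Tendsto (fun x : ℝ => Complex.exp (δ * (x + τ : ℝ))) atBot (𝓝 c) :=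
      h.comp (tendsto_atBot_add_const_right _ τ tendsto_id)
    have h2 := h.mul_const (Complex.exp (δ * τ))
    have h3 : (fun x : ℝ => Complex.exp (δ * (x + τ : ℝ))) =
        fun x : ℝ => Complex.exp (δ * x) * Complex.exp (δ * τ) := by
      ext x
      rw [← Complex.exp_add]
      congr 1
      push_cast
      ring
    rw [h3] at h1
    have := tendsto_nhds_unique h1 h2
    exact (mul_right_eq_self₀.1 this.symm).resolve_right hc
  have h1 : HasDerivAt (fun τ : ℝ => Complex.exp (δ * τ)) δ 0 := by
    have := ((Complex.ofRealCLM.hasDerivAt (x := 0)).const_mul δ).cexp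
    simpa using this
  have h2 : (fun τ : ℝ => Complex.exp (δ * τ)) = fun _ => 1 := funext key
  rw [h2] at h1
  exact h1.unique (hasDerivAt_const _ _)

theorem IsNear.HasExponent.eq_of_hasVanishingOrder {h : IsNear a b P} {φ : solutionSpace a b}
    {μ ν : ℂ} (hφ : h.HasExponent φ μ) (hν : HasVanishingOrder P (φ : Germ (𝓝 b) ℂ) ν) : μ = ν := by
  obtain ⟨c, hc, ht⟩ := hφ.tendsto
  obtain ⟨u, hu, hφu, d, hd, hud⟩ := hν
  have hul := h.eq_lift hu hφu
  have h1 : Tendsto (fun x : ℝ => Complex.exp (-(ν * x)) * h.lift φ x) atBot (𝓝 d) := by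
    refine hud.congr' ?_
    filter_upwards [Iic_mem_atBot (0 : ℝ)] with x hx
    rw [hul x (by simpa using hx)]
  have h2 := (ht.comp tendsto_ofReal_farLeft).div h1 hd
  have hne := (ht.comp tendsto_ofReal_farLeft).eventually_ne hc
  have h3 : Tendsto (fun x : ℝ => Complex.exp ((ν - μ) * x)) atBot (𝓝 (c / d)) := by
    refine h2.congr' ?_
    filter_upwards [hne] with x hx
    simp only [Function.comp_apply, ne_eq, mul_eq_zero, not_or] at hx
    simp only [Pi.div_apply, Function.comp_apply]
    rw [mul_div_mul_right _ _ hx.2, ← Complex.exp_sub]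
    congr 1
    ring
  exact (sub_eq_zero.1 (eq_of_tendsto_exp_mul (div_ne_zero hc hd) h3)).symm

/-- The exponent of a solution is a root of the indicial polynomial. -/
theorem IsNear.HasExponent.isRoot {h : IsNear a b P} (hF : IsFuchsian a) {φ : solutionSpace a b}
    {μ : ℂ} (hφ : h.HasExponent φ μ) : (indicialPolynomial a P).eval μ = 0 := by
  obtain ⟨H, hH, hH0, hev⟩ := hφ
  set ε : ℂ := ((orient P : ℝ) : ℂ)
  have hεε : ε * ε = 1 := by
    simp only [ε]
    exact_mod_cast orient_mul_self P
  -- The scaled k-th derivative is again e^{μs} times a holomorphic function of e^s, with leading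
  -- coefficient [εμ]_k H(0). The sign ε accounts for the parameter 1/z at ∞.
  have key : ∀ k ≤ n, ∃ G : ℂ → ℂ, AnalyticAt ℂ G 0 ∧
      G 0 = (descPochhammer ℂ k).eval (ε * μ) * H 0 ∧
      ∀ᶠ s in farLeft, h.scaled φ k s = Complex.exp (μ * s) * G (Complex.exp s) := by
    intro k
    induction k with
    | zero =>
      intro _
      refine ⟨H, hH, by simp, ?_⟩
      filter_upwards [hev] with s hs
      rw [h.scaled_zero, hs]
    | succ k ih =>
      intro hk
      obtain ⟨G, hG, hG0, hGev⟩ := ih (by omega)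
      -- This is the recurrence of `hasDerivAt_scaled` solved for the next term: on e^{μs} G(e^s),
      -- d/ds acts on G as μ + t d/dt.
      refine ⟨fun t => ε * (μ * G t + t * deriv G t) - k * G t, ?_, ?_, ?_⟩
      · exact (analyticAt_const.mul ((analyticAt_const.mul hG).add (analyticAt_id.mul hG.deriv))).sub
          (analyticAt_const.mul hG)
      · beta_reduce
        rw [hG0, descPochhammer_succ_right]
        simp
        ring
      · have hdiff : ∀ᶠ s in farLeft, DifferentiableAt ℂ G (Complex.exp s) :=
          tendsto_exp_farLeft.eventually
            (hG.eventually_analyticAt.mono fun x hx => hx.differentiableAt)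
        filter_upwards [eventually_eventually_farLeft hGev, hdiff,
          eventually_farLeft.2 ⟨0, fun s hs => h.mem_halfPlane (le_of_lt hs)⟩] with s h1 h2 h3
        have h4 := h.hasDerivAt_scaled φ (k := k) (by omega) h3
        have h5 : HasDerivAt (fun s => Complex.exp (μ * s) * G (Complex.exp s))
            (Complex.exp (μ * s) * μ * G (Complex.exp s) +
              Complex.exp (μ * s) * (deriv G (Complex.exp s) * Complex.exp s)) s := by
          have h6 := ((hasDerivAt_id s).const_mul μ).cexp
          have h7 := HasDerivAt.comp s h2.hasDerivAt (Complex.hasDerivAt_exp s)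
          convert! h6.mul h7 using 1
          simp
        have h8 := (h4.congr_of_eventuallyEq (h1.mono fun x hx => hx.symm)).unique h5
        have h9 := h1.self_of_nhds
        rw [h9] at h8
        linear_combination ε * h8 - (h.scaled φ (k + 1) s +
          k * (Complex.exp (μ * s) * G (Complex.exp s))) * hεε
  choose! G hG hG0 hGev using key
  have hall : ∀ᶠ s in farLeft, ∀ i : Fin n,
      h.scaled φ i s = Complex.exp (μ * s) * G i (Complex.exp s) :=
    eventually_all.2 fun i => hGev i i.2.le
  have hlim : ∀ k ≤ n, Tendsto (fun s => G k (Complex.exp s)) farLeft (𝓝 (G k 0)) := fun k hk =>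
    (hG k hk).continuousAt.tendsto.comp tendsto_exp_farLeft
  -- Dividing the differential equation by e^{μs} and passing to the limit at P leaves the indicial
  -- polynomial at μ times H(0).
  have h1 : Tendsto (fun s => -∑ i : Fin n, eulerCoeff a P b i s * G i (Complex.exp s)) farLeft
      (𝓝 (-∑ i : Fin n, valueAt (scale P ^ (n - (i : ℕ)) * a i) P * G i 0)) :=
    (tendsto_finsetSum _ fun i _ => (h.tendsto_eulerCoeff hF i).mul (hlim i i.2.le)).neg
  have h2 : Tendsto (fun s => -∑ i : Fin n, eulerCoeff a P b i s * G i (Complex.exp s)) farLeft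
      (𝓝 (G n 0)) := by
    refine (hlim n le_rfl).congr' ?_
    filter_upwards [hall, hGev n le_rfl] with s h3 h4
    have h5 := h.scaled_self φ s
    rw [h4] at h5
    refine mul_left_cancel₀ (Complex.exp_ne_zero (μ * s)) (h5.trans ?_)
    rw [mul_neg, Finset.mul_sum]
    congr 1
    refine Finset.sum_congr rfl fun i _ => ?_
    rw [h3 i]
    ring
  have h3 := tendsto_nhds_unique h2 h1
  have h4 : ((descPochhammer ℂ n + ∑ i : Fin n,
      Polynomial.C (valueAt (scale P ^ (n - (i : ℕ)) * a i) P) * descPochhammer ℂ i).eval (ε * μ)) =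
      0 := by
    refine (mul_eq_zero.1 ?_).resolve_right hH0
    rw [Polynomial.eval_add, Polynomial.eval_finsetSum, add_mul, ← hG0 n le_rfl, h3, Finset.sum_mul,
      neg_add_eq_zero]
    refine Finset.sum_congr rfl fun i _ => ?_
    rw [hG0 i i.2.le, Polynomial.eval_mul, Polynomial.eval_C, mul_assoc]
  rw [← h4]
  induction P using OnePoint.rec with
  | infty =>
    simp only [indicialPolynomial, ε, orient, Polynomial.eval_comp]
    simp
  | coe p =>
    simp only [indicialPolynomial, ε, orient]
    simp

theorem IsNear.HasExponent.eigenvalue {h : IsNear a b P} {φ ψ : solutionSpace a b} {μ χ : ℂ}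
    (hφ : h.HasExponent φ μ) (hψ : ψ = χ • φ)
    (hM : ∀ s ∈ h.halfPlane, h.extension ψ s = h.extension φ (s + 2 * Real.pi * I)) :
    χ = Complex.exp (2 * Real.pi * I * μ) := by
  obtain ⟨c, hc, ht⟩ := hφ.tendsto
  obtain ⟨H, hH, hH0, hev⟩ := hφ
  have hev' : ∀ᶠ s in farLeft, h.lift φ (s + 2 * Real.pi * I) =
      Complex.exp (μ * (s + 2 * Real.pi * I)) * H (Complex.exp (s + 2 * Real.pi * I)) := by
    obtain ⟨L, hL⟩ := eventually_farLeft.1 hev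
    exact eventually_farLeft.2 ⟨L, fun s hs => hL _ (by rwa [re_add_period])⟩
  obtain ⟨s, h1, h2, h3, h4⟩ := (hev.and (hev'.and ((ht.eventually_ne hc).and
    (eventually_farLeft.2 ⟨0, fun s hs => h.mem_halfPlane (le_of_lt hs)⟩)))).exists
  have h5 : h.lift φ (s + 2 * Real.pi * I) = χ * h.lift φ s := by
    have h6 := congrFun (hM s h4) 0
    rw [hψ, h.extension_smul χ φ h4] at h6
    exact h6.symm
  have h6 : h.lift φ s ≠ 0 := right_ne_zero_of_mul h3
  refine mul_right_cancel₀ h6 ?_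
  rw [← h5, h2, h1, Complex.exp_add s, Complex.exp_two_pi_mul_I, mul_one, mul_add, Complex.exp_add]
  ring_nf

/-- An eigenvector of the local monodromy has an exponent. -/
theorem IsNear.exists_hasExponent (h : IsNear a b P) (hF : IsFuchsian a)
    {φ ψ : solutionSpace a b} {χ : ℂ} (hφ : φ ≠ 0) (hχ : χ ≠ 0) (hψ : ψ = χ • φ)
    (hM : ∀ s ∈ h.halfPlane, h.extension ψ s = h.extension φ (s + 2 * Real.pi * I)) :
    ∃ μ, h.HasExponent φ μ := by
  classical
  have hper : ∀ s ∈ h.halfPlane, h.lift φ (s + 2 * Real.pi * I) = χ * h.lift φ s := fun s hs => by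
    have h6 := congrFun (hM s hs) 0
    rw [hψ, h.extension_smul χ φ hs] at h6
    exact h6.symm
  have h2pi : (2 * Real.pi * I : ℂ) ≠ 0 := Complex.two_pi_I_ne_zero
  -- Multiplying the solution by e^{-αs} makes it 2πi-periodic. The further factor e^{ms} preserves
  -- periodicity and, for m ≥ K + |Re α|, outweighs the growth, so the product is bounded to the
  -- left.
  obtain ⟨α, hα⟩ : ∃ α : ℂ, Complex.exp (2 * Real.pi * I * α) = χ :=
    ⟨Complex.log χ / (2 * Real.pi * I), by rw [mul_div_cancel₀ _ h2pi, Complex.exp_log hχ]⟩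
  obtain ⟨D, K, L, hK, hL, hgrow⟩ := h.exists_growth hF φ
  obtain ⟨m, hm⟩ := exists_nat_ge (K + |α.re|)
  -- Extension by zero outside the half-plane makes periodicity hold on all of ℂ, as the theory of
  -- cusp functions requires.
  let u : ℂ → ℂ := fun s =>
    if s ∈ h.halfPlane then Complex.exp ((m - α) * s) * h.lift φ s else 0
  have hu_per : ∀ s, u (s + 2 * Real.pi * I) = u s := by
    intro s
    by_cases hs : s ∈ h.halfPlane
    · simp only [u, if_pos hs, if_pos (h.add_period_mem hs), hper s hs]
      rw [mul_add, Complex.exp_add, sub_mul (m : ℂ) α (2 * Real.pi * I), Complex.exp_sub,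
        mul_comm α, hα, Complex.exp_nat_mul_two_pi_mul_I]
      field_simp
    · have hs' : s + 2 * Real.pi * I ∉ h.halfPlane := fun h' => hs (by
        change (s + 2 * Real.pi * I).re < _ at h'
        rwa [re_add_period] at h')
      simp only [u, if_neg hs, if_neg hs']
  -- The substitution s = 2πi w turns the period into 1, the left into the upper end of the plane,
  -- and e^s into the cusp parameter e^{2πiw}.
  let f : ℂ → ℂ := fun w => u (2 * Real.pi * I * w)
  have hf_per : Function.Periodic f ((1 : ℝ) : ℂ) := fun w => by
    simp only [f]
    rw [Complex.ofReal_one, mul_add, mul_one, hu_per]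
  have hre : ∀ w : ℂ, (2 * Real.pi * I * w).re = -(2 * Real.pi * w.im) := fun w => by
    simp [Complex.mul_re, Complex.mul_im]
  have him : ∀ w : ℂ, (2 * Real.pi * I * w).im = 2 * Real.pi * w.re := fun w => by
    simp [Complex.mul_re, Complex.mul_im]
  have hI : ∀ {p : ℂ → Prop} (y : ℝ), (∀ w : ℂ, y < w.im → p w) →
      ∀ᶠ w in comap Complex.im atTop, p w := fun {p} y hp => by
    rw [eventually_comap]
    filter_upwards [Ioi_mem_atTop y] with x hx w hw
    exact hp w (hw ▸ hx)
  have hf_diff : ∀ᶠ w in comap Complex.im atTop, DifferentiableAt ℂ f w := by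
    refine hI 0 fun w hw => ?_
    have hmem : 2 * Real.pi * I * w ∈ h.halfPlane := h.mem_halfPlane (by
      rw [hre]
      nlinarith [Real.pi_pos])
    have hu : DifferentiableAt ℂ u (2 * Real.pi * I * w) := by
      have h1 : DifferentiableAt ℂ (fun s => Complex.exp ((m - α) * s) * h.lift φ s)
          (2 * Real.pi * I * w) :=
        DifferentiableAt.mul (by fun_prop) (h.analyticOnNhd_lift φ _ hmem).differentiableAt
      refine h1.congr_of_eventuallyEq ?_
      filter_upwards [h.isOpen_halfPlane.mem_nhds hmem] with x hx
      exact if_pos hx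
    exact DifferentiableAt.comp w hu (by fun_prop)
  have hf_bdd : BoundedAtFilter (comap Complex.im atTop) f := by
    rw [BoundedAtFilter, Asymptotics.isBigO_iff]
    refine ⟨|D| * Real.exp (|α.im| * Real.pi), hI (L + 1) fun w hw => ?_⟩
    -- Periodicity moves Re w into [-1/2, 1/2], that is |Im s| ≤ π, where the growth estimate is
    -- available.
    set w' : ℂ := w - round w.re
    have hfw : f w = f w' := by
      have := hf_per.sub_int_mul_eq (x := w) (round w.re)
      simpa [w'] using this.symm
    set s : ℂ := 2 * Real.pi * I * w'
    have hsre : s.re ≤ -L := by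
      simp only [s, hre, w', Complex.sub_im, Complex.intCast_im, sub_zero]
      nlinarith [Real.pi_gt_three]
    have hsim : |s.im| ≤ Real.pi := by
      simp only [s, him, w', Complex.sub_re, Complex.intCast_re]
      have := abs_sub_round w.re
      rw [abs_mul, abs_of_pos Real.two_pi_pos]
      nlinarith [Real.pi_pos]
    have hsneg : s.re ≤ 0 := by linarith
    have hfs : f w = Complex.exp ((m - α) * s) * h.lift φ s := by
      rw [hfw]
      exact if_pos (h.mem_halfPlane hsneg)
    rw [hfs, norm_mul, Complex.norm_exp]
    have hexp : ((m - α) * s).re = (m - α.re) * s.re + α.im * s.im := by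
      simp [Complex.mul_re]
    rw [hexp]
    have h1 : (m - α.re) * s.re + α.im * s.im ≤ |α.im| * Real.pi + K * s.re := by
      have h2 : α.im * s.im ≤ |α.im| * Real.pi := by
        refine (le_abs_self _).trans ?_
        rw [abs_mul]
        exact mul_le_mul_of_nonneg_left hsim (abs_nonneg _)
      have h3 : α.re ≤ |α.re| := le_abs_self _
      nlinarith
    calc Real.exp ((m - α.re) * s.re + α.im * s.im) * ‖h.lift φ s‖
        ≤ Real.exp (|α.im| * Real.pi + K * s.re) * (|D| * Real.exp (-K * s.re)) := by
          refine mul_le_mul (Real.exp_le_exp.2 h1) ((hgrow s hsre hsim).trans ?_) (norm_nonneg _)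
            (Real.exp_pos _).le
          exact mul_le_mul_of_nonneg_right (le_abs_self D) (Real.exp_pos _).le
      _ = |D| * Real.exp (|α.im| * Real.pi) * ‖(1 : ℂ → ℝ) w‖ := by
          rw [Real.exp_add, neg_mul, Real.exp_neg]
          simp
          field_simp
  set H₀ : ℂ → ℂ := Function.Periodic.cuspFunction 1 f
  have hH₀d := Function.Periodic.differentiableAt_cuspFunction_zero one_pos hf_per hf_diff hf_bdd
  have hH₀n := Function.Periodic.eventually_differentiableAt_cuspFunction_nhds_ne_zero one_pos
    hf_per hf_diff
  have hH₀ : AnalyticAt ℂ H₀ 0 := by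
    rw [Complex.analyticAt_iff_eventually_differentiableAt]
    filter_upwards [eventually_nhdsWithin_iff.1 hH₀n] with t ht
    rcases eq_or_ne t 0 with rfl | h0
    · exact hH₀d
    · exact ht h0
  have hH₀eq : ∀ s ∈ h.halfPlane, H₀ (Complex.exp s) = Complex.exp ((m - α) * s) * h.lift φ s := by
    intro s hs
    have h1 := Function.Periodic.eq_cuspFunction (h := 1) one_ne_zero hf_per (s / (2 * Real.pi * I))
    have h2 : Function.Periodic.qParam 1 (s / (2 * Real.pi * I)) = Complex.exp s := by
      rw [Function.Periodic.qParam]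
      congr 1
      rw [Complex.ofReal_one]
      field_simp
    rw [h2] at h1
    simp only [H₀, h1, f]
    rw [mul_div_cancel₀ _ h2pi]
    exact if_pos hs
  have hlift : ∀ s ∈ h.halfPlane, h.lift φ s = Complex.exp ((α - m) * s) * H₀ (Complex.exp s) := by
    intro s hs
    rw [hH₀eq s hs, ← mul_assoc, ← Complex.exp_add]
    have : (α - m) * s + (m - α) * s = 0 := by ring
    rw [this, Complex.exp_zero, one_mul]
  have hmemL : ∀ᶠ s in farLeft, s ∈ h.halfPlane :=
    eventually_farLeft.2 ⟨0, fun s hs => h.mem_halfPlane (le_of_lt hs)⟩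
  -- The bounded cusp function extends holomorphically to 0 and is not identically zero. Splitting
  -- off its zero of order k raises the exponent α - m by k.
  have hne : ¬ ∀ᶠ t in 𝓝 0, H₀ t = 0 := by
    intro h0
    apply hφ
    apply eq_zero_of_lift_eventually (h := h)
    filter_upwards [hmemL, tendsto_exp_farLeft.eventually h0] with s h1 h2
    rw [hlift s h1, h2, mul_zero]
  obtain ⟨k, H, hH, hH0, hev⟩ := hH₀.exists_eventuallyEq_pow_smul_nonzero_iff.2 hne
  refine ⟨α - m + k, H, hH, hH0, ?_⟩
  filter_upwards [hmemL, tendsto_exp_farLeft.eventually hev] with s h1 h2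
  rw [hlift s h1, h2, sub_zero, smul_eq_mul, ← Complex.exp_nat_mul, ← mul_assoc, ← Complex.exp_add]
  congr 2
  ring

end Exponents

/-! ### Rationality of monodromy-invariant expressions -/

section Rational

/-- An entire function of polynomial growth is a polynomial. -/
theorem exists_polynomial_of_growth (N : ℕ) : ∀ {f : ℂ → ℂ}, Differentiable ℂ f →
    ∀ R A : ℝ, (∀ z : ℂ, R ≤ ‖z‖ → ‖f z‖ ≤ A * ‖z‖ ^ N) → ∃ p : Polynomial ℂ, ∀ z, f z = p.eval z := by
  induction N with
  | zero =>
    intro f hf R A hb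
    obtain ⟨C, hC⟩ := (isCompact_closedBall (0 : ℂ) R).exists_bound_of_continuousOn
      hf.continuous.continuousOn
    have hbdd : Bornology.IsBounded (Set.range f) := by
      rw [isBounded_iff_forall_norm_le]
      refine ⟨max A C, ?_⟩
      rintro _ ⟨z, rfl⟩
      rcases le_total R ‖z‖ with h | h
      · exact (by simpa using hb z h : ‖f z‖ ≤ A).trans (le_max_left _ _)
      · exact (hC z (by simpa using h)).trans (le_max_right _ _)
    obtain ⟨c, hc⟩ := hf.exists_const_forall_eq_of_bounded hbdd
    exact ⟨Polynomial.C c, fun z => by rw [hc, Polynomial.eval_C]⟩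
  | succ N ih =>
    intro f hf R A hb
    -- The difference quotient (f(z) - f(0))/z is entire and grows with exponent one less.
    have hd : Differentiable ℂ (dslope f 0) := by
      rw [← differentiableOn_univ, Complex.differentiableOn_dslope univ_mem]
      exact hf.differentiableOn
    obtain ⟨p, hp⟩ := ih hd (max R 1) (A + ‖f 0‖) (fun z hz => by
      have hR : R ≤ ‖z‖ := (le_max_left _ _).trans hz
      have h1 : 1 ≤ ‖z‖ := (le_max_right _ _).trans hz
      have hz0 : z ≠ 0 := norm_pos_iff.1 (by linarith)
      rw [dslope_of_ne _ hz0, slope_def_field, sub_zero, norm_div, div_le_iff₀ (by linarith)]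
      have h2 : 1 ≤ ‖z‖ ^ (N + 1) := one_le_pow₀ h1
      calc ‖f z - f 0‖ ≤ ‖f z‖ + ‖f 0‖ := norm_sub_le _ _
        _ ≤ A * ‖z‖ ^ (N + 1) + ‖f 0‖ * ‖z‖ ^ (N + 1) := by
          have := hb z hR
          nlinarith [norm_nonneg (f 0)]
        _ = (A + ‖f 0‖) * ‖z‖ ^ N * ‖z‖ := by ring)
    refine ⟨Polynomial.C (f 0) + Polynomial.X * p, fun z => ?_⟩
    have := sub_smul_dslope f 0 z
    rw [hp, smul_eq_mul, sub_zero] at this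
    rw [Polynomial.eval_add, Polynomial.eval_C, Polynomial.eval_mul, Polynomial.eval_X, this]
    ring

theorem ratVal_algebraMap (p : Polynomial ℂ) (z : ℂ) :
    ratVal (algebraMap (Polynomial ℂ) (RatFunc ℂ) p) z = p.eval z := by
  rw [ratVal_eq, RatFunc.num_algebraMap, RatFunc.denom_algebraMap, Polynomial.eval_one, div_one]

theorem ratVal_div {p q : Polynomial ℂ} {z : ℂ} (hq : q.eval z ≠ 0) :
    ratVal (algebraMap (Polynomial ℂ) (RatFunc ℂ) p / algebraMap (Polynomial ℂ) (RatFunc ℂ) q) z =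
      p.eval z / q.eval z := by
  have hq0 : q ≠ 0 := fun h => hq (by simp [h])
  set f := algebraMap (Polynomial ℂ) (RatFunc ℂ) p / algebraMap (Polynomial ℂ) (RatFunc ℂ) q
  have hfd : f.denom.eval z ≠ 0 := by
    obtain ⟨r, hr⟩ := RatFunc.denom_div_dvd p q
    intro h0
    apply hq
    rw [hr, Polynomial.eval_mul, h0, zero_mul]
  have h1 : f * algebraMap (Polynomial ℂ) (RatFunc ℂ) q = algebraMap (Polynomial ℂ) (RatFunc ℂ) p :=
    div_mul_cancel₀ _ (RatFunc.algebraMap_ne_zero hq0)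
  have h2 := ratVal_mul (f := f) (g := algebraMap (Polynomial ℂ) (RatFunc ℂ) q) (z := z) hfd
    (by rw [RatFunc.denom_algebraMap]; simp)
  rw [h1, ratVal_algebraMap, ratVal_algebraMap] at h2
  rw [h2, mul_div_cancel_right₀ _ hq]

variable {n : ℕ} {a : Fin n → RatFunc ℂ}

theorem exists_isNear (a : Fin n → RatFunc ℂ) (P : OnePoint ℂ) : ∃ b, IsNear a b P := by
  induction P using OnePoint.rec with
  | infty =>
    obtain ⟨C, hC⟩ := ((finite_singularSet a).image norm).bddAbove
    refine ⟨((|C| + 1 : ℝ) : ℂ), ?_, fun s hs => ?_⟩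
    · exact_mod_cast (by positivity : (|C| + 1 : ℝ) ≠ 0)
    · have h1 := hC ⟨s, hs, rfl⟩
      rw [Complex.norm_real, Real.norm_of_nonneg (by positivity)]
      linarith [le_abs_self C]
  | coe p =>
    have h1 : ∀ s ∈ singularSet a, ∀ᶠ z in 𝓝[≠] p, s ≠ p → ‖z - p‖ < ‖s - p‖ := by
      intro s _
      by_cases hsp : s = p
      · exact Eventually.of_forall fun z h => absurd hsp h
      · refine mem_nhdsWithin_of_mem_nhds ?_
        have : ContinuousAt (fun z : ℂ => ‖z - p‖) p := by fun_prop
        filter_upwards [this.eventually (gt_mem_nhds (a := ‖s - p‖)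
          (by simpa [sub_eq_zero] using hsp))] with z hz _ using hz
    obtain ⟨z, h2, h3⟩ := (((finite_singularSet a).eventually_all.2 h1).and
      self_mem_nhdsWithin).exists
    exact ⟨z, h3, h2⟩

theorem localParam_ne_zero {P : OnePoint ℂ} {z : ℂ} (hz : z ≠ center P) : localParam P z ≠ 0 := by
  induction P using OnePoint.rec with
  | infty => exact inv_ne_zero hz
  | coe p => exact sub_ne_zero.2 hz

variable [NeZero n] {ι : Type*} [Fintype ι]

/-- An auxiliary base point b near P is used. Over the covering half-plane Φ is Q of the lifted
local branches, by the identity theorem. Every z near P is the image of its principal logarithm,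
which lies in the strip |Im s| ≤ π where the lifts have moderate growth, and Q grows polynomially.
-/
theorem singleValued_growth (hF : IsFuchsian a) {Q : (ι → ℂ) → ℂ} (hQ : Differentiable ℂ Q)
    {C : ℝ} {d : ℕ} (hC : ∀ x, ‖Q x‖ ≤ C * (1 + ‖x‖) ^ d) {Φ : ℂ → ℂ}
    (hΦ : ∀ z₀ ∉ singularSet a, ∃ F : ι → ℂ → ℂ, (∀ i, IsSolutionAt a z₀ (F i)) ∧
        Φ =ᶠ[𝓝 z₀] fun z => Q fun i => F i z) (P : OnePoint ℂ) :
    ∃ (A r : ℝ) (N : ℕ), 0 < r ∧ ∀ z, z ≠ center P → ‖localParam P z‖ ≤ r →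
      ‖Φ z‖ * ‖localParam P z‖ ^ N ≤ A := by
  obtain ⟨b, hb⟩ := exists_isNear a P
  obtain ⟨F, hFs, hFΦ⟩ := hΦ b hb.notMem
  let φ : ι → solutionSpace a b := fun i => ofSolution (F i) (hFs i)
  have hφF : ∀ᶠ z in 𝓝 b, ∀ i, rep (φ i) z = F i z :=
    eventually_all.2 fun i => rep_eventuallyEq rfl
  have hΦan : ∀ z ∉ singularSet a, AnalyticAt ℂ Φ z := fun z hz => by
    obtain ⟨G, hG, hGΦ⟩ := hΦ z hz
    exact (analyticAt_comp_tuple hQ fun i => (hG i).1).congr hGΦ.symm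
  have hid : ∀ s ∈ hb.halfPlane, Φ (toPlane P b s) = Q fun i => hb.lift (φ i) s := by
    have h1 : AnalyticOnNhd ℂ (fun s => Φ (toPlane P b s)) hb.halfPlane := fun s hs =>
      (hΦan _ (hb.toPlane_notMem hs)).fun_comp ((differentiable_toPlane P b).analyticAt s)
    have h2 : AnalyticOnNhd ℂ (fun s => Q fun i => hb.lift (φ i) s) hb.halfPlane := fun s hs =>
      analyticAt_comp_tuple hQ fun i => hb.analyticOnNhd_lift (φ i) s hs
    refine fun s hs => h1.eqOn_of_preconnected_of_eventuallyEq h2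
      hb.convex_halfPlane.isPreconnected hb.zero_mem ?_ hs
    have h3 : ∀ᶠ s in 𝓝 0, ∀ i, hb.lift (φ i) s = rep (φ i) (toPlane P b s) :=
      eventually_all.2 fun i => hb.lift_eventuallyEq (φ i)
    filter_upwards [h3, (tendsto_toPlane_zero P b).eventually hφF,
      (tendsto_toPlane_zero P b).eventually hFΦ] with s h4 h5 h6
    rw [h6]
    simp only [h4, h5]
  choose D K L hK hL hgrow using fun i => hb.exists_growth hF (φ i)
  set D' := ∑ i, |D i|
  set K' := ∑ i, K i
  set L' := ∑ i, L i
  have hD' : 0 ≤ D' := Finset.sum_nonneg fun i _ => abs_nonneg _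
  have hK' : 0 ≤ K' := Finset.sum_nonneg fun i _ => hK i
  have hL' : 0 ≤ L' := Finset.sum_nonneg fun i _ => hL i
  obtain ⟨N, hN⟩ := exists_nat_ge (K' * d)
  have hlb : localParam P b ≠ 0 := localParam_ne_zero hb.ne_center
  have hlbpos : 0 < ‖localParam P b‖ := norm_pos_iff.2 hlb
  refine ⟨|C| * (1 + D') ^ d * ‖localParam P b‖ ^ N, ‖localParam P b‖ * Real.exp (-L'), N,
    by positivity, fun z hz hzr => ?_⟩
  have hlz : localParam P z ≠ 0 := localParam_ne_zero hz
  have hlzpos : 0 < ‖localParam P z‖ := norm_pos_iff.2 hlz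
  set s := Complex.log (localParam P z / localParam P b)
  have hzs : toPlane P b s = z := toPlane_log_localParam hb.ne_center hz
  have hexp : Real.exp s.re = ‖localParam P z‖ / ‖localParam P b‖ := by
    rw [Complex.log_re, norm_div, Real.exp_log (by positivity)]
  have hsre : s.re ≤ -L' := by
    rw [← Real.exp_le_exp, hexp, div_le_iff₀ hlbpos]
    linarith
  have hsim : |s.im| ≤ Real.pi := by
    rw [Complex.log_im]
    exact Complex.abs_arg_le_pi _
  have hs0 : s.re ≤ 0 := by linarith
  have hnorm : ‖fun i => hb.lift (φ i) s‖ ≤ D' * Real.exp (-K' * s.re) := by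
    refine (pi_norm_le_iff_of_nonneg (by positivity)).2 fun i => ?_
    have hLi : L i ≤ L' := Finset.single_le_sum (fun j _ => hL j) (Finset.mem_univ i)
    have hKi : K i ≤ K' := Finset.single_le_sum (fun j _ => hK j) (Finset.mem_univ i)
    have hDi : |D i| ≤ D' :=
      Finset.single_le_sum (f := fun j => |D j|) (fun j _ => abs_nonneg _) (Finset.mem_univ i)
    refine (hgrow i s (by linarith) hsim).trans ?_
    refine mul_le_mul ((le_abs_self _).trans hDi) (Real.exp_le_exp.2 ?_) (Real.exp_pos _).le hD'
    nlinarith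
  have hE1 : 1 ≤ Real.exp (-K' * s.re) := Real.one_le_exp (by nlinarith)
  have hΦz : ‖Φ z‖ ≤ |C| * (1 + D') ^ d * Real.exp (-(N : ℝ) * s.re) := by
    rw [← hzs, hid s (hb.mem_halfPlane hs0)]
    calc ‖Q fun i => hb.lift (φ i) s‖ ≤ C * (1 + ‖fun i => hb.lift (φ i) s‖) ^ d := hC _
      _ ≤ |C| * ((1 + D') * Real.exp (-K' * s.re)) ^ d := by
          refine mul_le_mul (le_abs_self C) ?_ (by positivity) (abs_nonneg _)
          refine pow_le_pow_left₀ (by positivity) ?_ d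
          nlinarith
      _ = |C| * (1 + D') ^ d * Real.exp (-(K' * d) * s.re) := by
          rw [mul_pow, ← Real.exp_nat_mul, mul_assoc]
          congr 3
          ring
      _ ≤ |C| * (1 + D') ^ d * Real.exp (-(N : ℝ) * s.re) := by
          refine mul_le_mul_of_nonneg_left (Real.exp_le_exp.2 ?_) (by positivity)
          nlinarith
  have hexpN : Real.exp (-(N : ℝ) * s.re) * ‖localParam P z‖ ^ N = ‖localParam P b‖ ^ N := by
    have : ‖localParam P z‖ = Real.exp s.re * ‖localParam P b‖ := by
      rw [hexp, div_mul_cancel₀ _ hlbpos.ne']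
    rw [this, mul_pow, ← Real.exp_nat_mul, ← mul_assoc, ← Real.exp_add, neg_mul, neg_add_cancel,
      Real.exp_zero, one_mul]
  calc ‖Φ z‖ * ‖localParam P z‖ ^ N
      ≤ |C| * (1 + D') ^ d * Real.exp (-(N : ℝ) * s.re) * ‖localParam P z‖ ^ N :=
        mul_le_mul_of_nonneg_right hΦz (by positivity)
    _ = |C| * (1 + D') ^ d * ‖localParam P b‖ ^ N := by rw [mul_assoc _ (Real.exp _), hexpN]

/-- An expression in solutions that is invariant under monodromy is a rational function. -/
theorem exists_ratFunc_of_invariant (hF : IsFuchsian a) {b : ℂ} (hb : b ∉ singularSet a)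
    {f : ι → solutionSpace a b} {Q : (ι → ℂ) → ℂ} (hQ : Differentiable ℂ Q)
    {C : ℝ} {d : ℕ} (hC : ∀ x, ‖Q x‖ ≤ C * (1 + ‖x‖) ^ d)
    (hinv : ∀ T ∈ monodromyGroup a b, (fun z => Q fun i => rep (T (f i)) z) =ᶠ[𝓝 b]
      fun z => Q fun i => rep (f i) z) :
    ∃ R : RatFunc ℂ, ∀ᶠ z in 𝓝 b, Q (fun i => rep (f i) z) = ratVal R z := by
  obtain ⟨Φ, hΦb, hΦ⟩ := exists_singleValued hb hQ hinv
  have hΦan : ∀ z ∉ singularSet a, AnalyticAt ℂ Φ z := fun z hz => by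
    obtain ⟨G, hG, hGΦ⟩ := hΦ z hz
    exact (analyticAt_comp_tuple hQ fun i => (hG i).1).congr hGΦ.symm
  choose A r N hr hA using fun p : ℂ => singleValued_growth hF hQ hC hΦ (OnePoint.some p)
  obtain ⟨A', r', N', hr', hA'⟩ := singleValued_growth hF hQ hC hΦ OnePoint.infty
  classical
  set S := (finite_singularSet a).toFinset
  have hS : ∀ z, z ∈ S ↔ z ∈ singularSet a := fun z => (finite_singularSet a).mem_toFinset
  -- The factor (z - p)^{N p} absorbs the growth of Φ at p. The two extra factors give Φq = O((z -
  -- p)²) with value 0 at p, so Φq is differentiable there with derivative 0, whatever value Φ has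
  -- at p.
  let q : Polynomial ℂ := ∏ p ∈ S, (Polynomial.X - Polynomial.C p) ^ (N p + 2)
  have hq : ∀ z, q.eval z = ∏ p ∈ S, (z - p) ^ (N p + 2) := fun z => by
    simp [q, Polynomial.eval_prod]
  let Ψ : ℂ → ℂ := fun z => Φ z * q.eval z
  have hΨ : Differentiable ℂ Ψ := by
    intro z
    by_cases hz : z ∈ singularSet a
    · obtain ⟨B, hB⟩ : ∃ B, ∀ᶠ x in 𝓝 z, ‖∏ p ∈ S.erase z, (x - p) ^ (N p + 2)‖ ≤ B := by
        have : ContinuousAt (fun x : ℂ => ‖∏ p ∈ S.erase z, (x - p) ^ (N p + 2)‖) z := by fun_prop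
        exact ⟨_, (this.eventually (gt_mem_nhds (lt_add_one _))).mono fun x hx => hx.le⟩
      have hqe : ∀ x, q.eval x = (x - z) ^ (N z + 2) * ∏ p ∈ S.erase z, (x - p) ^ (N p + 2) :=
        fun x => by
          rw [hq, Finset.mul_prod_erase S (fun p => (x - p) ^ (N p + 2)) ((hS z).2 hz)]
      have hΨz : Ψ z = 0 := by
        simp only [Ψ, hqe, sub_self]
        rw [zero_pow (by omega), zero_mul, mul_zero]
      have hball : ∀ᶠ x in 𝓝 z, ‖x - z‖ ≤ r z := by
        filter_upwards [Metric.closedBall_mem_nhds z (hr z)] with x hx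
        rwa [Metric.mem_closedBall, dist_eq_norm] at hx
      have hO : (fun x => Ψ x) =O[𝓝 z] fun x => (x - z) ^ 2 := by
        rw [Asymptotics.isBigO_iff]
        refine ⟨|A z| * B, ?_⟩
        filter_upwards [hB, hball] with x h1 h2
        rcases eq_or_ne x z with rfl | hxz
        · rw [hΨz, norm_zero]
          exact mul_nonneg (mul_nonneg (abs_nonneg _) ((norm_nonneg _).trans h1)) (norm_nonneg _)
        · have h3 : ‖Φ x‖ * ‖x - z‖ ^ N z ≤ A z := hA z x hxz h2
          calc ‖Ψ x‖ = (‖Φ x‖ * ‖x - z‖ ^ N z) * ‖∏ p ∈ S.erase z, (x - p) ^ (N p + 2)‖ *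
                ‖(x - z) ^ 2‖ := by
                simp only [Ψ, hqe, norm_mul, norm_pow, pow_add]
                ring
            _ ≤ |A z| * B * ‖(x - z) ^ 2‖ := by
                refine mul_le_mul_of_nonneg_right ?_ (norm_nonneg _)
                exact mul_le_mul (h3.trans (le_abs_self _)) h1 (norm_nonneg _) (abs_nonneg _)
      have hder : HasDerivAt Ψ 0 z := by
        rw [hasDerivAt_iff_isLittleO]
        simp only [hΨz, sub_zero, smul_zero]
        refine hO.trans_isLittleO ?_
        have h4 : (fun x : ℂ => (x - z) ^ 2) =o[𝓝 z] fun x => (x - z) ^ 1 :=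
          (Asymptotics.isLittleO_pow_pow one_lt_two).comp_tendsto (tendsto_sub_nhds_zero_iff.2 tendsto_id)
        simpa using h4
      exact hder.differentiableAt
    · exact (hΦan z hz).differentiableAt.mul q.differentiableAt
  have hqgrow : ∃ (B R : ℝ) (m : ℕ), 0 ≤ B ∧ 1 ≤ R ∧ ∀ z : ℂ, R ≤ ‖z‖ → ‖q.eval z‖ ≤ B * ‖z‖ ^ m := by
    have h1 := (tendsto_eval_div_pow_cobounded (le_refl q.natDegree)).norm.eventually
      (gt_mem_nhds (lt_add_one _))
    rw [← comap_norm_atTop, eventually_comap] at h1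
    obtain ⟨R, hR⟩ := eventually_atTop.1 h1
    refine ⟨‖q.coeff q.natDegree‖ + 1, max R 1, q.natDegree, by positivity, le_max_right _ _,
      fun z hz => ?_⟩
    have h2 := hR ‖z‖ ((le_max_left _ _).trans hz) z rfl
    have h3 : 0 < ‖z‖ := lt_of_lt_of_le one_pos ((le_max_right _ _).trans hz)
    rw [norm_div, norm_pow, div_lt_iff₀ (by positivity)] at h2
    exact h2.le
  obtain ⟨B, R, m, hB0, hR1, hB⟩ := hqgrow
  -- The product Ψ is entire, and the growth of Φ at ∞ together with the degree of q bounds it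
  -- polynomially.
  obtain ⟨p, hp⟩ := exists_polynomial_of_growth (N' + m) hΨ (max R r'⁻¹) (|A'| * B) (fun z hz => by
    have h1 : R ≤ ‖z‖ := (le_max_left _ _).trans hz
    have h2 : r'⁻¹ ≤ ‖z‖ := (le_max_right _ _).trans hz
    have hpos : 0 < ‖z‖ := lt_of_lt_of_le one_pos (hR1.trans h1)
    have h3 := hA' z (norm_pos_iff.1 hpos) (by
      change ‖z⁻¹‖ ≤ r'
      rw [norm_inv]
      exact inv_le_of_inv_le₀ hr' h2)
    have h4 : ‖Φ z‖ ≤ |A'| * ‖z‖ ^ N' := by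
      change ‖Φ z‖ * ‖z⁻¹‖ ^ N' ≤ A' at h3
      rw [norm_inv, inv_pow, ← div_eq_mul_inv, div_le_iff₀ (by positivity)] at h3
      exact h3.trans (mul_le_mul_of_nonneg_right (le_abs_self _) (by positivity))
    calc ‖Ψ z‖ = ‖Φ z‖ * ‖q.eval z‖ := norm_mul _ _
      _ ≤ (|A'| * ‖z‖ ^ N') * (B * ‖z‖ ^ m) :=
        mul_le_mul h4 (hB z h1) (norm_nonneg _) (by positivity)
      _ = |A'| * B * ‖z‖ ^ (N' + m) := by ring)
  refine ⟨algebraMap (Polynomial ℂ) (RatFunc ℂ) p / algebraMap (Polynomial ℂ) (RatFunc ℂ) q, ?_⟩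
  filter_upwards [hΦb, (isOpen_compl_singularSet a).mem_nhds hb] with z h1 h2
  have hqz : q.eval z ≠ 0 := by
    rw [hq]
    refine Finset.prod_ne_zero_iff.2 fun p hp => pow_ne_zero _ (sub_ne_zero.2 ?_)
    rintro rfl
    exact h2 ((hS z).1 hp)
  rw [ratVal_div hqz, ← hp, ← h1]
  simp only [Ψ]
  rw [mul_div_cancel_right₀ _ hqz]

end Rational

/-! ### Eigenlines and dihedral groups -/

section LinearAlgebra

variable {V : Type*} [AddCommGroup V] [Module ℂ V] {n : ℕ}

/-- A diagonalizable operator with one-dimensional eigenspaces and all eigenvalues in a list whose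
length is the dimension has an eigenbasis indexed by that list. -/
theorem exists_eigenbasis [FiniteDimensional ℂ V] (hV : Module.finrank ℂ V = n)
    {M : Module.End ℂ V} {k : ℕ} (hk : k ≠ 0) (hM : M ^ k = 1) {χ : Fin n → ℂ}
    (hχ : ∀ (κ : ℂ) (v : V), v ≠ 0 → M v = κ • v → ∃ j, κ = χ j)
    (hone : ∀ (κ : ℂ) (v w : V), v ≠ 0 → M v = κ • v → M w = κ • w → ∃ c : ℂ, w = c • v) :
    ∃ f : Module.Basis (Fin n) ℂ V, ∀ j, M (f j) = χ j • f j := by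
  have hss : M.IsSemisimple := by
    refine Module.End.isSemisimple_of_squarefree_aeval_eq_zero
      (p := (Polynomial.X ^ k - 1 : Polynomial ℂ)) ?_ (by simp [hM])
    have := (Polynomial.separable_X_pow_sub_C (1 : ℂ) (n := k) (by exact_mod_cast hk)
      one_ne_zero).squarefree
    simpa using this
  have hgen : ∀ j, ∃ v : V, M v = χ j • v ∧ ∀ w, M w = χ j • w → ∃ c : ℂ, w = c • v := by
    intro j
    by_cases h : ∃ v : V, v ≠ 0 ∧ M v = χ j • v
    · obtain ⟨v, hv0, hv⟩ := h
      exact ⟨v, hv, fun w hw => hone (χ j) v w hv0 hv hw⟩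
    · push Not at h
      refine ⟨0, by simp, fun w hw => ⟨0, ?_⟩⟩
      by_contra hw0
      exact h w (by simpa using hw0) hw
  choose f hf hfgen using hgen
  have hspan : ⊤ ≤ Submodule.span ℂ (Set.range f) := by
    rw [← hss.iSup_eigenspace_eq_top]
    refine iSup_le fun κ v hv => ?_
    rw [Module.End.mem_eigenspace_iff] at hv
    by_cases hv0 : v = 0
    · rw [hv0]
      exact zero_mem _
    · obtain ⟨j, rfl⟩ := hχ κ v hv0 hv
      obtain ⟨c, rfl⟩ := hfgen j v hv
      exact Submodule.smul_mem _ _ (Submodule.subset_span ⟨j, rfl⟩)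
  refine ⟨basisOfTopLeSpanOfCardEqFinrank f hspan (by rw [hV, Fintype.card_fin]), fun j => ?_⟩
  rw [coe_basisOfTopLeSpanOfCardEqFinrank]
  exact hf j

/-- Eigenvectors of an operator with simple spectrum. -/
theorem eq_smul_of_eigenvector {f : Module.Basis (Fin n) ℂ V} {χ : Fin n → ℂ}
    (hχ : Function.Injective χ) {M : V ≃ₗ[ℂ] V} (hM : ∀ j, M (f j) = χ j • f j) {κ : ℂ} {v : V}
    (hv0 : v ≠ 0) (hv : M v = κ • v) : ∃ (j : Fin n) (c : ℂ), v = c • f j ∧ κ = χ j := by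
  have h1 : ∀ i, χ i * f.repr v i = κ * f.repr v i := by
    intro i
    have h2 : M v = ∑ j, (f.repr v j * χ j) • f j := by
      conv_lhs => rw [← f.sum_repr v]
      rw [map_sum]
      refine Finset.sum_congr rfl fun j _ => ?_
      rw [map_smul, hM, smul_smul]
    have h3 : f.repr (M v) i = f.repr v i * χ i := by
      rw [h2, f.repr_sum_self]
    rw [hv, map_smul, Finsupp.smul_apply, smul_eq_mul] at h3
    rw [h3, mul_comm]
  have h4 : ∃ j, f.repr v j ≠ 0 := by
    by_contra hcon
    push Not at hcon
    exact hv0 (f.ext_elem fun i => by simp [hcon])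
  obtain ⟨j, hj⟩ := h4
  have hκ : κ = χ j := (mul_right_cancel₀ hj (h1 j)).symm
  refine ⟨j, f.repr v j, ?_, hκ⟩
  refine f.ext_elem fun i => ?_
  rw [map_smul, f.repr_self, Finsupp.smul_apply, smul_eq_mul]
  by_cases hij : i = j
  · rw [hij, Finsupp.single_eq_same, mul_one]
  · rw [Finsupp.single_eq_of_ne hij, mul_zero]
    by_contra h0
    exact hij (hχ ((mul_right_cancel₀ h0 (h1 i)).trans hκ))

theorem eq_smul_of_commute {f : Module.Basis (Fin n) ℂ V} {χ : Fin n → ℂ}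
    (hχ : Function.Injective χ) {M T : V ≃ₗ[ℂ] V} (hM : ∀ j, M (f j) = χ j • f j)
    (hT : T * M = M * T) (i : Fin n) : ∃ c : ℂ, T (f i) = c • f i := by
  have h1 : M (T (f i)) = χ i • T (f i) := by
    rw [← LinearEquiv.mul_apply, ← hT, LinearEquiv.mul_apply, hM, map_smul]
  obtain ⟨j, c, h2, h3⟩ := eq_smul_of_eigenvector hχ hM
    (by simpa using f.ne_zero i) h1
  exact ⟨c, by rw [h2, hχ h3]⟩

/-- Rotations commute and reflections invert rotations. The inversion is written without inverses,
in the form that yields T(f i) = χ i · M(T(f i)) when M is the rotation and T inverts it. -/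
theorem dihedral_rotation {m : ℕ} (k : ZMod m) (y : DihedralGroup m) :
    y * .r k = .r k * y ∨ .r k * y * .r k = y := by
  rcases y with j | j
  · left
    simp [add_comm]
  · right
    simp

/-- An element that does not commute with some rotation is a reflection, and the product of two
reflections is a rotation. -/
theorem dihedral_rotation_mul {m : ℕ} (k : ZMod m) {y y' : DihedralGroup m}
    (hy : y * .r k ≠ .r k * y) (hy' : y' * .r k ≠ .r k * y') :
    y * y' * .r k = .r k * (y * y') := by
  rcases y with j | j
  · simp [add_comm] at hy
  · rcases y' with j' | j'
    · simp [add_comm] at hy'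
    · simp [add_comm]

/-- The element z is the commutator of y with the reflection, a rotation by an even amount. Since 4
= 0 in `ZMod m`, it is an involution that commutes with both. -/
theorem dihedral_reflection {m : ℕ} (hm : m ∣ 4) (k : ZMod m) (y : DihedralGroup m) :
    ∃ z : DihedralGroup m, y * .sr k = z * .sr k * y ∧ z * z = 1 ∧ z * y = y * z ∧
      z * .sr k = .sr k * z := by
  have h4 : ((4 : ℕ) : ZMod m) = 0 := (ZMod.natCast_eq_zero_iff 4 m).2 hm
  push_cast at h4
  rcases y with j | j
  · refine ⟨.r (2 * j), ?_, ?_, ?_, ?_⟩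
    · simp only [DihedralGroup.r_mul_sr, DihedralGroup.sr_mul_r]
      congr 1
      ring
    · rw [DihedralGroup.r_mul_r, DihedralGroup.one_def]
      congr 1
      linear_combination j * h4
    · simp [add_comm]
    · simp only [DihedralGroup.r_mul_sr, DihedralGroup.sr_mul_r]
      congr 1
      linear_combination (-j) * h4
  · refine ⟨.r (2 * (j - k)), ?_, ?_, ?_, ?_⟩
    · simp only [DihedralGroup.r_mul_sr, DihedralGroup.sr_mul_sr]
      congr 1
      linear_combination (k - j) * h4
    · rw [DihedralGroup.r_mul_r, DihedralGroup.one_def]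
      congr 1
      linear_combination (j - k) * h4
    · simp only [DihedralGroup.r_mul_sr, DihedralGroup.sr_mul_r]
      congr 1
      linear_combination (-(j - k)) * h4
    · simp only [DihedralGroup.r_mul_sr, DihedralGroup.sr_mul_r]
      congr 1
      linear_combination (-(j - k)) * h4

/-- For m = 1, 2 the group is abelian, and for m = 4 the centralizer of a reflection has index two.
The cases are finite and checked directly. -/
theorem dihedral_reflection_mul {m : ℕ} (hm : m ∣ 4) (k : ZMod m) {y y' : DihedralGroup m}
    (hy : y * .sr k ≠ .sr k * y) (hy' : y' * .sr k ≠ .sr k * y') :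
    y * y' * .sr k = .sr k * (y * y') := by
  have hm4 : m ≤ 4 := Nat.le_of_dvd (by norm_num) hm
  have hm0 : m ≠ 0 := by
    rintro rfl
    norm_num at hm
  revert k y y'
  interval_cases m
  · exact absurd rfl hm0
  · decide
  · decide
  · norm_num at hm
  · decide

variable {m : ℕ} {G : Subgroup (V ≃ₗ[ℂ] V)}

/-- In a dihedral group acting faithfully, every element permutes the eigenlines of an element `M`
with simple spectrum, and the elements that fix these lines form a subgroup of index at most two. -/
theorem dihedral_permutes_eigenlines (e : G ≃* DihedralGroup m) {M : V ≃ₗ[ℂ] V} (hMG : M ∈ G)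
    {f : Module.Basis (Fin n) ℂ V} {χ : Fin n → ℂ} (hχ : Function.Injective χ)
    (hM : ∀ j, M (f j) = χ j • f j) (hn : n ≠ 0)
    (hexc : n = 2 → (∀ i, χ i ^ 2 = 1) → m ∣ 4) :
    (∀ T ∈ G, ∀ i, ∃ (j : Fin n) (c : ℂ), T (f i) = c • f j) ∧
    ∀ T ∈ G, ∀ T' ∈ G, T * M ≠ M * T → T' * M ≠ M * T' → T * T' * M = M * (T * T') := by
  have transfer : ∀ {x y : G}, e x = e y → (x : V ≃ₗ[ℂ] V) = y := fun h => by
    rw [e.injective h]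
  have hTf : ∀ T : V ≃ₗ[ℂ] V, ∀ i, T (f i) ≠ 0 := fun T i => by simpa using f.ne_zero i
  rcases hx : e ⟨M, hMG⟩ with k | k
  · constructor
    · intro T hT i
      rcases dihedral_rotation k (e ⟨T, hT⟩) with h | h
      · rw [← hx, ← map_mul, ← map_mul] at h
        obtain ⟨c, hc⟩ := eq_smul_of_commute hχ hM (T := T) (transfer h) i
        exact ⟨i, c, hc⟩
      · rw [← hx, ← map_mul, ← map_mul] at h
        have h1 : M * T * M = T := transfer h
        have h2 : T (f i) = χ i • M (T (f i)) := by
          conv_lhs => rw [← h1]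
          rw [LinearEquiv.mul_apply, hM, map_smul, LinearEquiv.mul_apply]
        have hχ0 : χ i ≠ 0 := by
          intro h0
          rw [h0, zero_smul] at h2
          exact hTf T i h2
        have h3 : M (T (f i)) = (χ i)⁻¹ • T (f i) := by
          conv_rhs => rw [h2]
          rw [smul_smul, inv_mul_cancel₀ hχ0, one_smul]
        obtain ⟨j, c, h4, _⟩ := eq_smul_of_eigenvector hχ hM (hTf T i) h3
        exact ⟨j, c, h4⟩
    · intro T hT T' hT' h h'
      have key := dihedral_rotation_mul k (y := e ⟨T, hT⟩) (y' := e ⟨T', hT'⟩)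
        (fun h1 => h (by
          rw [← hx, ← map_mul, ← map_mul] at h1
          exact transfer h1))
        (fun h1 => h' (by
          rw [← hx, ← map_mul, ← map_mul] at h1
          exact transfer h1))
      rw [← hx, ← map_mul, ← map_mul, ← map_mul] at key
      exact transfer key
  -- If M is a reflection, its eigenvalues are distinct square roots of 1, so n ≤ 2.
  · have hMM : M * M = 1 := by
      have h1 : e (⟨M, hMG⟩ * ⟨M, hMG⟩) = e 1 := by
        rw [map_mul, hx, map_one, DihedralGroup.sr_mul_sr, sub_self]
        rfl
      exact transfer h1
    have hχ2 : ∀ i, χ i ^ 2 = 1 := by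
      intro i
      have h1 : M (M (f i)) = f i := by
        rw [← LinearEquiv.mul_apply, hMM]
        rfl
      rw [hM, map_smul, hM, smul_smul, ← pow_two] at h1
      have h2 : (χ i ^ 2 - 1) • f i = 0 := by rw [sub_smul, h1, one_smul, sub_self]
      exact sub_eq_zero.1 ((smul_eq_zero.1 h2).resolve_right (f.ne_zero i))
    have hn2 : n ≤ 2 := by
      have h1 : ∀ i ∈ (Finset.univ : Finset (Fin n)), χ i ∈ ({1, -1} : Finset ℂ) := fun i _ => by
        rcases mul_self_eq_one_iff.1 ((pow_two (χ i)).symm.trans (hχ2 i)) with h | h <;> simp [h]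
      have h2 := Finset.card_le_card_of_injOn χ h1 hχ.injOn
      rw [Finset.card_univ, Fintype.card_fin] at h2
      exact h2.trans Finset.card_le_two
    by_cases hn1 : n = 1
    · subst hn1
      have hscal : ∀ v, M v = χ 0 • v := by
        intro v
        rw [← f.sum_repr v]
        simp only [Finset.univ_unique, Fin.default_eq_zero, Finset.sum_singleton, map_smul, hM]
        rw [smul_comm]
      have hcomm : ∀ T : V ≃ₗ[ℂ] V, T * M = M * T := fun T => by
        ext v
        rw [LinearEquiv.mul_apply, LinearEquiv.mul_apply, hscal, hscal, map_smul]
      refine ⟨fun T _ i => ?_, fun T _ T' _ h _ => absurd (hcomm T) h⟩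
      obtain ⟨c, hc⟩ := eq_smul_of_commute hχ hM (hcomm T) i
      exact ⟨i, c, hc⟩
    · have hm4 : m ∣ 4 := hexc (by omega) hχ2
      constructor
      · intro T hT i
        obtain ⟨z', h1, h2, h3, h4⟩ := dihedral_reflection hm4 k (e ⟨T, hT⟩)
        obtain ⟨z, rfl⟩ := e.surjective z'
        rw [← hx, ← map_mul, ← map_mul, ← map_mul] at h1
        rw [← map_mul, ← map_one e] at h2
        rw [← map_mul, ← map_mul] at h3
        rw [← hx, ← map_mul, ← map_mul] at h4
        have k1 : T * M = z * M * T := transfer h1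
        have k2 : (z : V ≃ₗ[ℂ] V) * z = 1 := transfer h2
        have k3 : z * T = T * z := transfer h3
        have k4 : z * M = M * z := transfer h4
        obtain ⟨ζ, hζ⟩ := eq_smul_of_commute hχ hM k4 i
        -- Conjugation by T changes M only by the involution z, which scales f i by some ζ as it
        -- commutes with M. So T(f i) is an eigenvector of M with eigenvalue ζ χ i.
        have k5 : M * T = T * M * z := by
          rw [k1, mul_assoc (_ * M), ← k3, ← mul_assoc, mul_assoc (z : V ≃ₗ[ℂ] V) M z, ← k4,
            ← mul_assoc, k2, one_mul]
        have k6 : M (T (f i)) = (ζ * χ i) • T (f i) := by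
          rw [← LinearEquiv.mul_apply, k5, LinearEquiv.mul_apply, hζ, map_smul,
            LinearEquiv.mul_apply, hM, map_smul, smul_smul]
        obtain ⟨j, c, h5, _⟩ := eq_smul_of_eigenvector hχ hM (hTf T i) k6
        exact ⟨j, c, h5⟩
      · intro T hT T' hT' h h'
        have key := dihedral_reflection_mul hm4 k (y := e ⟨T, hT⟩) (y' := e ⟨T', hT'⟩)
          (fun h1 => h (by
            rw [← hx, ← map_mul, ← map_mul] at h1
            exact transfer h1))
          (fun h1 => h' (by
            rw [← hx, ← map_mul, ← map_mul] at h1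
            exact transfer h1))
        rw [← hx, ← map_mul, ← map_mul, ← map_mul] at key
        exact transfer key

end LinearAlgebra

/-! ### The eigenbasis indexed by the local exponents -/

section Eigenbasis

open Complex (I)

variable {n : ℕ} {a : Fin n → RatFunc ℂ} {b : ℂ} {P : OnePoint ℂ} {lam : Fin n → ℂ}

theorem eq_of_exp_eq (hdist : ∀ i j : Fin n, i ≠ j → ∀ k : ℤ, lam i - lam j ≠ (k : ℂ)) {i j : Fin n}
    (h : Complex.exp (2 * Real.pi * I * lam i) = Complex.exp (2 * Real.pi * I * lam j)) : i = j := by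
  by_contra hij
  obtain ⟨k, hk⟩ := Complex.exp_eq_exp_iff_exists_int.1 h
  refine hdist i j hij k ?_
  have h2pi : (2 * Real.pi * I : ℂ) ≠ 0 := Complex.two_pi_I_ne_zero
  refine mul_left_cancel₀ h2pi ?_
  rw [mul_sub, hk]
  ring

variable [NeZero n]

/-- The exponent of an eigenvector of the local monodromy is one of the local exponents. -/
theorem IsNear.exists_index (h : IsNear a b P) (hF : IsFuchsian a) (hlam : IsLocalExponents a P lam)
    {M : solutionSpace a b ≃ₗ[ℂ] solutionSpace a b}
    (hM : ∀ φ : solutionSpace a b, ∀ s ∈ h.halfPlane,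
      h.extension (M φ) s = h.extension φ (s + 2 * Real.pi * I))
    {φ : solutionSpace a b} (hφ : φ ≠ 0) {χ : ℂ} (hχ : M φ = χ • φ) :
    ∃ j, h.HasExponent φ (lam j) ∧ χ = Complex.exp (2 * Real.pi * I * lam j) := by
  have hχ0 : χ ≠ 0 := by
    rintro rfl
    rw [zero_smul] at hχ
    exact hφ (by simpa using hχ)
  obtain ⟨μ, hμ⟩ := h.exists_hasExponent hF hφ hχ0 hχ (hM φ)
  have hroot : μ ∈ (indicialPolynomial a P).roots := by
    refine (Polynomial.mem_roots ?_).2 (hμ.isRoot hF)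
    intro h0
    have h1 := congrArg Multiset.card hlam
    rw [h0, Polynomial.roots_zero] at h1
    simp only [Multiset.card_zero, Multiset.card_map, Finset.card_val, Finset.card_univ,
      Fintype.card_fin] at h1
    exact NeZero.ne n h1.symm
  rw [hlam] at hroot
  obtain ⟨j, _, rfl⟩ := Multiset.mem_map.1 hroot
  exact ⟨j, hμ, hμ.eigenvalue hχ (hM φ)⟩

/-- Eigenvectors φ, ψ with a common eigenvalue share the exponent λ_j, as the exponents differ
modulo ℤ. The combination θ that cancels the leading terms is an eigenvector for the same
eigenvalue. If it were nonzero it would have exponent λ_j too, with a nonzero leading term. -/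
theorem IsNear.eigenspace_le_one (h : IsNear a b P) (hF : IsFuchsian a)
    (hlam : IsLocalExponents a P lam)
    (hdist : ∀ i j : Fin n, i ≠ j → ∀ k : ℤ, lam i - lam j ≠ (k : ℂ))
    {M : solutionSpace a b ≃ₗ[ℂ] solutionSpace a b}
    (hM : ∀ φ : solutionSpace a b, ∀ s ∈ h.halfPlane,
      h.extension (M φ) s = h.extension φ (s + 2 * Real.pi * I))
    {φ ψ : solutionSpace a b} (hφ0 : φ ≠ 0) {χ : ℂ} (hφ : M φ = χ • φ) (hψ : M ψ = χ • ψ) :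
    ∃ c : ℂ, ψ = c • φ := by
  by_cases hψ0 : ψ = 0
  · exact ⟨0, by rw [hψ0, zero_smul]⟩
  obtain ⟨j, hj, hχj⟩ := h.exists_index hF hlam hM hφ0 hφ
  obtain ⟨k, hk, hχk⟩ := h.exists_index hF hlam hM hψ0 hψ
  obtain rfl : j = k := eq_of_exp_eq hdist (hχj.symm.trans hχk)
  obtain ⟨c₁, hc₁, ht₁⟩ := hj.tendsto
  obtain ⟨c₂, hc₂, ht₂⟩ := hk.tendsto
  refine ⟨c₂ / c₁, ?_⟩
  by_contra hne
  set θ := ψ + (-(c₂ / c₁)) • φ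
  have hθ0 : θ ≠ 0 := fun h0 => hne (by
    have := eq_neg_of_add_eq_zero_left h0
    rw [this]
    module)
  have hθ : M θ = χ • θ := by
    simp only [θ, map_add, map_smul, hφ, hψ, smul_add]
    rw [smul_comm]
  obtain ⟨l, hl, hχl⟩ := h.exists_index hF hlam hM hθ0 hθ
  obtain rfl : j = l := eq_of_exp_eq hdist (hχj.symm.trans hχl)
  obtain ⟨c₃, hc₃, ht₃⟩ := hl.tendsto
  have ht := ht₂.add (ht₁.const_mul (-(c₂ / c₁)))
  have hzero : c₂ + -(c₂ / c₁) * c₁ = 0 := by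
    field_simp
    ring
  rw [hzero] at ht
  refine hc₃ (tendsto_nhds_unique (ht₃.congr' ?_) ht)
  refine eventually_farLeft.2 ⟨0, fun s hs => ?_⟩
  have hmem := h.mem_halfPlane (le_of_lt hs)
  have h1 : h.lift θ s = h.lift ψ s + -(c₂ / c₁) * h.lift φ s := by
    have h2 := congrFun (h.extension_add ψ ((-(c₂ / c₁)) • φ) hmem) 0
    have h3 := congrFun (h.extension_smul (-(c₂ / c₁)) φ hmem) 0
    simp only [Pi.add_apply, Pi.smul_apply, smul_eq_mul] at h2 h3
    rw [h3] at h2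
    exact h2
  beta_reduce
  rw [h1]
  ring

/-- An eigenbasis of the local monodromy, indexed by the local exponents. -/
theorem IsNear.exists_eigenbasis (h : IsNear a b P) (hF : IsFuchsian a)
    (hlam : IsLocalExponents a P lam)
    (hdist : ∀ i j : Fin n, i ≠ j → ∀ k : ℤ, lam i - lam j ≠ (k : ℂ))
    {M : solutionSpace a b ≃ₗ[ℂ] solutionSpace a b}
    (hM : ∀ φ : solutionSpace a b, ∀ s ∈ h.halfPlane,
      h.extension (M φ) s = h.extension φ (s + 2 * Real.pi * I)) {k : ℕ} (hk : k ≠ 0)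
    (hMk : M ^ k = 1) :
    ∃ f : Module.Basis (Fin n) ℂ (solutionSpace a b),
      ∀ j, M (f j) = Complex.exp (2 * Real.pi * I * lam j) • f j := by
  have hfd : FiniteDimensional ℂ (solutionSpace a b) :=
    (jetEquiv h.notMem).symm.finiteDimensional
  have hrank : Module.finrank ℂ (solutionSpace a b) = n := by
    rw [(jetEquiv h.notMem).finrank_eq, Module.finrank_fin_fun]
  have hpow : ∀ l : ℕ, ∀ v, ((M : Module.End ℂ (solutionSpace a b)) ^ l) v = (M ^ l) v := by
    intro l
    induction l with
    | zero => intro v; rfl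
    | succ l ih =>
      intro v
      rw [pow_succ, pow_succ, Module.End.mul_apply, LinearEquiv.mul_apply, ih]
      rfl
  refine LinODE.exists_eigenbasis hrank (M := (M : Module.End ℂ (solutionSpace a b))) hk ?_ ?_ ?_
  · ext1 v
    rw [hpow, hMk]
    rfl
  · intro κ v hv0 hv
    obtain ⟨j, _, hj⟩ := h.exists_index hF hlam hM hv0 hv
    exact ⟨j, hj⟩
  · intro κ v w hv0 hv hw
    exact h.eigenspace_le_one hF hlam hdist hM hv0 hv hw

end Eigenbasis

/-! ### Invariant powers: radical functions, half-sums and half-differences -/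

section Invariants

variable {n : ℕ} {a : Fin n → RatFunc ℂ} {b : ℂ}

theorem rep_pow_eventuallyEq {φ ψ : solutionSpace a b} {c : ℂ} {N : ℕ} (h : ψ = c • φ)
    (hc : c ^ N = 1) : ∀ᶠ z in 𝓝 b, rep ψ z ^ N = rep φ z ^ N := by
  rw [h]
  filter_upwards [rep_smul c φ] with z hz
  rw [hz, Pi.smul_apply, smul_eq_mul, mul_pow, hc, one_mul]

theorem pow_card_eq_one_of_smul {V : Type*} [AddCommGroup V] [Module ℂ V]
    {G : Subgroup (V ≃ₗ[ℂ] V)} {T : V ≃ₗ[ℂ] V} (hT : T ∈ G) {v : V} (hv : v ≠ 0) {c : ℂ}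
    (h : T v = c • v) : c ^ Nat.card G = 1 := by
  have h1 : ∀ k : ℕ, (T ^ k) v = c ^ k • v := by
    intro k
    induction k with
    | zero => simp
    | succ k ih =>
      rw [pow_succ, LinearEquiv.mul_apply, h, map_smul, ih, smul_smul, pow_succ, mul_comm]
  have h2 : T ^ Nat.card G = 1 := by
    have := pow_card_eq_one' (x := (⟨T, hT⟩ : G))
    exact congrArg Subtype.val this
  have h3 := h1 (Nat.card G)
  rw [h2] at h3
  have h4 : (c ^ Nat.card G - 1) • v = 0 := by
    rw [sub_smul, ← h3, one_smul]
    exact sub_self _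
  exact sub_eq_zero.1 ((smul_eq_zero.1 h4).resolve_right hv)

theorem eventually_denom_ne_zero (f : RatFunc ℂ) (z : ℂ) :
    ∀ᶠ x in 𝓝[≠] z, f.denom.eval x ≠ 0 := by
  have h := AnalyticOnNhd.eval_polynomial (𝕜 := ℂ) f.denom z trivial
  refine h.eventually_eq_zero_or_eventually_ne_zero.resolve_left fun h0 => ?_
  refine f.denom_ne_zero (Polynomial.eq_zero_of_infinite_isRoot _ ?_)
  exact infinite_of_mem_nhds z h0

/-- The `N`-th power of a radical or dihedral solution lies in the field generated by `√g`. -/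
theorem IsRadicalOrDihedral.exists_pow_eq {g : RatFunc ℂ} {y : solutionSpace a b}
    (hy : IsRadicalOrDihedral a g y) {h₀ : ℂ → ℂ} (hh₀ : AnalyticAt ℂ h₀ b)
    (hg : ∀ᶠ z in 𝓝 b, h₀ z * h₀ z = ratVal g z) :
    ∃ (N : ℕ) (p q : RatFunc ℂ), N ≠ 0 ∧
      ∀ᶠ z in 𝓝[≠] b, rep y z ^ N = ratVal p z + ratVal q z * h₀ z := by
  have hzero : ∀ z, ratVal 0 z = 0 := fun z => by
    have := ratVal_algebraMap 0 z
    rwa [map_zero, Polynomial.eval_zero] at this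
  rcases hy with ⟨F, N, R, hyF, hN, hR⟩ | ⟨y', F, F', r, N, p, q, _, hyF, _, hN, hr, hev⟩
  · refine ⟨N, R, 0, hN, ?_⟩
    filter_upwards [hR, (rep_eventuallyEq hyF).filter_mono nhdsWithin_le_nhds] with z h1 h2
    rw [h2, h1, hzero, zero_mul, add_zero]
  · have hrep := (rep_eventuallyEq hyF).filter_mono (nhdsWithin_le_nhds (s := {b}ᶜ))
    have hg' := hg.filter_mono (nhdsWithin_le_nhds (s := {b}ᶜ))
    -- Two meromorphic square roots of g agree or are opposite throughout a punctured neighbourhood.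
    -- In the second case q is replaced by -q.
    rcases (hr.sub hh₀.meromorphicAt).eventually_eq_zero_or_eventually_ne_zero with h | h
    · refine ⟨N, p, q, hN, ?_⟩
      filter_upwards [hrep, hev, h] with z h1 h2 h3
      rw [h1, h2.2.1, sub_eq_zero.1 h3]
    · refine ⟨N, p, -q, hN, ?_⟩
      filter_upwards [hrep, hev, h, hg', eventually_denom_ne_zero q b] with z h1 h2 h3 h4 h5
      have h6 : (r z - h₀ z) * (r z + h₀ z) = 0 := by
        linear_combination h2.1 - h4
      have h7 : r z = -h₀ z := eq_neg_of_add_eq_zero_left ((mul_eq_zero.1 h6).resolve_left h3)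
      have h8 : ratVal (-q) z = -ratVal q z := by
        have h9 := ratVal_mul (f := algebraMap (Polynomial ℂ) (RatFunc ℂ) (-1)) (g := q) (z := z)
          (by rw [RatFunc.denom_algebraMap]; simp) h5
        rw [ratVal_algebraMap] at h9
        simpa using h9
      rw [h1, h2.2.1, h7, h8]
      ring

variable [NeZero n]

/-- A solution that spans a line stable under a finite monodromy group is radical. -/
theorem isRadical_of_invariant (hF : IsFuchsian a) (hb : b ∉ singularSet a) {N : ℕ} (hN : N ≠ 0)
    {φ : solutionSpace a b}
    (hφ : ∀ T ∈ monodromyGroup a b, ∀ᶠ z in 𝓝 b, rep (T φ) z ^ N = rep φ z ^ N) :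
    IsRadical (φ : Germ (𝓝 b) ℂ) := by
  obtain ⟨R, hR⟩ := exists_ratFunc_of_invariant hF hb (ι := Unit) (f := fun _ => φ)
    (Q := fun x => x () ^ N) (by fun_prop) (C := 1) (d := N) (fun x => by
      rw [norm_pow, one_mul]
      exact pow_le_pow_left₀ (norm_nonneg _) (by linarith [norm_le_pi_norm x ()]) N) hφ
  exact ⟨rep φ, N, R, coe_rep φ, hN, hR.filter_mono nhdsWithin_le_nhds⟩

/-- `T` fixes the `N`-th powers of `φ` and `φ'`. -/
def FixesPowers (N : ℕ) (T : solutionSpace a b ≃ₗ[ℂ] solutionSpace a b)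
    (φ φ' : solutionSpace a b) : Prop :=
  ∀ᶠ z in 𝓝 b, rep (T φ) z ^ N = rep φ z ^ N ∧ rep (T φ') z ^ N = rep φ' z ^ N

/-- `T` exchanges the `N`-th powers of `φ` and `φ'`. -/
def SwapsPowers (N : ℕ) (T : solutionSpace a b ≃ₗ[ℂ] solutionSpace a b)
    (φ φ' : solutionSpace a b) : Prop :=
  ∀ᶠ z in 𝓝 b, rep (T φ) z ^ N = rep φ' z ^ N ∧ rep (T φ') z ^ N = rep φ z ^ N

theorem exists_ratFunc_half_add (hF : IsFuchsian a) (hb : b ∉ singularSet a) {N : ℕ}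
    {φ φ' : solutionSpace a b}
    (hφ : ∀ T ∈ monodromyGroup a b, FixesPowers N T φ φ' ∨ SwapsPowers N T φ φ') :
    ∃ R : RatFunc ℂ, ∀ᶠ z in 𝓝 b, (rep φ z ^ N + rep φ' z ^ N) / 2 = ratVal R z := by
  refine exists_ratFunc_of_invariant hF hb (ι := Fin 2) (f := ![φ, φ'])
    (Q := fun x => (x 0 ^ N + x 1 ^ N) / 2) (by fun_prop) (C := 1) (d := N) (fun x => ?_)
    (fun T hT => ?_)
  · have h : ∀ i, ‖x i ^ N‖ ≤ (1 + ‖x‖) ^ N := fun i => by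
      rw [norm_pow]
      exact pow_le_pow_left₀ (norm_nonneg _) (by linarith [norm_le_pi_norm x i]) N
    have h2 := norm_add_le (x 0 ^ N) (x 1 ^ N)
    rw [norm_div, Complex.norm_ofNat]
    linarith [h 0, h 1]
  · rcases hφ T hT with h | h
    · filter_upwards [h] with z hz
      simp [hz.1, hz.2]
    · filter_upwards [h] with z hz
      simp [hz.1, hz.2, add_comm]

/-- A half-difference changes sign under a swap. Both pairs are swapped by the same elements, so the
product is invariant. The case of equal pairs gives the squares. -/
theorem exists_ratFunc_half_sub_mul (hF : IsFuchsian a) (hb : b ∉ singularSet a) {N : ℕ}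
    {φ φ' ψ ψ' : solutionSpace a b}
    (hφ : ∀ T ∈ monodromyGroup a b, (FixesPowers N T φ φ' ∧ FixesPowers N T ψ ψ') ∨
      (SwapsPowers N T φ φ' ∧ SwapsPowers N T ψ ψ')) :
    ∃ R : RatFunc ℂ, ∀ᶠ z in 𝓝 b, (rep φ z ^ N - rep φ' z ^ N) / 2 *
      ((rep ψ z ^ N - rep ψ' z ^ N) / 2) = ratVal R z := by
  refine exists_ratFunc_of_invariant hF hb (ι := Fin 4) (f := ![φ, φ', ψ, ψ'])
    (Q := fun x => (x 0 ^ N - x 1 ^ N) / 2 * ((x 2 ^ N - x 3 ^ N) / 2)) (by fun_prop)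
    (C := 1) (d := N + N) (fun x => ?_) (fun T hT => ?_)
  · have h : ∀ i, ‖x i ^ N‖ ≤ (1 + ‖x‖) ^ N := fun i => by
      rw [norm_pow]
      exact pow_le_pow_left₀ (norm_nonneg _) (by linarith [norm_le_pi_norm x i]) N
    have h2 : ∀ i j, ‖(x i ^ N - x j ^ N) / 2‖ ≤ (1 + ‖x‖) ^ N := fun i j => by
      have := norm_sub_le (x i ^ N) (x j ^ N)
      rw [norm_div, Complex.norm_ofNat]
      linarith [h i, h j]
    rw [norm_mul, one_mul, pow_add]
    exact mul_le_mul (h2 _ _) (h2 _ _) (norm_nonneg _) (by positivity)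
  · rcases hφ T hT with ⟨h, h'⟩ | ⟨h, h'⟩
    · filter_upwards [h, h'] with z hz hz'
      simp [hz.1, hz.2, hz'.1, hz'.2]
    · filter_upwards [h, h'] with z hz hz'
      simp [hz.1, hz.2, hz'.1, hz'.2]
      ring

/-- Holomorphic functions with equal `N`-th powers differ by a root of unity. -/
theorem exists_root_of_unity {u v : ℂ → ℂ} {z : ℂ} (hu : AnalyticAt ℂ u z) (hv : AnalyticAt ℂ v z)
    {N : ℕ} (hN : N ≠ 0) (h : ∀ᶠ x in 𝓝[≠] z, u x ^ N = v x ^ N) :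
    ∃ ζ : ℂ, ∀ᶠ x in 𝓝 z, u x = ζ * v x := by
  have hpos : 0 < N := Nat.pos_of_ne_zero hN
  -- At each nearby point u = ζ v for some N-th root of unity ζ (any one where both vanish). There
  -- are finitely many, so one ζ occurs at points accumulating at z, and the identity theorem
  -- applies.
  have hfreq : ∃ ζ ∈ Polynomial.nthRootsFinset N (1 : ℂ), ∃ᶠ x in 𝓝[≠] z, u x = ζ * v x := by
    by_contra hcon
    push Not at hcon
    have hall : ∀ᶠ x in 𝓝[≠] z, ∀ ζ ∈ Polynomial.nthRootsFinset N (1 : ℂ), ¬ u x = ζ * v x :=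
      (Filter.eventually_all_finset _).2 fun ζ hζ => hcon ζ hζ
    obtain ⟨x, h1, h2⟩ := (hall.and h).exists
    by_cases hvx : v x = 0
    · have hux : u x = 0 := by
        rw [hvx, zero_pow hN] at h2
        exact pow_eq_zero_iff hN |>.1 h2
      exact h1 1 ((Polynomial.mem_nthRootsFinset hpos 1).2 (one_pow N)) (by rw [hux, hvx, mul_zero])
    · refine h1 (u x / v x) ((Polynomial.mem_nthRootsFinset hpos 1).2 ?_) ?_
      · rw [div_pow, h2, div_self (pow_ne_zero _ hvx)]
      · rw [div_mul_cancel₀ _ hvx]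
  obtain ⟨ζ, _, hζ⟩ := hfreq
  exact ⟨ζ, (hu.frequently_eq_iff_eventually_eq (analyticAt_const.mul hv)).1 hζ⟩

open Complex (I) in
/-- If `√g` is unchanged by the local monodromy, then radical and dihedral solutions are
eigenvectors of the local monodromy. -/
theorem IsNear.exists_eigenvalue {P : OnePoint ℂ} (h : IsNear a b P)
    {M : solutionSpace a b ≃ₗ[ℂ] solutionSpace a b}
    (hM : ∀ φ : solutionSpace a b, ∀ s ∈ h.halfPlane,
      h.extension (M φ) s = h.extension φ (s + 2 * Real.pi * I))
    {g : RatFunc ℂ} {h₀ k : ℂ → ℂ} (hh₀ : AnalyticAt ℂ h₀ b)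
    (hg : ∀ᶠ z in 𝓝 b, h₀ z * h₀ z = ratVal g z)
    (hk : AnalyticOnNhd ℂ k h.halfPlane) (hkh : ∀ᶠ s in 𝓝 0, k s = h₀ (toPlane P b s))
    (hkper : ∀ s ∈ h.halfPlane, k (s + 2 * Real.pi * I) = k s)
    {y : solutionSpace a b} (hy : IsRadicalOrDihedral a g y) : ∃ ζ : ℂ, M y = ζ • y := by
  obtain ⟨N, p, q, hN, hev⟩ := hy.exists_pow_eq hh₀ hg
  -- Clearing denominators turns the relation into one between functions holomorphic on the whole
  -- half-plane, even if p or q has poles there, so it extends from near b.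
  let D : Polynomial ℂ := p.denom * q.denom
  let A : Polynomial ℂ := p.num * q.denom
  let B : Polynomial ℂ := q.num * p.denom
  have hcl : ∀ᶠ z in 𝓝[≠] b, D.eval z * rep y z ^ N = A.eval z + B.eval z * h₀ z := by
    filter_upwards [hev, eventually_denom_ne_zero p b, eventually_denom_ne_zero q b] with z h1 h2 h3
    rw [h1, ratVal_eq, ratVal_eq]
    simp only [D, A, B, Polynomial.eval_mul]
    field_simp
  have htop : Tendsto (toPlane P b) (𝓝[≠] 0) (𝓝[≠] b) := by
    have h1 := (hasDerivAt_toPlane P b 0).tendsto_nhdsNE (by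
      rw [toPlane_zero]
      refine mul_ne_zero ?_ (sub_ne_zero.2 h.ne_center)
      have := orient_mul_self P
      have h2 : orient P ≠ 0 := by
        intro h0
        rw [h0] at this
        norm_num at this
      exact_mod_cast h2)
    rwa [toPlane_zero] at h1
  have hpoly : ∀ r : Polynomial ℂ, AnalyticOnNhd ℂ (fun s => r.eval (toPlane P b s)) h.halfPlane :=
    fun r s _ => (AnalyticOnNhd.eval_polynomial (𝕜 := ℂ) r _ trivial).fun_comp
      ((differentiable_toPlane P b).analyticAt s)
  have hall : ∀ s ∈ h.halfPlane, D.eval (toPlane P b s) * h.lift y s ^ N =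
      A.eval (toPlane P b s) + B.eval (toPlane P b s) * k s := by
    have h1 : AnalyticOnNhd ℂ (fun s => D.eval (toPlane P b s) * h.lift y s ^ N) h.halfPlane :=
      (hpoly D).mul ((h.analyticOnNhd_lift y).pow N)
    have h2 : AnalyticOnNhd ℂ (fun s => A.eval (toPlane P b s) + B.eval (toPlane P b s) * k s)
        h.halfPlane := (hpoly A).add ((hpoly B).mul hk)
    refine fun s hs => h1.eqOn_of_preconnected_of_frequently_eq h2
      h.convex_halfPlane.isPreconnected h.zero_mem ?_ hs
    refine Eventually.frequently ?_
    filter_upwards [htop.eventually hcl,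
      (h.lift_eventuallyEq y).filter_mono nhdsWithin_le_nhds,
      hkh.filter_mono nhdsWithin_le_nhds] with s h3 h4 h5
    rw [h4, h5, h3]
  have hMlift : ∀ s ∈ h.halfPlane, h.lift (M y) s = h.lift y (s + 2 * Real.pi * I) := fun s hs =>
    congrFun (hM y s hs) 0
  -- Shifting s by 2πi changes neither side of the relation except y, which becomes M y. So M y and
  -- y have equal N-th powers where the denominators do not vanish.
  have hpow : ∀ᶠ s in 𝓝[≠] 0, h.lift (M y) s ^ N = h.lift y s ^ N := by
    filter_upwards [htop.eventually (eventually_denom_ne_zero p b),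
      htop.eventually (eventually_denom_ne_zero q b),
      mem_nhdsWithin_of_mem_nhds (h.isOpen_halfPlane.mem_nhds h.zero_mem)] with s h1 h2 h3
    have h4 := hall _ (h.add_period_mem h3)
    rw [toPlane_add_period, hkper s h3, ← hall s h3, ← hMlift s h3] at h4
    refine mul_left_cancel₀ ?_ h4
    simp only [D, Polynomial.eval_mul]
    exact mul_ne_zero h1 h2
  obtain ⟨ζ, hζ⟩ := exists_root_of_unity (h.analyticOnNhd_lift (M y) 0 h.zero_mem)
    (h.analyticOnNhd_lift y 0 h.zero_mem) hN hpow
  refine ⟨ζ, ext_of_rep ?_⟩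
  filter_upwards [h.rep_eventuallyEq_lift (M y), h.rep_eventuallyEq_lift y, rep_smul ζ y,
    (tendsto_log_localParam h.ne_center).eventually hζ] with z h1 h2 h3 h4
  rw [h1, h3, Pi.smul_apply, h2, h4, smul_eq_mul]

end Invariants

/-! ### The common square root and the assembly of the basis -/

section Main

variable {n : ℕ} {a : Fin n → RatFunc ℂ} {b : ℂ}

theorem fixesPowers_of_smul {N : ℕ} {T : solutionSpace a b ≃ₗ[ℂ] solutionSpace a b}
    {φ φ' : solutionSpace a b} (h : ∃ c : ℂ, c ^ N = 1 ∧ T φ = c • φ)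
    (h' : ∃ c : ℂ, c ^ N = 1 ∧ T φ' = c • φ') : FixesPowers N T φ φ' := by
  obtain ⟨c, hc, hφ⟩ := h
  obtain ⟨c', hc', hφ'⟩ := h'
  exact (rep_pow_eventuallyEq hφ hc).and (rep_pow_eventuallyEq hφ' hc')

theorem swapsPowers_of_smul {N : ℕ} {T : solutionSpace a b ≃ₗ[ℂ] solutionSpace a b}
    {φ φ' : solutionSpace a b} (h : ∃ c : ℂ, c ^ N = 1 ∧ T φ = c • φ')
    (h' : ∃ c : ℂ, c ^ N = 1 ∧ T φ' = c • φ) : SwapsPowers N T φ φ' := by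
  obtain ⟨c, hc, hφ⟩ := h
  obtain ⟨c', hc', hφ'⟩ := h'
  exact (rep_pow_eventuallyEq hφ hc).and (rep_pow_eventuallyEq hφ' hc')

theorem subsingleton_solutionSpace_of_eq_zero (hn : n = 0) : Subsingleton (solutionSpace a b) := by
  subst hn
  have hzero : ∀ φ : solutionSpace a b, rep φ =ᶠ[𝓝 b] 0 := fun φ => by
    filter_upwards [(isSolutionAt_rep φ).2] with z hz
    simpa using hz
  exact ⟨fun φ ψ => ext_of_rep ((hzero φ).trans (hzero ψ).symm)⟩

variable [NeZero n]

/-- A quadratic function field element through which all half-differences of `N`-th powers are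
expressed, together with its continuation around `P`. -/
theorem exists_common_sqrt (hF : IsFuchsian a) {P : OnePoint ℂ} (h : IsNear a b P) {N : ℕ}
    {M T₀ : solutionSpace a b ≃ₗ[ℂ] solutionSpace a b}
    (hM : ∀ φ : solutionSpace a b, ∀ s ∈ h.halfPlane,
      h.extension (M φ) s = h.extension φ (s + 2 * Real.pi * Complex.I))
    {ι : Type*} {f : ι → solutionSpace a b}
    (hMf : ∀ i, (∃ c : ℂ, c ^ N = 1 ∧ M (f i) = c • f i) ∧
      ∃ c : ℂ, c ^ N = 1 ∧ M (T₀ (f i)) = c • T₀ (f i))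
    (hG : ∀ T ∈ monodromyGroup a b, (∀ i, FixesPowers N T (f i) (T₀ (f i))) ∨
      ∀ i, SwapsPowers N T (f i) (T₀ (f i))) :
    ∃ (g : RatFunc ℂ) (h₀ k : ℂ → ℂ), AnalyticAt ℂ h₀ b ∧
      (∀ᶠ z in 𝓝 b, h₀ z * h₀ z = ratVal g z) ∧ AnalyticOnNhd ℂ k h.halfPlane ∧
      (∀ᶠ s in 𝓝 0, k s = h₀ (toPlane P b s)) ∧
      (∀ s ∈ h.halfPlane, k (s + 2 * Real.pi * Complex.I) = k s) ∧
      ∀ i, ∃ q : RatFunc ℂ, ∀ᶠ z in 𝓝[≠] b,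
        (rep (f i) z ^ N - rep (T₀ (f i)) z ^ N) / 2 = ratVal q z * h₀ z := by
  let d : ι → ℂ → ℂ := fun i z => (rep (f i) z ^ N - rep (T₀ (f i)) z ^ N) / 2
  have hd : ∀ i, AnalyticAt ℂ (d i) b := fun i =>
    (((isSolutionAt_rep _).1.pow N).sub ((isSolutionAt_rep _).1.pow N)).div_const
  have hR : ∀ i j, ∃ R : RatFunc ℂ, ∀ᶠ z in 𝓝 b, d i z * d j z = ratVal R z := fun i j =>
    exists_ratFunc_half_sub_mul hF h.notMem fun T hT =>
      (hG T hT).imp (fun h => ⟨h i, h j⟩) fun h => ⟨h i, h j⟩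
  choose R hR using hR
  -- Any half-difference that is not identically zero serves as √g. If all vanish, √g = 1 and all
  -- coefficients q are 0.
  by_cases hex : ∃ i, ¬ d i =ᶠ[𝓝 b] 0
  · obtain ⟨i₀, hi₀⟩ := hex
    have hne : ∀ᶠ z in 𝓝[≠] b, d i₀ z ≠ 0 :=
      (hd i₀).eventually_eq_zero_or_eventually_ne_zero.resolve_left hi₀
    refine ⟨R i₀ i₀, d i₀, fun s => (h.lift (f i₀) s ^ N - h.lift (T₀ (f i₀)) s ^ N) / 2, hd i₀,
      hR i₀ i₀, ?_, ?_, ?_, fun i => ?_⟩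
    · exact fun s hs => (((h.analyticOnNhd_lift _ s hs).pow N).sub
        ((h.analyticOnNhd_lift _ s hs).pow N)).div_const
    · filter_upwards [h.lift_eventuallyEq (f i₀), h.lift_eventuallyEq (T₀ (f i₀))] with s h1 h2
      simp only [d, h1, h2]
    · intro s hs
      -- M multiplies f i₀ and T₀ (f i₀) by N-th roots of unity, so their N-th powers, and with them
      -- √g, return to themselves around P.
      have key : ∀ φ : solutionSpace a b, (∃ c : ℂ, c ^ N = 1 ∧ M φ = c • φ) →
          h.lift φ (s + 2 * Real.pi * Complex.I) ^ N = h.lift φ s ^ N := by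
        rintro φ ⟨c, hc, hφ⟩
        have h1 := congrFun (hM φ s hs) 0
        rw [hφ, h.extension_smul c φ hs] at h1
        have h2 : h.lift φ (s + 2 * Real.pi * Complex.I) = c * h.lift φ s := h1.symm
        rw [h2, mul_pow, hc, one_mul]
      simp only [key _ (hMf i₀).1, key _ (hMf i₀).2]
    · refine ⟨R i i₀ / R i₀ i₀, ?_⟩
      have hR0 : R i₀ i₀ ≠ 0 := by
        intro h0
        obtain ⟨z, h1, h2⟩ := (hne.and ((hR i₀ i₀).filter_mono nhdsWithin_le_nhds)).exists
        have h3 := ratVal_algebraMap 0 z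
        rw [map_zero, Polynomial.eval_zero] at h3
        rw [h0, h3] at h2
        exact mul_ne_zero h1 h1 h2
      filter_upwards [hne, (hR i₀ i₀).filter_mono nhdsWithin_le_nhds,
        (hR i i₀).filter_mono nhdsWithin_le_nhds,
        eventually_denom_ne_zero (R i i₀ / R i₀ i₀) b, eventually_denom_ne_zero (R i₀ i₀) b]
        with z h1 h2 h3 h4 h5
      have h6 := ratVal_mul h4 h5
      rw [div_mul_cancel₀ _ hR0, ← h2, ← h3] at h6
      refine mul_right_cancel₀ h1 ?_
      rw [mul_assoc, ← h6]
  · push Not at hex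
    refine ⟨algebraMap (Polynomial ℂ) (RatFunc ℂ) 1, fun _ => 1, fun _ => 1, analyticAt_const,
      Eventually.of_forall fun z => by rw [ratVal_algebraMap]; simp, analyticOnNhd_const,
      Eventually.of_forall fun _ => rfl, fun _ _ => rfl, fun i =>
      ⟨algebraMap (Polynomial ℂ) (RatFunc ℂ) 0, ?_⟩⟩
    filter_upwards [(hex i).filter_mono nhdsWithin_le_nhds] with z hz
    rw [ratVal_algebraMap, Polynomial.eval_zero, zero_mul]
    exact hz

/-- The eigenbasis of the local monodromy consists of radical and dihedral solutions for a suitable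
`g`, and conversely such solutions are eigenvectors of the local monodromy. -/
theorem exists_sqrt_of_eigenbasis (hF : IsFuchsian a) {P : OnePoint ℂ} (h : IsNear a b P) {m : ℕ}
    (hm : m ≠ 0) (e : monodromyGroup a b ≃* DihedralGroup m)
    {M : solutionSpace a b ≃ₗ[ℂ] solutionSpace a b} (hMG : M ∈ monodromyGroup a b)
    (hM : ∀ φ : solutionSpace a b, ∀ s ∈ h.halfPlane,
      h.extension (M φ) s = h.extension φ (s + 2 * Real.pi * Complex.I))
    {f : Module.Basis (Fin n) ℂ (solutionSpace a b)} {χ : Fin n → ℂ} (hχ : Function.Injective χ)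
    (hMf : ∀ j, M (f j) = χ j • f j) (hexc : n = 2 → (∀ i, χ i ^ 2 = 1) → m ∣ 4) :
    ∃ g : RatFunc ℂ, (∀ i, IsRadicalOrDihedral a g (f i)) ∧
      ∀ y, IsRadicalOrDihedral a g y → ∃ ζ : ℂ, M y = ζ • y := by
  have : NeZero m := ⟨hm⟩
  have hfin : Finite (monodromyGroup a b) := Finite.of_equiv _ e.symm.toEquiv
  -- With N the order of the group, every scalar by which a group element acts on an eigenvector is
  -- an N-th root of unity.
  set N := Nat.card (monodromyGroup a b)
  have hN : N ≠ 0 := Nat.card_pos.ne'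
  obtain ⟨hperm, hidx⟩ := dihedral_permutes_eigenlines e hMG hχ hMf (NeZero.ne n) hexc
  have hfix : ∀ T ∈ monodromyGroup a b, T * M = M * T → ∀ i,
      ∃ c : ℂ, c ^ N = 1 ∧ T (f i) = c • f i := fun T hT hTM i => by
    obtain ⟨c, hc⟩ := eq_smul_of_commute hχ hMf hTM i
    exact ⟨c, pow_card_eq_one_of_smul hT (f.ne_zero i) hc, hc⟩
  by_cases hex : ∃ T ∈ monodromyGroup a b, T * M ≠ M * T
  · obtain ⟨T₀, hT₀, hT₀M⟩ := hex
    have hfix' : ∀ T ∈ monodromyGroup a b, T * M = M * T → ∀ i,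
        ∃ c : ℂ, c ^ N = 1 ∧ T (T₀ (f i)) = c • T₀ (f i) := fun T hT hTM i => by
      obtain ⟨j, c, hc⟩ := hperm T₀ hT₀ i
      obtain ⟨c', hc'1, hc'⟩ := hfix T hT hTM j
      exact ⟨c', hc'1, by rw [hc, map_smul, hc', smul_comm]⟩
    have hswap : ∀ T ∈ monodromyGroup a b, T * M ≠ M * T → ∀ i,
        (∃ c : ℂ, c ^ N = 1 ∧ T (f i) = c • T₀ (f i)) ∧
        ∃ c : ℂ, c ^ N = 1 ∧ T (T₀ (f i)) = c • f i := fun T hT hTM i => by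
      constructor
      -- Two elements outside the centralizer of M have product inside it. Applied to T and T₀⁻¹,
      -- this shows that T T₀⁻¹ scales T₀ (f i).
      · have hinv : T₀⁻¹ * M ≠ M * T₀⁻¹ := fun h1 => hT₀M (by
          have := congrArg (fun x => T₀ * x * T₀) h1
          simpa [mul_assoc] using this.symm)
        have hTT := hidx T hT T₀⁻¹ (inv_mem hT₀) hTM hinv
        obtain ⟨c, hc1, hc⟩ := hfix' (T * T₀⁻¹) (mul_mem hT (inv_mem hT₀)) hTT i
        refine ⟨c, hc1, ?_⟩
        rw [← hc, ← LinearEquiv.mul_apply, mul_assoc, inv_mul_cancel, mul_one]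
      · exact hfix (T * T₀) (mul_mem hT hT₀) (hidx T hT T₀ hT₀ hTM hT₀M) i
    have hG : ∀ T ∈ monodromyGroup a b, (∀ i, FixesPowers N T (f i) (T₀ (f i))) ∨
        ∀ i, SwapsPowers N T (f i) (T₀ (f i)) := fun T hT => by
      by_cases hTM : T * M = M * T
      · exact Or.inl fun i => fixesPowers_of_smul (hfix T hT hTM i) (hfix' T hT hTM i)
      · exact Or.inr fun i => swapsPowers_of_smul (hswap T hT hTM i).1 (hswap T hT hTM i).2
    obtain ⟨g, h₀, k, hh₀, hg, hk, hkh, hkper, hq⟩ := exists_common_sqrt hF h (T₀ := T₀) (f := f) hM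
      (fun i => ⟨hfix M hMG rfl i, hfix' M hMG rfl i⟩) hG
    refine ⟨g, fun i => ?_, fun y hy => h.exists_eigenvalue hM hh₀ hg hk hkh hkper hy⟩
    obtain ⟨j, c, hc⟩ := hperm T₀ hT₀ i
    -- If T₀ preserves the line of f i, a swap also fixes the N-th power of f i, so f i is radical.
    -- Otherwise f i and T₀ (f i) lie on different eigenlines and form the independent pair.
    by_cases hij : i = j
    · subst hij
      left
      refine isRadical_of_invariant hF h.notMem hN fun T hT => ?_
      have hc1 : c ^ N = 1 := pow_card_eq_one_of_smul hT₀ (f.ne_zero i) hc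
      rcases hG T hT with h1 | h1
      · exact (h1 i).mono fun z hz => hz.1
      · filter_upwards [h1 i, rep_pow_eventuallyEq hc hc1] with z h2 h3
        rw [h2.1, h3]
    · right
      obtain ⟨p, hp⟩ := exists_ratFunc_half_add hF h.notMem
        (φ := f i) (φ' := T₀ (f i)) fun T hT => (hG T hT).imp (fun h => h i) fun h => h i
      obtain ⟨q, hq⟩ := hq i
      refine ⟨T₀ (f i), rep (f i), rep (T₀ (f i)), h₀, N, p, q, ?_, coe_rep _, coe_rep _, hN,
        hh₀.meromorphicAt, ?_⟩
      · have hc0 : c ≠ 0 := by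
          rintro rfl
          rw [zero_smul] at hc
          exact f.ne_zero i (by simpa using hc)
        rw [LinearIndependent.pair_iff]
        intro s t hst
        rw [hc, smul_smul] at hst
        have h1 := congrArg (fun v => f.repr v i) hst
        have h2 := congrArg (fun v => f.repr v j) hst
        simp only [map_add, map_smul, f.repr_self, Finsupp.add_apply, Finsupp.smul_apply,
          Finsupp.single_eq_same, smul_eq_mul, map_zero, Finsupp.zero_apply,
          Finsupp.single_eq_of_ne hij, Finsupp.single_eq_of_ne (Ne.symm hij), mul_one, mul_zero,
          add_zero, zero_add] at h1 h2
        exact ⟨h1, (mul_eq_zero.1 h2).resolve_right hc0⟩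
      · filter_upwards [hq, hp.filter_mono nhdsWithin_le_nhds, hg.filter_mono nhdsWithin_le_nhds]
          with z h1 h2 h3
        rw [← h1, ← h2, pow_two]
        exact ⟨h3, by ring, by ring⟩
  -- Here every group element commutes with M, so each eigenline is stable, all basis vectors are
  -- radical, and g = 1 serves.
  · push Not at hex
    have hone : ∀ z, ratVal 1 z = 1 := fun z => by
      have := ratVal_algebraMap 1 z
      rwa [map_one, Polynomial.eval_one] at this
    refine ⟨1, fun i => Or.inl ?_, fun y hy => ?_⟩
    · refine isRadical_of_invariant hF h.notMem hN fun T hT => ?_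
      obtain ⟨c, hc1, hc⟩ := hfix T hT (hex T hT) i
      exact rep_pow_eventuallyEq hc hc1
    · exact h.exists_eigenvalue hM (h₀ := fun _ => 1) (k := fun _ => 1) analyticAt_const
        (Eventually.of_forall fun z => by rw [hone, one_mul]) analyticOnNhd_const
        (Eventually.of_forall fun _ => rfl) (fun _ _ => rfl) hy

end Main

end LinODE

/-! ### The main theorem -/

theorem mainTheorem7 {n : ℕ} (a : Fin n → RatFunc ℂ) (hFuchs : LinODE.IsFuchsian a)
    (P : OnePoint ℂ) (b : ℂ) (hb : LinODE.IsNear a b P)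
    (m : ℕ) (hm : m ≠ 0)
    (hmono : Nonempty (LinODE.monodromyGroup a b ≃* DihedralGroup m))
    (lam : Fin n → ℂ) (hlam : LinODE.IsLocalExponents a P lam)
    (hdist : ∀ i j : Fin n, i ≠ j → ∀ k : ℤ, lam i - lam j ≠ (k : ℂ))
    (hexc : n = 2 → (∀ i : Fin n, ∃ k : ℤ, 2 * lam i = (k : ℂ)) → m ∣ 4) :
    ∃ (g : RatFunc ℂ) (f : Module.Basis (Fin n) ℂ (LinODE.solutionSpace a b)),
      (∀ i : Fin n, LinODE.IsRadicalOrDihedral a g (f i) ∧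
        LinODE.HasVanishingOrder P (f i : Germ (𝓝 b) ℂ) (lam i)) ∧
      ∀ (i : Fin n) (y : LinODE.solutionSpace a b), LinODE.IsRadicalOrDihedral a g y →
        LinODE.HasVanishingOrder P (y : Germ (𝓝 b) ℂ) (lam i) → ∃ c : ℂ, y = c • f i := by
  obtain ⟨e⟩ := hmono
  have hn : n ≠ 0 := by
    -- For n = 0 the solution space and hence the group are trivial, whereas a dihedral group
    -- contains a rotation distinct from a reflection.
    intro hn
    have := LinODE.subsingleton_solutionSpace_of_eq_zero (a := a) (b := b) hn
    have hsub : ∀ x y : LinODE.monodromyGroup a b, x = y := fun x y =>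
      Subtype.ext (LinearEquiv.ext fun v => Subsingleton.elim _ _)
    have h1 : DihedralGroup.r (0 : ZMod m) = DihedralGroup.sr 0 :=
      e.symm.injective (hsub _ _)
    cases h1
  have : NeZero n := ⟨hn⟩
  have : NeZero m := ⟨hm⟩
  have hfin : Finite (LinODE.monodromyGroup a b) := Finite.of_equiv _ e.symm.toEquiv
  obtain ⟨M, hMG, hM⟩ := hb.exists_localMonodromy
  have hMN : M ^ Nat.card (LinODE.monodromyGroup a b) = 1 :=
    congrArg Subtype.val (pow_card_eq_one' (x := (⟨M, hMG⟩ : LinODE.monodromyGroup a b)))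
  obtain ⟨f, hf⟩ := hb.exists_eigenbasis hFuchs hlam hdist hM Nat.card_pos.ne' hMN
  have hexp : ∀ i (y : LinODE.solutionSpace a b), y ≠ 0 →
      M y = Complex.exp (2 * Real.pi * Complex.I * lam i) • y → hb.HasExponent y (lam i) := by
    intro i y hy0 hy
    obtain ⟨j, hj, hχ⟩ := hb.exists_index hFuchs hlam hM hy0 hy
    obtain rfl := LinODE.eq_of_exp_eq hdist hχ
    exact hj
  obtain ⟨g, hg, hgM⟩ := LinODE.exists_sqrt_of_eigenbasis hFuchs hb hm e hMG hM
    (χ := fun i => Complex.exp (2 * Real.pi * Complex.I * lam i))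
    -- The squares of all eigenvalues e^{2πiλ_i} equal 1 exactly when all λ_i are half-integers,
    -- which is the exceptional case of the hypothesis for n = 2.
    (fun i j h => LinODE.eq_of_exp_eq hdist h) hf (fun hn2 hsq => hexc hn2 fun i => by
      have h1 := hsq i
      simp only [← Complex.exp_nat_mul] at h1
      obtain ⟨k, hk⟩ := Complex.exp_eq_one_iff.1 h1
      refine ⟨k, mul_right_cancel₀ Complex.two_pi_I_ne_zero ?_⟩
      rw [← hk]
      push_cast
      ring)
  refine ⟨g, f, fun i => ⟨hg i, (hexp i _ (f.ne_zero i) (hf i)).hasVanishingOrder⟩,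
    fun i y hy hyord => ?_⟩
  by_cases hy0 : y = 0
  · exact ⟨0, by rw [hy0, zero_smul]⟩
  obtain ⟨ζ, hζ⟩ := hgM y hy
  obtain ⟨j, hj, hχ⟩ := hb.exists_index hFuchs hlam hM hy0 hζ
  -- The solution y has an exponent λ_j as an eigenvector, and its vanishing order λ_i must equal
  -- that exponent.
  have hji : j = i := by
    by_contra hne
    refine hdist j i hne 0 ?_
    rw [hj.eq_of_hasVanishingOrder hyord, sub_self, Int.cast_zero]
  subst hji
  rw [hχ] at hζ
  exact hb.eigenspace_le_one hFuchs hlam hdist hM (f.ne_zero j) (hf j) hζ
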